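/- **Notation.** Let $p$ be a prime and let $\mathbf c=(c_1\le c_2\le\dots)$ be a non-decreasing sequence of positive integers. Let $A(p,\mathbf c)$ be the group with generators $a_i$ ($i\in\mathbb Z$) and defining relations $a_i^p=1$ ($i\in\mathbb Z$) and $[\dots[[a_{i_0},a_{i_1}],a_{i_2}],\dots,a_{i_{c_n}}]=1$ for all $n\ge 1$ and all $i_0,\dots,i_{c_n}\in\mathbb Z$ with $\max_{j,k}|i_j-i_k|\le n$. Let $G(p,\mathbf c)=A(p,\mathbf c)\rtimes\langle t\rangle$, where $t$ has infinite order and $ta_it^{-1}=a_{i+1}$ for all $i\in\mathbb Z$. For a group $G$ with a finite generating set $S$, a non-principal ultrafilter $\omega$ on $\mathbb N$ and a scaling sequence $d=(d_n)$ (an unbounded non-decreasing sequence of positive reals), $\mathrm{Con}^\omega(G,d)$ denotes the asymptotic cone of $G$ with the word metric of $S$: the set of sequences $(g_n)$ in $G$ with $\sup_n |g_n|_S/d_n<\infty$, with the pseudometric $\lim^\omega |f_n^{-1}g_n|_S/d_n$, where sequences at distance $0$ are identified. An $\mathbb R$-tree is a geodesic metric space in which any two distinct points are joined by a unique topological arc.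 The class of elementary amenable groups is the smallest class of groups that contains all finite and all abelian groups and is closed under subgroups, quotients, extensions and directed unions. **Theorem.** Let $p$ be a prime. 1. For every non-decreasing sequence $\mathbf c$ of positive integers, the group $G=G(p,\mathbf c)$ has the following properties: $G$ is 2-generated; $G$ is (locally nilpotent $p$-group)-by-(infinite cyclic); $G$ is elementary amenable, and amenable; $G$ admits an epimorphism onto the restricted wreath product $(\mathbb Z/p\mathbb Z)\,\mathrm{wr}\,\mathbb Z$; $G$ is not virtually cyclic; $G$ is residually (finite $p$-group) and residually nilpotent. 2. There is a non-decreasing sequence $\mathbf c$ of positive integers such that $G=G(p,\mathbf c)$ has the following two properties. - There is a scaling sequence $d$ such that for every non-principal ultrafilter $\omega$ on $\mathbb N$ and every finite generating set of $G$, the asymptotic cone $\mathrm{Con}^\omega(G,d)$ is an $\mathbb R$-tree. - For every finite generating set of $G$, there are non-principal ultrafilters $\omega_1,\omega_2$ and scaling sequences $d_1,d_2$ such that $\mathrm{Con}^{\omega_1}(G,d_1)$ and $\mathrm{Con}^{\omega_2}(G,d_2)$ are not homeomorphic. In particular, some finitely generated amenable group has two non-homeomorphic asymptotic cones. -/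

import Mathlib

open Filter Topology
open scoped commutatorElement

universe u

/-! ### Group-theoretic properties -/

/-- `G` is generated by (at most) two elements. -/
def IsTwoGenerated (G : Type*) [Group G] : Prop :=
  ∃ a b : G, Subgroup.closure {a, b} = ⊤

/-- `G` has a cyclic subgroup of finite index. -/
def IsVirtuallyCyclic (G : Type*) [Group G] : Prop :=
  ∃ H : Subgroup G, IsCyclic H ∧ H.FiniteIndex

/-- Every finitely generated subgroup of `G` is nilpotent. -/
def IsLocallyNilpotent (G : Type*) [Group G] : Prop :=
  ∀ H : Subgroup G, H.FG → Group.IsNilpotent H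

/-- `G` is (locally nilpotent `p`-group)-by-(infinite cyclic). -/
def IsLocallyNilpotentPGroupByInfiniteCyclic (p : ℕ) (G : Type*) [Group G] : Prop :=
  ∃ (N : Subgroup G) (_ : N.Normal), IsLocallyNilpotent N ∧ IsPGroup p N ∧
    Nonempty (G ⧸ N ≃* Multiplicative ℤ)

/-- `G` is residually (finite `p`-group). -/
def IsResiduallyFinitePGroup (p : ℕ) (G : Type*) [Group G] : Prop :=
  ∀ g : G, g ≠ 1 → ∃ (N : Subgroup G) (_ : N.Normal),
    g ∉ N ∧ Finite (G ⧸ N) ∧ IsPGroup p (G ⧸ N)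

/-- `G` is residually nilpotent. -/
def IsResiduallyNilpotent (G : Type*) [Group G] : Prop :=
  ∀ g : G, g ≠ 1 → ∃ (N : Subgroup G) (_ : N.Normal), g ∉ N ∧ Group.IsNilpotent (G ⧸ N)

/-- The class of elementary amenable groups: the smallest class of groups that contains all finite
and all abelian groups and is closed under subgroups, quotients, extensions and directed unions.
(Subgroups and quotients are taken up to isomorphism, as domains of injective and codomains of
surjective homomorphisms; so the class is closed under isomorphism.) -/
inductive IsElementaryAmenable : (G : Type u) → [Group G] → Prop
  | of_finite (G : Type u) [Group G] [Finite G] : IsElementaryAmenable G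
  | of_comm (G : Type u) [Group G] (h : ∀ a b : G, a * b = b * a) : IsElementaryAmenable G
  | of_injective {G H : Type u} [Group G] [Group H] (f : H →* G) (hf : Function.Injective f)
      (hG : IsElementaryAmenable G) : IsElementaryAmenable H
  | of_surjective {G H : Type u} [Group G] [Group H] (f : G →* H) (hf : Function.Surjective f)
      (hG : IsElementaryAmenable G) : IsElementaryAmenable H
  | of_extension {G : Type u} [Group G] (N : Subgroup G) [N.Normal]
      (hN : IsElementaryAmenable N) (hQ : IsElementaryAmenable (G ⧸ N)) : IsElementaryAmenable G
  | of_directed {G : Type u} [Group G] (K : Set (Subgroup G)) (hne : K.Nonempty)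
      (hdir : DirectedOn (· ≤ ·) K) (hK : ∀ H ∈ K, IsElementaryAmenable H)
      (htop : ∀ g : G, ∃ H ∈ K, g ∈ H) : IsElementaryAmenable G

/-- Amenability of a discrete group: there is a left-invariant finitely additive probability
measure defined on all subsets. -/
def IsAmenableGroup (G : Type*) [Group G] : Prop :=
  ∃ μ : Set G → ℝ, (∀ A, 0 ≤ μ A) ∧ μ Set.univ = 1 ∧
    (∀ A B, Disjoint A B → μ (A ∪ B) = μ A + μ B) ∧
    ∀ (g : G) (A : Set G), μ ((fun x => g * x) '' A) = μ A

/-! ### The groups `A(p, c)`, `G(p, c)` and the wreath product `(ℤ/p) wr ℤ` -/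

/-- The left-normed commutator `[…[[x₀, x₁], x₂], …, xₖ]`. -/
def leftNormedCommutator {G : Type*} [Group G] (x : ℕ → G) : ℕ → G
  | 0 => x 0
  | k + 1 => ⁅leftNormedCommutator x k, x (k + 1)⁆

theorem map_leftNormedCommutator {G H : Type*} [Group G] [Group H] (f : G →* H) (x : ℕ → G)
    (k : ℕ) :
    f (leftNormedCommutator x k) = leftNormedCommutator (fun j => f (x j)) k := by
  induction k with
  | zero => rfl
  | succ k ih => simp [leftNormedCommutator, map_commutatorElement, ih]

/-- The relators `a_i ^ p` (`i ∈ ℤ`) and `[…[a_{i₀}, a_{i₁}], …, a_{i_{c n}}]` for all `n ≥ 1` and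
all indices `i₀, …, i_{c n}` that pairwise differ by at most `n`. -/
def relatorsA (p : ℕ) (c : ℕ+ → ℕ+) : Set (FreeGroup ℤ) :=
  {w | ∃ i : ℤ, w = FreeGroup.of i ^ p} ∪
  {w | ∃ (n : ℕ+) (i : ℕ → ℤ),
    (∀ j ≤ (c n : ℕ), ∀ k ≤ (c n : ℕ), |i j - i k| ≤ (n : ℤ)) ∧
    w = leftNormedCommutator (fun j => FreeGroup.of (i j)) (c n)}

/-- The group `A(p, c)`. -/
abbrev GroupA (p : ℕ) (c : ℕ+ → ℕ+) : Type := PresentedGroup (relatorsA p c)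

namespace GroupA

variable (p : ℕ) (c : ℕ+ → ℕ+)

theorem lift_shift_relators (m : ℤ) :
    ∀ r ∈ relatorsA p c,
      FreeGroup.lift (fun i : ℤ => (PresentedGroup.of (i + m) : GroupA p c)) r = 1 := by
  rintro r (⟨i, rfl⟩ | ⟨n, i, hi, rfl⟩)
  · have h : (PresentedGroup.mk (relatorsA p c)) (FreeGroup.of (i + m) ^ p) = 1 :=
      PresentedGroup.one_of_mem (Or.inl ⟨i + m, rfl⟩)
    rw [map_pow] at h ⊢
    rw [FreeGroup.lift_apply_of]
    exact h
  · have h : (PresentedGroup.mk (relatorsA p c))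
        (leftNormedCommutator (fun j => FreeGroup.of (i j + m)) (c n)) = 1 :=
      PresentedGroup.one_of_mem (Or.inr ⟨n, fun j => i j + m, by simpa using hi, rfl⟩)
    rw [map_leftNormedCommutator] at h ⊢
    simp only [FreeGroup.lift_apply_of]
    exact h

/-- The endomorphism `a_i ↦ a_{i + m}` of `A(p, c)`. -/
def shiftHom (m : ℤ) : GroupA p c →* GroupA p c :=
  PresentedGroup.toGroup (lift_shift_relators p c m)

/-- The automorphism `a_i ↦ a_{i + 1}` of `A(p, c)`. -/
def shift : MulAut (GroupA p c) :=
  MonoidHom.toMulEquiv (shiftHom p c 1) (shiftHom p c (-1))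
    (PresentedGroup.ext fun i => by simp [shiftHom])
    (PresentedGroup.ext fun i => by simp [shiftHom])

theorem shift_of (i : ℤ) :
    shift p c (PresentedGroup.of i) = PresentedGroup.of (i + 1) := by
  simp [shift, shiftHom]

end GroupA

/-- The group `G(p, c)`: the extension of `A(p, c)` by an element `t` of infinite order that acts
by `t a_i t⁻¹ = a_{i + 1}`, that is, the semidirect product of `A(p, c)` and `ℤ`. -/
abbrev GroupG (p : ℕ) (c : ℕ+ → ℕ+) : Type :=
  GroupA p c ⋊[zpowersHom (MulAut (GroupA p c)) (GroupA.shift p c)] Multiplicative ℤ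

/-- The shift by one of the base group `⨁_ℤ ℤ/p` of the wreath product. -/
noncomputable def baseShift (p : ℕ) : MulAut (Multiplicative (ℤ →₀ ZMod p)) :=
  AddEquiv.toMultiplicative (Finsupp.domCongr (Equiv.addRight (1 : ℤ)))

/-- The (restricted) wreath product `(ℤ/p) wr ℤ`. -/
abbrev WreathZModInt (p : ℕ) : Type :=
  Multiplicative (ℤ →₀ ZMod p) ⋊[zpowersHom (MulAut (Multiplicative (ℤ →₀ ZMod p)))
    (baseShift p)] Multiplicative ℤ

/-! ### Word metrics -/

section WordMetric

variable {G : Type*} [Group G]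

/-- `g` is represented by a word of length `n` in the letters `S ∪ S⁻¹`. -/
def IsWordOfLength (S : Set G) (n : ℕ) (g : G) : Prop :=
  ∃ l : List G, l.length = n ∧ (∀ x ∈ l, x ∈ S ∨ x⁻¹ ∈ S) ∧ l.prod = g

/-- The length of a shortest word in `S ∪ S⁻¹` that represents `g`
(used only when `S` generates the group). -/
noncomputable def wordLength (S : Set G) (g : G) : ℕ := sInf {n | IsWordOfLength S n g}

theorem exists_isWordOfLength {S : Set G} (hS : Subgroup.closure S = ⊤) (g : G) :
    ∃ n, IsWordOfLength S n g := by
  have hg : g ∈ Subgroup.closure S := hS ▸ Subgroup.mem_top g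
  rw [← Subgroup.mem_toSubmonoid, Subgroup.closure_toSubmonoid] at hg
  obtain ⟨l, hl, rfl⟩ := Submonoid.exists_list_of_mem_closure hg
  exact ⟨l.length, l, rfl, fun x hx => by simpa using hl x hx, rfl⟩

theorem isWordOfLength_wordLength {S : Set G} (hS : Subgroup.closure S = ⊤) (g : G) :
    IsWordOfLength S (wordLength S g) g :=
  Nat.sInf_mem (exists_isWordOfLength hS g)

theorem wordLength_le {S : Set G} {n : ℕ} {g : G} (h : IsWordOfLength S n g) :
    wordLength S g ≤ n :=
  Nat.sInf_le h

theorem wordLength_one (S : Set G) : wordLength S (1 : G) = 0 :=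
  Nat.le_zero.1 (wordLength_le ⟨[], rfl, by simp, rfl⟩)

theorem wordLength_inv_le {S : Set G} (hS : Subgroup.closure S = ⊤) (g : G) :
    wordLength S g⁻¹ ≤ wordLength S g := by
  obtain ⟨l, hl, hm, hp⟩ := isWordOfLength_wordLength hS g
  refine wordLength_le ⟨(l.map fun x => x⁻¹).reverse, by simpa using hl, ?_, ?_⟩
  · intro x hx
    simp only [List.mem_reverse, List.mem_map] at hx
    obtain ⟨y, hy, rfl⟩ := hx
    simpa using (hm y hy).symm
  · rw [← List.prod_inv_reverse, hp]

theorem wordLength_inv {S : Set G} (hS : Subgroup.closure S = ⊤) (g : G) :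
    wordLength S g⁻¹ = wordLength S g :=
  le_antisymm (wordLength_inv_le hS g) (by simpa using wordLength_inv_le hS g⁻¹)

theorem wordLength_mul_le {S : Set G} (hS : Subgroup.closure S = ⊤) (g h : G) :
    wordLength S (g * h) ≤ wordLength S g + wordLength S h := by
  obtain ⟨l, hl, hm, hp⟩ := isWordOfLength_wordLength hS g
  obtain ⟨l', hl', hm', hp'⟩ := isWordOfLength_wordLength hS h
  refine wordLength_le ⟨l ++ l', by simp [hl, hl'], ?_, by simp [hp, hp']⟩
  intro x hx
  rcases List.mem_append.1 hx with h1 | h1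
  exacts [hm x h1, hm' x h1]

theorem eq_one_of_wordLength_eq_zero {S : Set G} (hS : Subgroup.closure S = ⊤) {g : G}
    (h : wordLength S g = 0) : g = 1 := by
  obtain ⟨l, hl, -, hp⟩ := isWordOfLength_wordLength hS g
  rw [h, List.length_eq_zero_iff] at hl
  rw [← hp, hl, List.prod_nil]

/-- The group `G` with the word metric `dist(f, g) = |f⁻¹ g|` of a generating set `S`. -/
@[nolint unusedArguments]
def WordMetricSpace (S : Set G) (_hS : Subgroup.closure S = ⊤) : Type _ := G

noncomputable instance (S : Set G) (hS : Subgroup.closure S = ⊤) :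
    MetricSpace (WordMetricSpace S hS) where
  dist f g := (wordLength S ((show G from f)⁻¹ * (show G from g)) : ℝ)
  dist_self f := by
    show ((wordLength S ((show G from f)⁻¹ * (show G from f)) : ℕ) : ℝ) = 0
    rw [inv_mul_cancel, wordLength_one, Nat.cast_zero]
  dist_comm f g := by
    show ((wordLength S ((show G from f)⁻¹ * (show G from g)) : ℕ) : ℝ) =
      (wordLength S ((show G from g)⁻¹ * (show G from f)) : ℕ)
    rw [← wordLength_inv hS, mul_inv_rev, inv_inv]
  dist_triangle f g h := by
    show ((wordLength S ((show G from f)⁻¹ * (show G from h)) : ℕ) : ℝ) ≤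
      (wordLength S ((show G from f)⁻¹ * (show G from g)) : ℕ) +
      (wordLength S ((show G from g)⁻¹ * (show G from h)) : ℕ)
    have := wordLength_mul_le hS ((show G from f)⁻¹ * (show G from g))
      ((show G from g)⁻¹ * (show G from h))
    rw [mul_assoc, mul_inv_cancel_left] at this
    exact_mod_cast this
  eq_of_dist_eq_zero {f g} hfg := by
    have h : ((wordLength S ((show G from f)⁻¹ * (show G from g)) : ℕ) : ℝ) = 0 := hfg
    have h1 := eq_one_of_wordLength_eq_zero hS (Nat.cast_eq_zero.1 h)
    exact (inv_mul_eq_one (G := G)).1 h1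

/-- An element of `G`, viewed as a point of `WordMetricSpace S hS`. -/
def WordMetricSpace.of {S : Set G} {hS : Subgroup.closure S = ⊤} (g : G) : WordMetricSpace S hS := g

theorem WordMetricSpace.dist_of {S : Set G} {hS : Subgroup.closure S = ⊤} (f g : G) :
    dist (WordMetricSpace.of f : WordMetricSpace S hS) (WordMetricSpace.of g) =
      wordLength S (f⁻¹ * g) := rfl

end WordMetric

/-! ### Asymptotic cones -/

/-- A scaling sequence: an unbounded non-decreasing sequence of positive real numbers. -/
structure ScalingSequence where
  toFun : ℕ → ℝ
  pos : ∀ n, 0 < toFun n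
  mono : Monotone toFun
  unbounded : ¬ BddAbove (Set.range toFun)

instance : CoeFun ScalingSequence fun _ => ℕ → ℝ := ⟨ScalingSequence.toFun⟩

/-- An ultrafilter on `ℕ` is non-principal if it contains no finite set. -/
def IsNonprincipal (ω : Ultrafilter ℕ) : Prop := ∀ s : Set ℕ, s.Finite → s ∉ ω

/-- The limit `lim^ω x_n` of a (bounded) sequence of real numbers along an ultrafilter. -/
noncomputable def omegaLim (ω : Ultrafilter ℕ) (x : ℕ → ℝ) : ℝ := limUnder (ω : Filter ℕ) x

theorem tendsto_omegaLim (ω : Ultrafilter ℕ) {x : ℕ → ℝ} {a b : ℝ} (ha : ∀ n, a ≤ x n)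
    (hb : ∀ n, x n ≤ b) : Tendsto x ω (𝓝 (omegaLim ω x)) := by
  have h : Set.Icc a b ∈ ω.map x :=
    Ultrafilter.mem_map.2 (Filter.mem_of_superset Filter.univ_mem fun n _ => ⟨ha n, hb n⟩)
  obtain ⟨y, -, hy⟩ := isCompact_Icc.ultrafilter_le_nhds' (ω.map x) h
  exact tendsto_nhds_limUnder ⟨y, hy⟩

section Cone

variable {X : Type*} [MetricSpace X]

/-- The sequences `(x_n)` in `X` that stay at bounded distance from the observation points `e_n`
in the rescaled metrics `dist / d_n`. The ultrafilter is recorded because it determines the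
pseudometric below. -/
structure ConeSeq (ω : Ultrafilter ℕ) (X : Type*) [MetricSpace X] (e : ℕ → X)
    (d : ScalingSequence) where
  toFun : ℕ → X
  bounded : ∃ C : ℝ, ∀ n, dist (toFun n) (e n) / d n ≤ C

instance (ω : Ultrafilter ℕ) (e : ℕ → X) (d : ScalingSequence) :
    CoeFun (ConeSeq ω X e d) fun _ => ℕ → X := ⟨ConeSeq.toFun⟩

theorem ConeSeq.tendsto {ω : Ultrafilter ℕ} {e : ℕ → X} {d : ScalingSequence}
    (f g : ConeSeq ω X e d) :
    Tendsto (fun n => dist (f n) (g n) / d n) ω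
      (𝓝 (omegaLim ω fun n => dist (f n) (g n) / d n)) := by
  obtain ⟨C, hC⟩ := f.bounded
  obtain ⟨D, hD⟩ := g.bounded
  refine tendsto_omegaLim ω (a := 0) (b := C + D)
    (fun n => div_nonneg dist_nonneg (d.pos n).le) fun n => ?_
  calc dist (f n) (g n) / d n
      ≤ (dist (f n) (e n) + dist (g n) (e n)) / d n :=
        div_le_div_of_nonneg_right (dist_triangle_right _ _ _) (d.pos n).le
    _ ≤ C + D := by rw [add_div]; exact add_le_add (hC n) (hD n)

/-- The pseudometric `lim^ω (dist(f_n, g_n) / d_n)`. -/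
noncomputable instance (ω : Ultrafilter ℕ) (e : ℕ → X) (d : ScalingSequence) :
    PseudoMetricSpace (ConeSeq ω X e d) where
  dist f g := omegaLim ω fun n => dist (f n) (g n) / d n
  dist_self f := by
    have h := f.tendsto f
    simp only [dist_self, zero_div] at h
    simpa using tendsto_nhds_unique h tendsto_const_nhds
  dist_comm f g := by simp only [dist_comm]
  dist_triangle f g h := by
    refine le_of_tendsto_of_tendsto' (f.tendsto h) ((f.tendsto g).add (g.tendsto h)) fun n => ?_
    rw [← add_div]
    exact div_le_div_of_nonneg_right (dist_triangle _ _ _) (d.pos n).le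

/-- The asymptotic cone `Con^ω(X, e, d)`: the quotient of the space of sequences above in which
sequences at distance `0` are identified. -/
abbrev AsymptoticCone (ω : Ultrafilter ℕ) (X : Type*) [MetricSpace X] (e : ℕ → X)
    (d : ScalingSequence) : Type _ := SeparationQuotient (ConeSeq ω X e d)

end Cone

/-- The asymptotic cone `Con^ω(G, d)` of a group `G` with the word metric of a generating set `S`
(observed from the identity). -/
abbrev GroupAsymptoticCone {G : Type*} [Group G] (S : Set G) (hS : Subgroup.closure S = ⊤)
    (ω : Ultrafilter ℕ) (d : ScalingSequence) : Type _ :=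
  AsymptoticCone ω (WordMetricSpace S hS) (fun _ => WordMetricSpace.of 1) d

/-! ### `ℝ`-trees -/

/-- Any two points `x, y` are joined by a geodesic, an isometric copy of `[0, dist x y]`. -/
def IsGeodesicSpace (X : Type*) [MetricSpace X] : Prop :=
  ∀ x y : X, ∃ γ : ℝ → X, γ 0 = x ∧ γ (dist x y) = y ∧
    ∀ s ∈ Set.Icc 0 (dist x y), ∀ t ∈ Set.Icc 0 (dist x y), dist (γ s) (γ t) = |s - t|

/-- An `ℝ`-tree: a geodesic metric space in which any two topological arcs with the same endpoints
have the same image (so that two distinct points are joined by a unique arc, a geodesic). -/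
def IsRealTree (X : Type*) [MetricSpace X] : Prop :=
  IsGeodesicSpace X ∧
    ∀ α β : C(unitInterval, X), Function.Injective α → Function.Injective β →
      α 0 = β 0 → α 1 = β 1 → Set.range α = Set.range β

/-!
The subgroup of `A(p, c)` generated by finitely many consecutive `a i` is a finite `p`-group, so
`A(p, c)` is a locally finite `p`-group. Folding `ℤ` onto `ℤ/q`, with `q` a large power of `p`,
maps `G(p, c)` into wreath products of these finite groups with `ℤ/q`, and these maps separate
points.

Keeping only the commutator relations of spread at most `N` gives an HNN extension of a finite
group, which acts on a tree with finite stabilisers and is therefore hyperbolic. By residual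
finiteness (by finite `p`-groups), the commutator relations of larger spread leave any prescribed
ball of this group unchanged as soon as the classes `c (N + 1) ≤ c (N + 2) ≤ …` are large. Choosing
the classes successively, the ball of radius `(n + 1)² (δ n + 1)` satisfies the four-point condition
with constant `δ n`, and the cones for the scaling sequence `(n + 1) (δ n + 1)` are geodesic and
`0`-hyperbolic, hence trees.

A cone that is not a tree comes from finite subgroups `F n` whose orders are unbounded: let `d n` be
the least radius of a ball containing a conjugate of `F n`, and replace `F n` by that conjugate. If
the cone were a tree, then elements of `F n` would move the midpoint of the identity and an element
of `F n` of length `d n` by less than `d n`, asymptotically. This contradicts minimality.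
-/

/-! ### Left-normed commutators -/

section LeftNormedCommutator

variable {G : Type*} [Group G]

theorem leftNormedCommutator_congr {x y : ℕ → G} {k : ℕ} (h : ∀ j ≤ k, x j = y j) :
    leftNormedCommutator x k = leftNormedCommutator y k := by
  induction k with
  | zero => exact h 0 le_rfl
  | succ k ih =>
    simp only [leftNormedCommutator]
    rw [ih fun j hj => h j (hj.trans k.le_succ), h (k + 1) le_rfl]

theorem leftNormedCommutator_eq_one_of_eq_one {x : ℕ → G} {j k : ℕ} (hjk : j ≤ k)
    (h : x j = 1) : leftNormedCommutator x k = 1 := by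
  induction k with
  | zero => obtain rfl := Nat.le_zero.1 hjk; exact h
  | succ k ih =>
    simp only [leftNormedCommutator]
    rcases Nat.le_succ_iff.1 hjk with hj | rfl
    · rw [ih hj, commutatorElement_one_left]
    · rw [h, commutatorElement_one_right]

theorem leftNormedCommutator_mem_lowerCentralSeries (x : ℕ → G) (k : ℕ) :
    leftNormedCommutator x k ∈ (⊤ : Subgroup G).lowerCentralSeries k := by
  induction k with
  | zero => simp
  | succ k ih =>
    rw [Subgroup.lowerCentralSeries_succ]
    exact Subgroup.subset_closure ⟨_, ih, _, Subgroup.mem_top _, rfl⟩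

theorem commutatorElement_pow_right_of_commute {g x : G} (h : Commute ⁅g, x⁆ x) (n : ℕ) :
    ⁅g, x ^ n⁆ = ⁅g, x⁆ ^ n := by
  have hconj : g * x * g⁻¹ = ⁅g, x⁆ * x := by simp [commutatorElement_def]
  rw [commutatorElement_def, ← conj_pow, hconj, h.mul_pow, mul_inv_cancel_right]

/-- The left-normed commutators of weight `k + 1` with entries in `X`. -/
def leftNormedCommutators (X : Set G) (k : ℕ) : Set G :=
  {w | ∃ x : ℕ → G, (∀ j, x j ∈ X) ∧ leftNormedCommutator x k = w}

variable {X : Set G} {k n : ℕ}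

theorem finite_leftNormedCommutators (hX : X.Finite) (k : ℕ) :
    (leftNormedCommutators X k).Finite := by
  have : Finite X := hX
  refine (Set.finite_range fun f : Fin (k + 1) → X =>
    leftNormedCommutator (fun j => if h : j < k + 1 then (f ⟨j, h⟩ : G) else 1) k).subset ?_
  rintro _ ⟨x, hx, rfl⟩
  refine ⟨fun j => ⟨x j, hx j⟩, leftNormedCommutator_congr fun j hj => ?_⟩
  simp [Nat.lt_succ_of_le hj]

theorem image_leftNormedCommutators {H : Type*} [Group H] (f : G →* H) (X : Set G) (k : ℕ) :
    f '' leftNormedCommutators X k = leftNormedCommutators (f '' X) k := by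
  ext w
  constructor
  · rintro ⟨_, ⟨x, hx, rfl⟩, rfl⟩
    exact ⟨_, fun j => ⟨x j, hx j, rfl⟩, (map_leftNormedCommutator f x k).symm⟩
  · rintro ⟨y, hy, rfl⟩
    choose x hx hxy using hy
    exact ⟨_, ⟨x, hx, rfl⟩, by rw [map_leftNormedCommutator, funext hxy]⟩

theorem leftNormedCommutators_subset_center (hX : Subgroup.closure X = ⊤)
    (h : leftNormedCommutators X (k + 1) ⊆ {1}) :
    leftNormedCommutators X k ⊆ Subgroup.center G := by
  rintro _ ⟨x, hx, rfl⟩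
  suffices hc : (⊤ : Subgroup G) ≤ Subgroup.centralizer {leftNormedCommutator x k} from
    Subgroup.mem_center_iff.2 fun g =>
      Subgroup.mem_centralizer_singleton_iff.1 (hc (Subgroup.mem_top g))
  rw [← hX, Subgroup.closure_le]
  intro g hg
  have hcomm : ⁅leftNormedCommutator x k, g⁆ = 1 :=
    h ⟨fun j => if j ≤ k then x j else g, fun j => by dsimp only; split_ifs; exacts [hx j, hg], by
      rw [leftNormedCommutator, leftNormedCommutator_congr (y := x) fun j hj => if_pos hj]
      simp⟩
  exact Subgroup.mem_centralizer_singleton_iff.2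
    (commutatorElement_eq_one_iff_mul_comm.1 hcomm).symm

theorem pow_eq_one_of_mem_leftNormedCommutators
    (hc : leftNormedCommutators X k ⊆ Subgroup.center G) (hX : ∀ x ∈ X, x ^ n = 1) :
    ∀ w ∈ leftNormedCommutators X k, w ^ n = 1 := by
  rintro _ ⟨x, hx, rfl⟩
  cases k with
  | zero => exact hX _ (hx 0)
  | succ k =>
    have hcomm := (Subgroup.mem_center_iff.1 (hc ⟨x, hx, rfl⟩) (x (k + 1))).symm
    rw [leftNormedCommutator, ← commutatorElement_pow_right_of_commute hcomm, hX _ (hx _),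
      commutatorElement_one_right]

theorem pow_eq_one_of_mem_closure (hc : X ⊆ Subgroup.center G) (hX : ∀ x ∈ X, x ^ n = 1) :
    ∀ x ∈ Subgroup.closure X, x ^ n = 1 := by
  intro x hx
  induction hx using Subgroup.closure_induction with
  | mem x hx => exact hX x hx
  | one => exact one_pow _
  | mul x y _ hy hx' hy' =>
    have hcomm : Commute x y :=
      Subgroup.mem_center_iff.1 ((Subgroup.closure_le _).2 hc hy) x
    rw [hcomm.mul_pow, hx', hy', one_mul]
  | inv x _ hx' => rw [inv_pow, hx', inv_one]

theorem finite_closure_of_subset_center (hfin : X.Finite) (hc : X ⊆ Subgroup.center G)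
    (hn : 0 < n) (hX : ∀ x ∈ X, x ^ n = 1) : Finite (Subgroup.closure X) := by
  have hcenter : Subgroup.closure X ≤ Subgroup.center G := (Subgroup.closure_le _).2 hc
  let _ : CommGroup (Subgroup.closure X) := { (inferInstance : Group (Subgroup.closure X)) with
    mul_comm := fun x y => Subtype.ext (Subgroup.mem_center_iff.1 (hcenter y.2) x) }
  have : Group.FG (Subgroup.closure X) :=
    (Group.fg_iff_subgroup_fg _).2 ((Subgroup.fg_iff _).2 ⟨X, rfl, hfin⟩)
  exact CommGroup.finite_of_fg_isMulTorsion _ fun x => isOfFinOrder_iff_pow_eq_one.2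
    ⟨n, hn, Subtype.ext (pow_eq_one_of_mem_closure hc hX x x.2)⟩

/-- Induction on the weight: the longest nontrivial commutators generate a central subgroup of
exponent `p`. -/
theorem finite_and_isPGroup_of_leftNormedCommutators_subset {p : ℕ} (hp : 0 < p) (c : ℕ) :
    ∀ {H : Type*} [Group H] {X : Set H}, X.Finite → Subgroup.closure X = ⊤ →
      (∀ x ∈ X, x ^ p = 1) → leftNormedCommutators X c ⊆ {1} → Finite H ∧ IsPGroup p H := by
  induction c with
  | zero =>
    intro H _ X _ hgen _ hX
    have hbot : Subgroup.closure X = ⊥ :=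
      Subgroup.closure_eq_bot_iff.2 fun x hx => hX ⟨fun _ => x, fun _ => hx, rfl⟩
    have : Subsingleton H :=
      Subgroup.subsingleton_iff.1 (subsingleton_of_bot_eq_top (hbot.symm.trans hgen))
    exact ⟨inferInstance, fun g => ⟨0, Subsingleton.elim _ _⟩⟩
  | succ c ih =>
    intro H _ X hfin hgen hpow hX
    set Y := leftNormedCommutators X c
    have hYc : Y ⊆ Subgroup.center H := leftNormedCommutators_subset_center hgen hX
    have hYp : ∀ w ∈ Y, w ^ p = 1 := pow_eq_one_of_mem_leftNormedCommutators hYc hpow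
    set Z := Subgroup.closure Y
    have hZc : Z ≤ Subgroup.center H := (Subgroup.closure_le _).2 hYc
    have hZp : ∀ z ∈ Z, z ^ p = 1 := pow_eq_one_of_mem_closure hYc hYp
    have : Z.Normal := ⟨fun z hz g => by
      rwa [Subgroup.mem_center_iff.1 (hZc hz) g, mul_inv_cancel_right]⟩
    have : Finite Z :=
      finite_closure_of_subset_center (finite_leftNormedCommutators hfin c) hYc hp hYp
    obtain ⟨_, hQp⟩ := ih (X := QuotientGroup.mk' Z '' X) (hfin.image _)
      (by rw [← MonoidHom.map_closure, hgen,
            Subgroup.map_top_of_surjective _ (QuotientGroup.mk'_surjective Z)])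
      (by rintro _ ⟨x, hx, rfl⟩; rw [← map_pow, hpow x hx, map_one])
      (by
        rw [← image_leftNormedCommutators]
        rintro _ ⟨w, hw, rfl⟩
        exact (QuotientGroup.eq_one_iff w).2 (Subgroup.subset_closure hw))
    refine ⟨Finite.of_equiv _ (Subgroup.groupEquivQuotientProdSubgroup (s := Z)).symm, fun g => ?_⟩
    obtain ⟨k, hk⟩ := hQp (QuotientGroup.mk' Z g)
    rw [← map_pow, QuotientGroup.mk'_apply, QuotientGroup.eq_one_iff] at hk
    exact ⟨k + 1, by rw [pow_succ, pow_mul, hZp _ hk]⟩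

end LeftNormedCommutator

/-! ### Locally finite groups and semidirect products -/

/-- Every finitely generated subgroup of `G` is finite. -/
def IsLocallyFiniteGroup (G : Type*) [Group G] : Prop :=
  ∀ H : Subgroup G, H.FG → Finite H

namespace IsLocallyFiniteGroup

theorem of_injective {G H : Type*} [Group G] [Group H] (hG : IsLocallyFiniteGroup G) (f : H →* G)
    (hf : Function.Injective f) : IsLocallyFiniteGroup H := fun K hK => by
  obtain ⟨S, rfl, hS⟩ := (Subgroup.fg_iff _).1 hK
  have := hG ((Subgroup.closure S).map f)
    ((Subgroup.fg_iff _).2 ⟨f '' S, (MonoidHom.map_closure f S).symm, hS.image f⟩)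
  exact Finite.of_equiv _ ((Subgroup.closure S).equivMapOfInjective f hf).symm.toEquiv

theorem isLocallyNilpotent {G : Type*} [Group G] (hG : IsLocallyFiniteGroup G) {p : ℕ}
    [Fact p.Prime] (hp : IsPGroup p G) : IsLocallyNilpotent G := fun H hH => by
  have := hG H hH
  exact (hp.to_subgroup H).isNilpotent

theorem isElementaryAmenable {G : Type u} [Group G] (hG : IsLocallyFiniteGroup G) :
    IsElementaryAmenable G := by
  refine .of_directed {H | H.FG} ⟨⊥, Subgroup.FG.bot⟩ ?_ (fun H hH => ?_) fun g => ?_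
  · exact fun H hH K hK => ⟨H ⊔ K, hH.sup hK, le_sup_left, le_sup_right⟩
  · have := hG H hH
    exact .of_finite H
  · exact ⟨Subgroup.zpowers g, (Subgroup.fg_iff _).2
      ⟨{g}, (Subgroup.zpowers_eq_closure g).symm, Set.finite_singleton g⟩,
      Subgroup.mem_zpowers g⟩

end IsLocallyFiniteGroup

section SemidirectProduct

open SemidirectProduct

variable {N Q : Type*} [Group N] [Group Q] (φ : Q →* MulAut N)

/-- The normal factor of a semidirect product, as the kernel of the projection to the other
factor. -/
noncomputable def mulEquivKerRightHom : N ≃* (rightHom : N ⋊[φ] Q →* Q).ker :=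
  (MonoidHom.ofInjective inl_injective).trans (MulEquiv.subgroupCongr range_inl_eq_ker_rightHom)

theorem isElementaryAmenable_semidirectProduct {N Q : Type u} [Group N] [Group Q]
    (φ : Q →* MulAut N) (hN : IsElementaryAmenable N)
    (hQ : IsElementaryAmenable Q) : IsElementaryAmenable (N ⋊[φ] Q) :=
  .of_extension (rightHom : N ⋊[φ] Q →* Q).ker
    (.of_injective (mulEquivKerRightHom φ).symm.toMonoidHom (MulEquiv.injective _) hN)
    (.of_injective
      (QuotientGroup.quotientKerEquivOfSurjective _ rightHom_surjective).toMonoidHom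
      (MulEquiv.injective _) hQ)

theorem isLocallyNilpotentPGroupByInfiniteCyclic_semidirectProduct
    (φ : Multiplicative ℤ →* MulAut N) {p : ℕ} [Fact p.Prime] (hN : IsLocallyFiniteGroup N)
    (hp : IsPGroup p N) :
    IsLocallyNilpotentPGroupByInfiniteCyclic p (N ⋊[φ] Multiplicative ℤ) := by
  have hker := hp.of_equiv (mulEquivKerRightHom φ)
  exact ⟨rightHom.ker, inferInstance,
    (hN.of_injective (mulEquivKerRightHom φ).symm.toMonoidHom
      (MulEquiv.injective _)).isLocallyNilpotent hker, hker,
    ⟨QuotientGroup.quotientKerEquivOfSurjective _ rightHom_surjective⟩⟩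

end SemidirectProduct

theorem not_isVirtuallyCyclic_of_injective {G T : Type*} [Group G] [Group T] [Infinite T]
    (hT : IsMulTorsion T) (f : T →* G) (hf : Function.Injective f) :
    ¬ IsVirtuallyCyclic G := by
  rintro ⟨H, _, _⟩
  have : (H.comap f).FiniteIndex := ⟨by
    rw [Subgroup.index_comap]
    exact (Subgroup.instFiniteIndex_subgroupOf H f.range).index_ne_zero⟩
  have : IsCyclic (H.comap f) := isCyclic_of_injective (f.subgroupComap H) fun x y hxy =>
    Subtype.ext (hf (congrArg Subtype.val hxy))
  have : Finite (H.comap f) := by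
    obtain ⟨g, hg⟩ := IsCyclic.exists_generator (α := H.comap f)
    have hzpowers : (Subgroup.zpowers g : Set (H.comap f)).Finite :=
      finite_zpowers.2 ((hT.subgroup _) g)
    rw [(Subgroup.eq_top_iff' _).2 hg, Subgroup.coe_top] at hzpowers
    exact Set.finite_univ_iff.1 hzpowers
  exact not_finite_iff_infinite.2 ‹Infinite T›
    (Finite.of_equiv _ (Subgroup.groupEquivQuotientProdSubgroup (s := H.comap f)).symm)

theorem exists_normal_notMem_of_hom {G T : Type*} [Group G] [Group T] [Finite T] {p : ℕ}
    (hT : IsPGroup p T) (f : G →* T) {g : G} (hg : f g ≠ 1) :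
    ∃ (N : Subgroup G) (_ : N.Normal), g ∉ N ∧ Finite (G ⧸ N) ∧ IsPGroup p (G ⧸ N) :=
  ⟨f.ker, inferInstance, hg, Finite.of_injective _ (QuotientGroup.kerLift_injective f),
    hT.of_injective _ (QuotientGroup.kerLift_injective f)⟩

theorem IsResiduallyFinitePGroup.of_injective {G H : Type*} [Group G] [Group H] {p : ℕ}
    (h : IsResiduallyFinitePGroup p H) (f : G →* H) (hf : Function.Injective f) :
    IsResiduallyFinitePGroup p G := by
  intro g hg
  obtain ⟨N, _, hgN, _, hN⟩ := h (f g) ((map_ne_one_iff f hf).2 hg)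
  exact exists_normal_notMem_of_hom hN ((QuotientGroup.mk' N).comp f)
    fun hg' => hgN ((QuotientGroup.eq_one_iff _).1 hg')

theorem IsResiduallyFinitePGroup.isResiduallyNilpotent {G : Type*} [Group G] {p : ℕ}
    [Fact p.Prime] (h : IsResiduallyFinitePGroup p G) : IsResiduallyNilpotent G := by
  intro g hg
  obtain ⟨N, hN, hgN, _, hpN⟩ := h g hg
  exact ⟨N, hN, hgN, hpN.isNilpotent⟩

/-! ### Amenability -/

section Amenable

open MeasureTheory SemidirectProduct
open scoped Pointwise symmDiff

theorem isAmenableGroup_of_isFoelner {G ι : Type*} [Group G] [MeasurableSpace G]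
    [DiscreteMeasurableSpace G] {l : Filter ι} [l.NeBot] {F : ι → Set G}
    (hF : IsFoelner G Measure.count l F) : IsAmenableGroup G := by
  obtain ⟨m, hm_univ, hm_union, hm_smul⟩ := hF.amenable
  have hm_ne_top : ∀ s, m s ≠ ⊤ := fun s hs => by
    have hs' := hm_union s sᶜ (.of_discrete) disjoint_compl_right
    rw [Set.union_compl_self, hm_univ, hs, top_add] at hs'
    exact ENNReal.one_ne_top hs'
  refine ⟨fun s => (m s).toReal, fun _ => ENNReal.toReal_nonneg, by simp [hm_univ],
    fun s t hst => ?_, fun g s => congrArg _ (hm_smul g s)⟩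
  dsimp only
  rw [hm_union s t .of_discrete hst, ENNReal.toReal_add (hm_ne_top s) (hm_ne_top t)]

variable {A Q : Type*} [Group A] [Group Q] (φ : Q →* MulAut A)

/-- The coordinates `(q, a)` of the element `q a` of the semidirect product `A ⋊ Q`. -/
def rightLeftEquiv : A ⋊[φ] Q ≃ Q × A where
  toFun g := (g.right, φ g.right⁻¹ g.left)
  invFun x := ⟨φ x.1 x.2, x.1⟩
  left_inv g := by simp
  right_inv x := by simp

/-- The set of products `q a` with `q ∈ I` and `a ∈ P`: for finite `I` and `P` a candidate for an
almost invariant set. -/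
def slab (I : Set Q) (P : Set A) : Set (A ⋊[φ] Q) := rightLeftEquiv φ ⁻¹' I ×ˢ P

theorem rightLeftEquiv_mul (r : Q) (a : A) (g : A ⋊[φ] Q) :
    rightLeftEquiv φ (inr r * inl a * g) =
      (r * (rightLeftEquiv φ g).1, φ g.right⁻¹ a * (rightLeftEquiv φ g).2) := by
  simp only [rightLeftEquiv, Equiv.coe_fn_mk, mul_right, mul_left, right_inr, right_inl, left_inr,
    left_inl, one_mul, mul_one, map_mul, mul_inv_rev, Prod.mk.injEq, true_and]
  simp [← MulAut.mul_apply, ← map_mul]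

theorem smul_slab {r : Q} {a : A} {I : Set Q} {P : Subgroup A}
    (h : ∀ q ∈ I, φ q⁻¹ a ∈ P) :
    (inr r * inl a : A ⋊[φ] Q) • slab φ I P = slab φ (r • I) P := by
  ext g
  obtain ⟨g, rfl⟩ : ∃ g', (inr r * inl a) * g' = g :=
    ⟨(inr r * inl a)⁻¹ * g, mul_inv_cancel_left _ _⟩
  rw [← smul_eq_mul (inr r * inl a), Set.smul_mem_smul_set_iff, smul_eq_mul]
  simp only [slab, Set.mem_preimage, rightLeftEquiv_mul, Set.mem_prod, ← smul_eq_mul (a := r),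
    Set.smul_mem_smul_set_iff]
  exact and_congr_right fun hq => (P.mul_mem_cancel_left (h _ hq)).symm

theorem slab_symmDiff (I J : Set Q) (P : Set A) :
    slab φ I P ∆ slab φ J P = slab φ (I ∆ J) P := by
  ext g
  simp only [slab, Set.mem_symmDiff, Set.mem_preimage, Set.mem_prod]
  tauto

variable [MeasurableSpace Q] [DiscreteMeasurableSpace Q] [MeasurableSpace (A ⋊[φ] Q)]
  [DiscreteMeasurableSpace (A ⋊[φ] Q)]

theorem count_slab (I : Set Q) (P : Set A) :
    Measure.count (slab φ I P) = Measure.count I * (P.encard : ENNReal) := by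
  rw [Measure.count_apply .of_discrete, Measure.count_apply .of_discrete, slab,
    Set.encard_preimage_of_bijective (rightLeftEquiv φ).bijective, Set.encard_prod,
    ENat.toENNReal_mul]

/-- The almost invariant sets of the semidirect product: an almost invariant `I ⊆ Q` is thickened
by the finite subgroup of `A` generated by the `I`-translates of a large finite set. -/
theorem isFoelner_slab (hA : IsLocallyFiniteGroup A) {ι : Type*} {l : Filter ι} {I : ι → Set Q}
    (hI : IsFoelner Q Measure.count l I) :
    IsFoelner (A ⋊[φ] Q) Measure.count (atTop ×ˢ l) fun x : Finset A × ι => slab φ (I x.2)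
      (Subgroup.closure (Set.image2 (fun q a => φ q⁻¹ a) (I x.2) x.1) : Subgroup A) := by
  set P : Finset A × ι → Subgroup A := fun x =>
    Subgroup.closure (Set.image2 (fun q a => φ q⁻¹ a) (I x.2) x.1)
  have hP_ne_zero : ∀ x, ((P x : Set A).encard : ENNReal) ≠ 0 := fun x => by
    simpa using (OneMemClass.coe_nonempty (P x)).ne_empty
  have hP_ne_top : ∀ᶠ x in atTop ×ˢ l, ((P x : Set A).encard : ENNReal) ≠ ⊤ := by
    filter_upwards [tendsto_snd.eventually hI.eventually_meas_ne_top] with x hx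
    have hfin : (I x.2).Finite := Measure.count_apply_lt_top.1 hx.lt_top
    have := hA (P x) ((Subgroup.fg_iff _).2 ⟨_, rfl, hfin.image2 _ x.1.finite_toSet⟩)
    simpa using Set.toFinite (P x : Set A)
  refine ⟨.of_forall fun _ => .of_discrete, ?_, ?_, fun g => ?_⟩
  · filter_upwards [tendsto_snd.eventually hI.eventually_meas_ne_zero] with x hx
    rw [count_slab]
    exact mul_ne_zero hx (hP_ne_zero x)
  · filter_upwards [tendsto_snd.eventually hI.eventually_meas_ne_top, hP_ne_top] with x hx hPx
    rw [count_slab]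
    exact ENNReal.mul_ne_top hx hPx
  · obtain ⟨r, a, rfl⟩ : ∃ r a, inr r * inl a = g :=
      ⟨g.right, φ g.right⁻¹ g.left, by ext <;> simp⟩
    refine ((hI.tendsto_meas_smul_symmDiff r).comp tendsto_snd).congr' ?_
    filter_upwards [hP_ne_top, tendsto_fst.eventually (eventually_ge_atTop {a})] with x hPx hax
    have hmem : ∀ q ∈ I x.2, φ q⁻¹ a ∈ P x := fun q hq =>
      Subgroup.subset_closure (Set.mem_image2_of_mem hq (hax (Finset.mem_singleton_self a)))
    rw [smul_slab φ hmem, slab_symmDiff, count_slab, count_slab,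
      ENNReal.mul_div_mul_right _ _ (hP_ne_zero x) hPx]
    rfl

theorem isFoelner_ofAdd_Ico [MeasurableSpace (Multiplicative ℤ)]
    [DiscreteMeasurableSpace (Multiplicative ℤ)] :
    IsFoelner (Multiplicative ℤ) Measure.count atTop
      fun n : ℕ => Multiplicative.toAdd ⁻¹' Set.Ico (0 : ℤ) n := by
  have hcount (s : Set ℤ) : (Measure.count (Multiplicative.toAdd ⁻¹' s) : ENNReal) = s.encard := by
    rw [Measure.count_apply .of_discrete,
      Set.encard_preimage_of_bijective Multiplicative.toAdd.bijective]
  have hIco (a b : ℤ) : (Set.Ico a b).encard = (b - a).toNat := by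
    rw [← Finset.coe_Ico, Set.encard_coe_eq_coe_finsetCard, Int.card_Ico]
  refine ⟨.of_forall fun _ => .of_discrete, ?_, .of_forall fun n => ?_, fun g => ?_⟩
  · filter_upwards [eventually_ne_atTop 0] with n hn
    simpa [hcount, hIco] using hn
  · simp [hcount, hIco]
  · set k : ℤ := |Multiplicative.toAdd g|
    have hsub (n : ℕ) : (g • (Multiplicative.toAdd ⁻¹' Set.Ico (0 : ℤ) n)) ∆
        (Multiplicative.toAdd ⁻¹' Set.Ico (0 : ℤ) n) ⊆
        Multiplicative.toAdd ⁻¹' (Set.Ico (-k) k ∪ Set.Ico (n - k) (n + k)) := by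
      intro x
      simp only [Set.mem_symmDiff, Set.mem_smul_set_iff_inv_smul_mem, smul_eq_mul,
        Set.mem_preimage, toAdd_mul, toAdd_inv, Set.mem_union, Set.mem_Ico]
      grind
    have hlim : Tendsto (fun n : ℕ => (4 * k.toNat : ENNReal) / n) atTop (𝓝 0) := by
      simpa using ENNReal.Tendsto.const_div ENNReal.tendsto_nat_nhds_top
        (Or.inr (ENNReal.mul_ne_top ENNReal.ofNat_ne_top (ENNReal.natCast_ne_top k.toNat)))
    refine tendsto_of_tendsto_of_tendsto_of_le_of_le tendsto_const_nhds hlim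
      (fun _ => bot_le) fun n => ENNReal.div_le_div ?_ ?_
    · refine (measure_mono (hsub n)).trans ?_
      rw [Set.preimage_union]
      refine (measure_union_le _ _).trans ?_
      rw [hcount, hcount, hIco, hIco]
      norm_cast
      omega
    · simp [hcount, hIco]

theorem isAmenableGroup_semidirectProduct_int (hA : IsLocallyFiniteGroup A)
    (φ : Multiplicative ℤ →* MulAut A) : IsAmenableGroup (A ⋊[φ] Multiplicative ℤ) := by
  let _ : MeasurableSpace (Multiplicative ℤ) := ⊤
  let _ : MeasurableSpace (A ⋊[φ] Multiplicative ℤ) := ⊤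
  exact isAmenableGroup_of_isFoelner (isFoelner_slab φ hA isFoelner_ofAdd_Ico)

end Amenable

/-! ### Tuples that satisfy the defining relations -/

/-- The tuple `x` satisfies the defining relations of `A(p, c)`, the commutator relations only for
the levels `n ∈ L`. -/
structure IsLocalTuple {H : Type*} [Group H] (p : ℕ) (c : ℕ+ → ℕ+) (L : Set ℕ+) (x : ℤ → H) :
    Prop where
  pow_eq_one : ∀ i, x i ^ p = 1
  comm_eq_one : ∀ n ∈ L, ∀ i : ℕ → ℤ,
    (∀ j ≤ (c n : ℕ), ∀ k ≤ (c n : ℕ), |i j - i k| ≤ (n : ℤ)) →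
      leftNormedCommutator (fun j => x (i j)) (c n) = 1

namespace IsLocalTuple

variable {p : ℕ} {c : ℕ+ → ℕ+} {L : Set ℕ+} {H K : Type*} [Group H] [Group K] {x : ℤ → H}

theorem map (hx : IsLocalTuple p c L x)
    (f : H →* K) : IsLocalTuple p c L fun i => f (x i) where
  pow_eq_one i := by rw [← map_pow, hx.pow_eq_one, map_one]
  comm_eq_one n hn i hi := by
    rw [← map_leftNormedCommutator f fun j => x (i j), hx.comm_eq_one n hn i hi, map_one]

theorem of_map (f : H →* K) (hf : Function.Injective f) (hx : IsLocalTuple p c L fun i => f (x i)) :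
    IsLocalTuple p c L x where
  pow_eq_one i := hf (by rw [map_pow, hx.pow_eq_one, map_one])
  comm_eq_one n hn i hi := hf (by
    rw [map_leftNormedCommutator, hx.comm_eq_one n hn i hi, map_one])

theorem pi {ι : Type*} {x : ℤ → ι → H} (hx : ∀ j, IsLocalTuple p c L fun i => x i j) :
    IsLocalTuple p c L x where
  pow_eq_one i := funext fun j => (hx j).pow_eq_one i
  comm_eq_one n hn i hi := funext fun j => by
    have := (hx j).comm_eq_one n hn i hi
    rw [Pi.one_apply, ← this]
    exact map_leftNormedCommutator (Pi.evalMonoidHom (fun _ : ι => H) j) (fun k => x (i k)) (c n)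

theorem of_reindex {y : ℤ → H} (hx : IsLocalTuple p c L x) (I : Set ℤ) (m : ℤ → ℤ)
    (hy : ∀ i ∈ I, y i = x (m i)) (hy' : ∀ i ∉ I, y i = 1)
    (hm : ∀ n : ℕ+, ∀ i ∈ I, ∀ j ∈ I, |i - j| ≤ (n : ℤ) → |m i - m j| ≤ n) :
    IsLocalTuple p c L y where
  pow_eq_one i := by
    by_cases hi : i ∈ I
    · rw [hy i hi, hx.pow_eq_one]
    · rw [hy' i hi, one_pow]
  comm_eq_one n hn i hi := by
    by_cases h : ∀ j ≤ (c n : ℕ), i j ∈ I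
    · rw [leftNormedCommutator_congr (y := fun j => x (m (i (min j (c n)))))
        fun j hj => by rw [min_eq_left hj, hy _ (h j hj)]]
      refine hx.comm_eq_one n hn (fun j => m (i (min j (c n)))) fun j _ k _ => ?_
      exact hm n _ (h _ (min_le_right _ _)) _ (h _ (min_le_right _ _))
        (hi _ (min_le_right _ _) _ (min_le_right _ _))
    · push Not at h
      obtain ⟨j, hj, hjI⟩ := h
      exact leftNormedCommutator_eq_one_of_eq_one hj (hy' _ hjI)

theorem comp_add (hx : IsLocalTuple p c L x) (m : ℤ) : IsLocalTuple p c L fun i => x (i + m) :=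
  hx.of_reindex Set.univ (· + m) (fun _ _ => rfl) (by simp) (by simp)

theorem leftNormedCommutators_image_Icc_subset (hx : IsLocalTuple p c L x) {u v : ℤ} {n : ℕ+}
    (hn : n ∈ L) (huv : v - u ≤ n) : leftNormedCommutators (x '' Set.Icc u v) (c n) ⊆ {1} := by
  rintro _ ⟨y, hy, rfl⟩
  choose i hi hiy using hy
  rw [← funext hiy]
  refine hx.comm_eq_one n hn i fun j _ k _ => abs_le.2 ?_
  have hij := Set.mem_Icc.1 (hi j)
  have hik := Set.mem_Icc.1 (hi k)
  omega

theorem finite_closure (hx : IsLocalTuple p c L x) (hp : 0 < p) {u v : ℤ} {n : ℕ+} (hn : n ∈ L)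
    (huv : v - u ≤ n) :
    Finite (Subgroup.closure (x '' Set.Icc u v)) ∧
      IsPGroup p (Subgroup.closure (x '' Set.Icc u v)) := by
  set K := Subgroup.closure (x '' Set.Icc u v)
  refine finite_and_isPGroup_of_leftNormedCommutators_subset hp (c n)
    (X := (Subtype.val ⁻¹' (x '' Set.Icc u v) : Set K))
    (((Set.finite_Icc u v).image x).preimage Subtype.val_injective.injOn)
    Subgroup.closure_closure_coe_preimage ?_ fun w hw => Subtype.ext ?_
  · rintro ⟨_, _⟩ ⟨i, -, rfl⟩
    exact Subtype.ext (hx.pow_eq_one i)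
  · have himage : K.subtype '' (Subtype.val ⁻¹' (x '' Set.Icc u v)) = x '' Set.Icc u v :=
      Subtype.image_preimage_coe _ _ |>.trans (Set.inter_eq_right.2 Subgroup.subset_closure)
    refine hx.leftNormedCommutators_image_Icc_subset hn huv ?_
    rw [← himage, ← image_leftNormedCommutators]
    exact ⟨w, hw, rfl⟩

end IsLocalTuple

/-- The relators of `A(p, c)` whose level lies in `L`. -/
def localRelators (p : ℕ) (c : ℕ+ → ℕ+) (L : Set ℕ+) : Set (FreeGroup ℤ) :=
  {w | ∃ i : ℤ, w = FreeGroup.of i ^ p} ∪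
  {w | ∃ n ∈ L, ∃ i : ℕ → ℤ,
    (∀ j ≤ (c n : ℕ), ∀ k ≤ (c n : ℕ), |i j - i k| ≤ (n : ℤ)) ∧
    w = leftNormedCommutator (fun j => FreeGroup.of (i j)) (c n)}

theorem localRelators_univ (p : ℕ) (c : ℕ+ → ℕ+) :
    localRelators p c Set.univ = relatorsA p c := by
  simp [localRelators, relatorsA]

theorem isLocalTuple_iff_lift_eq_one {p : ℕ} {c : ℕ+ → ℕ+} {L : Set ℕ+} {H : Type*} [Group H]
    {x : ℤ → H} :
    IsLocalTuple p c L x ↔ ∀ r ∈ localRelators p c L, FreeGroup.lift x r = 1 := by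
  constructor
  · rintro hx r (⟨i, rfl⟩ | ⟨n, hn, i, hi, rfl⟩)
    · rw [map_pow, FreeGroup.lift_apply_of, hx.pow_eq_one]
    · simp only [map_leftNormedCommutator, FreeGroup.lift_apply_of]
      exact hx.comm_eq_one n hn i hi
  · refine fun h => ⟨fun i => ?_, fun n hn i hi => ?_⟩
    · simpa using h _ (Or.inl ⟨i, rfl⟩)
    · simpa [map_leftNormedCommutator] using h _ (Or.inr ⟨n, hn, i, hi, rfl⟩)

/-! ### Groups presented by local relations and their extensions by the shift -/

theorem zpow_apply_of_shift {B : Type*} [Group B] {σ : MulAut B} {b : ℤ → B}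
    (h : ∀ i, σ (b i) = b (i + 1)) (m i : ℤ) : (σ ^ m) (b i) = b (i + m) := by
  induction m using Int.induction_on with
  | zero => simp
  | succ k ih =>
    rw [add_comm (k : ℤ) 1, zpow_add, zpow_one, MulAut.mul_apply, ih, h]
    congr 1; ring
  | pred k ih =>
    rw [sub_eq_add_neg, add_comm, zpow_add, zpow_neg_one, MulAut.mul_apply, ih]
    apply σ.injective
    rw [MulAut.apply_inv_self, h]
    congr 1; ring

/-- A group `A` with a family of generators `a i`, `i ∈ ℤ`, and an automorphism `a i ↦ a (i + 1)`,
that is presented by the relations of `A(p, c)` whose level lies in `L`. -/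
structure LocalPresentation (p : ℕ) (c : ℕ+ → ℕ+) (L : Set ℕ+) (A : Type*) [Group A] where
  gen : ℤ → A
  shift : MulAut A
  shift_gen : ∀ i, shift (gen i) = gen (i + 1)
  closure_gen : Subgroup.closure (Set.range gen) = ⊤
  ker_lift_gen : (FreeGroup.lift gen).ker = Subgroup.normalClosure (localRelators p c L)

theorem ker_lift_presentedGroup_of {α : Type*} (rels : Set (FreeGroup α)) :
    (FreeGroup.lift fun a => (PresentedGroup.of a : PresentedGroup rels)).ker =
      Subgroup.normalClosure rels := by
  have hmk : FreeGroup.lift (fun a => (PresentedGroup.of a : PresentedGroup rels)) =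
      PresentedGroup.mk rels := FreeGroup.ext_hom _ _ fun a => FreeGroup.lift_apply_of
  rw [hmk]
  exact QuotientGroup.ker_mk' _

theorem isLocalTuple_presentedGroup_of (p : ℕ) (c : ℕ+ → ℕ+) (L : Set ℕ+) :
    IsLocalTuple p c L fun i => (PresentedGroup.of i : PresentedGroup (localRelators p c L)) :=
  isLocalTuple_iff_lift_eq_one.2 fun r hr => by
    rw [← MonoidHom.mem_ker, ker_lift_presentedGroup_of]
    exact Subgroup.subset_normalClosure hr

namespace LocalPresentation

open SemidirectProduct Multiplicative

/-- The group `A(p, c)`. -/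
abbrev groupA (p : ℕ) (c : ℕ+ → ℕ+) : LocalPresentation p c Set.univ (GroupA p c) where
  gen i := PresentedGroup.of i
  shift := GroupA.shift p c
  shift_gen := GroupA.shift_of p c
  closure_gen := PresentedGroup.closure_range_of _
  ker_lift_gen := by rw [localRelators_univ, ker_lift_presentedGroup_of]

/-- The group presented by the relations of `A(p, c)` whose level lies in `L`. -/
def presented (p : ℕ) (c : ℕ+ → ℕ+) (L : Set ℕ+) :
    LocalPresentation p c L (PresentedGroup (localRelators p c L)) where
  gen i := PresentedGroup.of i
  shift := MonoidHom.toMulEquiv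
    (PresentedGroup.toGroup
      (isLocalTuple_iff_lift_eq_one.1 ((isLocalTuple_presentedGroup_of p c L).comp_add 1)))
    (PresentedGroup.toGroup
      (isLocalTuple_iff_lift_eq_one.1 ((isLocalTuple_presentedGroup_of p c L).comp_add (-1))))
    (PresentedGroup.ext fun i => by simp)
    (PresentedGroup.ext fun i => by simp)
  shift_gen i := by simp
  closure_gen := PresentedGroup.closure_range_of _
  ker_lift_gen := ker_lift_presentedGroup_of _

variable {p : ℕ} {c : ℕ+ → ℕ+} {L : Set ℕ+} {A : Type*} [Group A] (M : LocalPresentation p c L A)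
  {H : Type*} [Group H]

theorem isLocalTuple_gen : IsLocalTuple p c L M.gen :=
  isLocalTuple_iff_lift_eq_one.2 fun r hr => by
    rw [← MonoidHom.mem_ker, M.ker_lift_gen]
    exact Subgroup.subset_normalClosure hr

theorem lift_gen_surjective : Function.Surjective (FreeGroup.lift M.gen) := by
  rw [← MonoidHom.range_eq_top, FreeGroup.range_lift_eq_closure, M.closure_gen]

/-- The homomorphism `a i ↦ x i` given by the universal property of the presentation. -/
noncomputable def lift {x : ℤ → H} (hx : IsLocalTuple p c L x) : A →* H :=
  (FreeGroup.lift M.gen).liftOfSurjective M.lift_gen_surjective ⟨FreeGroup.lift x, by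
    rw [M.ker_lift_gen]
    exact Subgroup.normalClosure_le_normal (isLocalTuple_iff_lift_eq_one.1 hx)⟩

@[simp]
theorem lift_gen {x : ℤ → H} (hx : IsLocalTuple p c L x) (i : ℤ) : M.lift hx (M.gen i) = x i := by
  have h := MonoidHom.liftOfRightInverse_comp_apply (FreeGroup.lift M.gen) _
    (Function.rightInverse_surjInv M.lift_gen_surjective) ⟨FreeGroup.lift x, by
      rw [M.ker_lift_gen]
      exact Subgroup.normalClosure_le_normal (isLocalTuple_iff_lift_eq_one.1 hx)⟩ (FreeGroup.of i)
  rwa [FreeGroup.lift_apply_of, FreeGroup.lift_apply_of] at h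

/-- The extension of `A` by the shift. -/
abbrev Ext : Type _ := A ⋊[zpowersHom (MulAut A) M.shift] Multiplicative ℤ

/-- The generator `a 0` of the extension. -/
def base : M.Ext := inl (M.gen 0)

/-- The stable letter `t` of the extension. -/
def stable : M.Ext := inr (ofAdd 1)

theorem hom_ext {f g : A →* H} (h : ∀ i, f (M.gen i) = g (M.gen i)) :
    f = g :=
  MonoidHom.eq_of_eqOn_dense M.closure_gen (by rintro _ ⟨i, rfl⟩; exact h i)

theorem shift_zpow_gen (m i : ℤ) : (M.shift ^ m) (M.gen i) = M.gen (i + m) :=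
  zpow_apply_of_shift M.shift_gen m i

theorem stable_zpow (m : ℤ) : M.stable ^ m = inr (ofAdd m) := by
  rw [stable, ← map_zpow, ← ofAdd_zsmul, smul_eq_mul, mul_one]

theorem stable_zpow_conj (m : ℤ) (a : A) :
    M.stable ^ m * inl a * (M.stable ^ m)⁻¹ = inl ((M.shift ^ m) a) := by
  rw [stable_zpow, ← map_inv, ← inl_aut, zpowersHom_apply, toAdd_ofAdd]

theorem inl_gen (i : ℤ) :
    (inl (M.gen i) : M.Ext) = M.stable ^ i * M.base * (M.stable ^ i)⁻¹ := by
  rw [base, stable_zpow_conj, shift_zpow_gen, zero_add]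

theorem closure_base_stable : Subgroup.closure {M.base, M.stable} = ⊤ := by
  rw [eq_top_iff]
  set K := Subgroup.closure {M.base, M.stable}
  have hb : M.base ∈ K := Subgroup.subset_closure (by simp)
  have hs : M.stable ∈ K := Subgroup.subset_closure (by simp)
  have hA : ∀ a : A, (inl a : M.Ext) ∈ K := by
    have : Subgroup.closure (Set.range M.gen) ≤ K.comap inl := by
      rw [Subgroup.closure_le]
      rintro _ ⟨i, rfl⟩
      rw [SetLike.mem_coe, Subgroup.mem_comap, M.inl_gen]
      exact K.mul_mem (K.mul_mem (K.zpow_mem hs i) hb) (K.inv_mem (K.zpow_mem hs i))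
    exact fun a => this (M.closure_gen ▸ Subgroup.mem_top a)
  intro x _
  rw [← inl_left_mul_inr_right x]
  refine K.mul_mem (hA _) ?_
  rw [← ofAdd_toAdd x.right, ← M.stable_zpow]
  exact K.zpow_mem hs _

theorem ext_hom_ext {f g : M.Ext →* H} (hb : f M.base = g M.base)
    (hs : f M.stable = g M.stable) : f = g :=
  MonoidHom.eq_of_eqOn_dense M.closure_base_stable (by
    rintro _ (rfl | rfl)
    exacts [hb, hs])

/-- The homomorphism `a 0 ↦ x`, `t ↦ τ` on the extension. -/
noncomputable def extLift {x τ : H} (h : IsLocalTuple p c L fun i : ℤ => τ ^ i * x * (τ ^ i)⁻¹) :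
    M.Ext →* H :=
  SemidirectProduct.lift (M.lift h) (zpowersHom H τ) fun m => M.hom_ext fun i => by
    simp only [MonoidHom.comp_apply, MulEquiv.coe_toMonoidHom, zpowersHom_apply,
      MulAut.conj_apply, M.shift_zpow_gen, lift_gen, add_comm i, zpow_add]
    group

@[simp]
theorem extLift_base {x τ : H} (h : IsLocalTuple p c L fun i : ℤ => τ ^ i * x * (τ ^ i)⁻¹) :
    M.extLift h M.base = x := by
  simp [extLift, base]

@[simp]
theorem extLift_stable {x τ : H} (h : IsLocalTuple p c L fun i : ℤ => τ ^ i * x * (τ ^ i)⁻¹) :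
    M.extLift h M.stable = τ := by
  simp [extLift, stable]

theorem map_inl_gen (F : M.Ext →* H) (i : ℤ) :
    F (inl (M.gen i)) = F M.stable ^ i * F M.base * (F M.stable ^ i)⁻¹ := by
  rw [M.inl_gen, map_mul, map_mul, map_inv, map_zpow]

/-- The subgroup of `A` generated by the `a i` with `u ≤ i ≤ v`. -/
def window (u v : ℤ) : Subgroup A := Subgroup.closure (M.gen '' Set.Icc u v)

theorem gen_mem_window {u v i : ℤ} (h : i ∈ Set.Icc u v) : M.gen i ∈ M.window u v :=
  Subgroup.subset_closure ⟨i, h, rfl⟩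

theorem window_mono {u v u' v' : ℤ} (hu : u' ≤ u) (hv : v ≤ v') :
    M.window u v ≤ M.window u' v' :=
  Subgroup.closure_mono (Set.image_mono (Set.Icc_subset_Icc hu hv))

theorem map_shift_zpow_window (m u v : ℤ) :
    (M.window u v).map (M.shift ^ m : MulAut A).toMonoidHom = M.window (u + m) (v + m) := by
  rw [window, MonoidHom.map_closure, window]
  congr 1
  ext a
  simp only [Set.mem_image, Set.mem_Icc]
  constructor
  · rintro ⟨_, ⟨i, hi, rfl⟩, rfl⟩
    exact ⟨i + m, by omega, by rw [MulEquiv.coe_toMonoidHom, M.shift_zpow_gen]⟩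
  · rintro ⟨i, hi, rfl⟩
    exact ⟨_, ⟨i - m, by omega, rfl⟩, by
      rw [MulEquiv.coe_toMonoidHom, M.shift_zpow_gen, sub_add_cancel]⟩

theorem exists_mem_window (a : A) : ∃ n : ℕ, a ∈ M.window (-n) n := by
  have ha : a ∈ Subgroup.closure (Set.range M.gen) := M.closure_gen ▸ Subgroup.mem_top a
  induction ha using Subgroup.closure_induction with
  | mem x hx =>
    obtain ⟨i, rfl⟩ := hx
    exact ⟨i.natAbs, M.gen_mem_window (by rw [Set.mem_Icc]; omega)⟩
  | one => exact ⟨0, one_mem _⟩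
  | mul x y _ _ hx hy =>
    obtain ⟨m, hm⟩ := hx
    obtain ⟨n, hn⟩ := hy
    exact ⟨max m n, mul_mem (M.window_mono (by simp) (by simp) hm)
      (M.window_mono (by simp) (by simp) hn)⟩
  | inv x _ hx =>
    obtain ⟨m, hm⟩ := hx
    exact ⟨m, inv_mem hm⟩

theorem finite_window (hp : 0 < p) {u v : ℤ} {n : ℕ+} (hn : n ∈ L) (huv : v - u ≤ n) :
    Finite (M.window u v) :=
  (M.isLocalTuple_gen.finite_closure hp hn huv).1

theorem isPGroup_window (hp : 0 < p) {u v : ℤ} {n : ℕ+} (hn : n ∈ L) (huv : v - u ≤ n) :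
    IsPGroup p (M.window u v) :=
  (M.isLocalTuple_gen.finite_closure hp hn huv).2

/-- The tuple that agrees with `a` in a window and is trivial outside. -/
noncomputable def windowTuple (u v i : ℤ) : M.window u v :=
  open Classical in if h : i ∈ Set.Icc u v then ⟨M.gen i, M.gen_mem_window h⟩ else 1

theorem isLocalTuple_windowTuple (u v : ℤ) : IsLocalTuple p c L (M.windowTuple u v) := by
  refine IsLocalTuple.of_map (M.window u v).subtype Subtype.val_injective ?_
  refine M.isLocalTuple_gen.of_reindex (Set.Icc u v) id (fun i hi => ?_) (fun i hi => ?_) ?_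
  · simp [windowTuple, Set.mem_Icc.1 hi]
  · simp only [windowTuple, dif_neg hi, map_one]
  · exact fun n i _ j _ h => h

theorem exists_subset_window {S : Set A} (hS : S.Finite) : ∃ n : ℕ, S ⊆ M.window (-n) n := by
  choose n hn using M.exists_mem_window
  obtain ⟨b, hb⟩ := (hS.image n).bddAbove
  refine ⟨b, fun a ha => ?_⟩
  have hab : n a ≤ b := hb (Set.mem_image_of_mem n ha)
  exact M.window_mono (by omega) (by omega) (hn a)

theorem isLocallyFiniteGroup (M : LocalPresentation p c Set.univ A) (hp : 0 < p) :
    IsLocallyFiniteGroup A := fun K hK => by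
  obtain ⟨S, rfl, hS⟩ := (Subgroup.fg_iff _).1 hK
  obtain ⟨n, hn⟩ := M.exists_subset_window hS
  have := M.finite_window hp (u := -n) (v := n) (n := ⟨2 * n + 1, by omega⟩) (Set.mem_univ _)
    (by push_cast [PNat.mk_coe]; omega)
  exact Finite.of_injective _ (Subgroup.inclusion_injective ((Subgroup.closure_le _).2 hn))

theorem isPGroup (M : LocalPresentation p c Set.univ A) (hp : 0 < p) : IsPGroup p A := fun a => by
  obtain ⟨n, hn⟩ := M.exists_mem_window a
  obtain ⟨k, hk⟩ := M.isPGroup_window hp (u := -n) (v := n) (n := ⟨2 * n + 1, by omega⟩)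
    (Set.mem_univ _) (by push_cast [PNat.mk_coe]; omega) ⟨a, hn⟩
  exact ⟨k, congrArg Subtype.val hk⟩

end LocalPresentation

/-! ### Finite quotients of the extensions -/

/-- The base group `Q → D` inside the regular wreath product `D ≀ᵣ Q`. -/
def regularWreathBase (D Q : Type*) [Group D] [Group Q] : (Q → D) →* D ≀ᵣ Q where
  toFun f := ⟨f, 1⟩
  map_one' := rfl
  map_mul' f g := by ext <;> simp

theorem conj_regularWreathBase {D Q : Type*} [Group D] [Group Q] (g : Q) (f : Q → D) :
    RegularWreathProduct.inl g * regularWreathBase D Q f * (RegularWreathProduct.inl g)⁻¹ =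
      regularWreathBase D Q fun y => f (g⁻¹ * y) := by
  ext <;> simp [regularWreathBase]

theorem isPGroup_regularWreathProduct {p : ℕ} [Fact p.Prime] {D Q : Type*} [Group D] [Group Q]
    [Finite D] [Finite Q] (hD : IsPGroup p D) (hQ : IsPGroup p Q) : IsPGroup p (D ≀ᵣ Q) := by
  obtain ⟨m, hm⟩ := IsPGroup.iff_card.1 hD
  obtain ⟨n, hn⟩ := IsPGroup.iff_card.1 hQ
  exact .of_card (n := m * p ^ n + n) (by
    rw [RegularWreathProduct.card, hm, hn, pow_add, pow_mul])

/-- The function on `ℤ/q` that takes the value `x m` at the residue of `m` for `u ≤ m ≤ v`, and the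
value `1` elsewhere. -/
noncomputable def foldTuple {H : Type*} [One H] (x : ℤ → H) (u v : ℤ) (q : ℕ) (r : ZMod q) : H :=
  open Classical in if h : ∃ m ∈ Set.Icc u v, (m : ZMod q) = r then x h.choose else 1

theorem eq_of_intCast_zmod_eq {q : ℕ} {a b : ℤ} (h : (a : ZMod q) = b) (hab : |a - b| < q) :
    a = b := by
  rw [ZMod.intCast_eq_intCast_iff_dvd_sub, dvd_sub_comm] at h
  exact sub_eq_zero.1 (Int.eq_zero_of_abs_lt_dvd h hab)

theorem foldTuple_of_mem {H : Type*} [One H] (x : ℤ → H) {u v : ℤ} {q : ℕ} (hq : v - u < q)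
    {m : ℤ} (hm : m ∈ Set.Icc u v) : foldTuple x u v q m = x m := by
  have h : ∃ k ∈ Set.Icc u v, (k : ZMod q) = m := ⟨m, hm, rfl⟩
  rw [foldTuple, dif_pos h]
  obtain ⟨hk, hkm⟩ := h.choose_spec
  rw [Set.mem_Icc] at hk hm
  rw [eq_of_intCast_zmod_eq hkm (by rw [abs_lt]; omega)]

theorem IsLocalTuple.foldTuple {H : Type*} [Group H] {p : ℕ} {c : ℕ+ → ℕ+} {L : Set ℕ+}
    {x : ℤ → H} (hx : IsLocalTuple p c L x) {u v : ℤ} {q : ℕ} (hq : 2 * (v - u) < q)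
    (r : ZMod q) : IsLocalTuple p c L fun i : ℤ => foldTuple x u v q (i - r) := by
  classical
  refine hx.of_reindex {i : ℤ | ∃ m ∈ Set.Icc u v, (m : ZMod q) = i - r}
    (fun i => if h : ∃ m ∈ Set.Icc u v, (m : ZMod q) = i - r then h.choose else 0)
    (fun i hi => ?_) (fun i hi => ?_) fun n i hi k hk hik => ?_
  · rw [Set.mem_ofPred_eq] at hi
    rw [_root_.foldTuple, dif_pos hi, dif_pos hi]
  · rw [Set.mem_ofPred_eq] at hi
    rw [_root_.foldTuple, dif_neg hi]
  · rw [Set.mem_ofPred_eq] at hi hk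
    rw [dif_pos hi, dif_pos hk]
    obtain ⟨ha, hai⟩ := hi.choose_spec
    obtain ⟨hb, hbk⟩ := hk.choose_spec
    set a := hi.choose
    set b := hk.choose
    rw [Set.mem_Icc] at ha hb
    by_cases hn : v - u ≤ n
    · rw [abs_le]; omega
    · -- Two representatives whose residues differ by less than `q / 2` differ by the same amount.
      have hab : ((a - b : ℤ) : ZMod q) = ((i - k : ℤ) : ZMod q) := by
        push_cast
        rw [hai, hbk]; ring
      rw [abs_le] at hik
      rw [eq_of_intCast_zmod_eq hab (by rw [abs_lt]; omega), abs_le]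
      exact hik

namespace LocalPresentation

open SemidirectProduct Multiplicative

variable {p : ℕ} {c : ℕ+ → ℕ+} {L : Set ℕ+} {A : Type u} [Group A] (M : LocalPresentation p c L A)
  {H : Type*} [Group H] {x : ℤ → H} {u v : ℤ} {q : ℕ}

theorem inl_zpow_conj_regularWreathBase (y : ZMod q → H) (i : ℤ) :
    RegularWreathProduct.inl (ofAdd (1 : ZMod q)) ^ i *
        regularWreathBase H (Multiplicative (ZMod q)) (fun j => y (-toAdd j)) *
        (RegularWreathProduct.inl (ofAdd (1 : ZMod q)) ^ i)⁻¹ =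
      regularWreathBase H _ fun j => y (i - toAdd j) := by
  rw [← map_zpow, conj_regularWreathBase]
  simp [toAdd_mul, toAdd_inv, toAdd_zpow, sub_eq_add_neg, add_comm]

theorem isLocalTuple_rotations (hx : IsLocalTuple p c L x) (hq : 2 * (v - u) < q) :
    IsLocalTuple p c L fun (i : ℤ) (j : Multiplicative (ZMod q)) =>
      foldTuple x u v q (i - toAdd j) :=
  .pi fun j => hx.foldTuple hq (toAdd j)

/-- The homomorphism that folds the window `[u, v]` of a tuple onto the cyclic group `ℤ/q`: `t` acts
as the rotation, and `a i` is the tuple whose value at `j` is the folded tuple at `i - j`. -/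
noncomputable def foldHom (hx : IsLocalTuple p c L x) (hq : 2 * (v - u) < q) :
    M.Ext →* H ≀ᵣ Multiplicative (ZMod q) :=
  M.extLift (x := regularWreathBase H _ fun j => foldTuple x u v q (-toAdd j))
    (τ := RegularWreathProduct.inl (ofAdd 1)) (by
      simp only [inl_zpow_conj_regularWreathBase]
      exact (isLocalTuple_rotations hx hq).map (regularWreathBase H _))

theorem foldHom_inl (hx : IsLocalTuple p c L x) (hq : 2 * (v - u) < q) (a : A) :
    M.foldHom hx hq (inl a) = regularWreathBase H _ (M.lift (isLocalTuple_rotations hx hq) a) := by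
  refine DFunLike.congr_fun (f := (M.foldHom hx hq).comp inl)
    (g := (regularWreathBase H _).comp (M.lift _)) (M.hom_ext fun i => ?_) a
  rw [MonoidHom.comp_apply, MonoidHom.comp_apply, lift_gen, map_inl_gen, foldHom, extLift_base,
    extLift_stable, inl_zpow_conj_regularWreathBase]

theorem rightHom_foldHom (hx : IsLocalTuple p c L x) (hq : 2 * (v - u) < q) (g : M.Ext) :
    RegularWreathProduct.rightHom (M.foldHom hx hq g) = ofAdd ((toAdd g.right : ℤ) : ZMod q) := by
  suffices RegularWreathProduct.rightHom.comp (M.foldHom hx hq) =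
      (AddMonoidHom.toMultiplicative (Int.castAddHom (ZMod q))).comp rightHom from
    DFunLike.congr_fun this g
  refine M.ext_hom_ext ?_ ?_
  · rw [MonoidHom.comp_apply, foldHom, extLift_base]
    simp [base, regularWreathBase]
  · rw [MonoidHom.comp_apply, foldHom, extLift_stable]
    simp [stable]

theorem foldHom_windowTuple_left_one (hq : 2 * (v - u) < q) {a : A} (ha : a ∈ M.window u v) :
    ((M.foldHom (M.isLocalTuple_windowTuple u v) hq (inl a)).left 1 : A) = a := by
  rw [foldHom_inl]
  refine MonoidHom.eqOn_closure (f := (M.window u v).subtype.comp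
    ((Pi.evalMonoidHom (fun _ : Multiplicative (ZMod q) => M.window u v) 1).comp
      (M.lift (isLocalTuple_rotations (M.isLocalTuple_windowTuple u v) hq))))
    (g := MonoidHom.id A) (s := M.gen '' Set.Icc u v) ?_ ha
  rintro _ ⟨i, hi, rfl⟩
  have huv := hi.1.trans hi.2
  simp [foldTuple_of_mem (M.windowTuple u v) (q := q) (by omega) hi, windowTuple,
    Set.mem_Icc.1 hi]

theorem exists_finite_quotient [Fact p.Prime] {n : ℕ+} (hn : n ∈ L) (huv : v - u ≤ n) (w : ℕ) :
    ∃ q > w, ∃ (E : Type u) (_ : Group E) (_ : Finite E) (F : M.Ext →* E)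
      (χ : E →* Multiplicative (ZMod q)), IsPGroup p E ∧
      (∀ a ∈ M.window u v, F (inl a) = 1 → a = 1) ∧
      ∀ g, χ (F g) = ofAdd ((toAdd g.right : ℤ) : ZMod q) := by
  have hp : p.Prime := Fact.out
  have := M.finite_window hp.pos hn huv
  set k := w + (2 * (v - u)).natAbs
  have hk : k < p ^ k := Nat.lt_pow_self hp.one_lt
  have hq : 2 * (v - u) < (p ^ k : ℕ) := by omega
  have : NeZero (p ^ k) := ⟨(pow_pos hp.pos k).ne'⟩
  have : Finite (Multiplicative (ZMod (p ^ k))) := inferInstanceAs (Finite (ZMod (p ^ k)))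
  refine ⟨p ^ k, by omega, M.window u v ≀ᵣ Multiplicative (ZMod (p ^ k)), inferInstance,
    inferInstance, M.foldHom (M.isLocalTuple_windowTuple u v) hq,
    RegularWreathProduct.rightHom, isPGroup_regularWreathProduct (M.isPGroup_window hp.pos hn huv)
      (.of_card (n := k) (Nat.card_zmod (p ^ k))), fun a ha h => ?_, M.rightHom_foldHom _ _⟩
  have hleft := M.foldHom_windowTuple_left_one hq ha
  rwa [h, eq_comm] at hleft

theorem isResiduallyFinitePGroup (M : LocalPresentation p c Set.univ A) [Fact p.Prime] :
    IsResiduallyFinitePGroup p M.Ext := by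
  intro g hg
  obtain ⟨n, hn⟩ := M.exists_mem_window g.left
  obtain ⟨q, hq, E, _, _, F, χ, hE, hF, hχ⟩ := M.exists_finite_quotient (u := -n) (v := n)
    (n := ⟨2 * n + 1, by omega⟩) (Set.mem_univ _) (by push_cast [PNat.mk_coe]; omega)
    (toAdd g.right).natAbs
  refine exists_normal_notMem_of_hom hE F fun h => hg ?_
  have hright : g.right = 1 := by
    have hcast : ((toAdd g.right : ℤ) : ZMod q) = (0 : ℤ) := by
      rw [Int.cast_zero, ← ofAdd_eq_one, ← hχ, h, map_one]
    exact toAdd_eq_zero.1 (eq_of_intCast_zmod_eq hcast (by rw [sub_zero, Int.abs_eq_natAbs]; omega))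
  have hdec : g = inl g.left := by
    conv_lhs => rw [← inl_left_mul_inr_right g, hright, map_one, mul_one]
  rw [hdec] at h
  rw [hdec, hF _ hn h, map_one]

/-! ### The wreath product quotient -/

theorem isLocalTuple_single (p : ℕ) (c : ℕ+ → ℕ+) (L : Set ℕ+) :
    IsLocalTuple p c L fun i : ℤ => ofAdd (Finsupp.single i (1 : ZMod p)) where
  pow_eq_one i := by
    rw [← ofAdd_nsmul, Finsupp.smul_single]
    simp
  comm_eq_one n _ i _ := by
    obtain ⟨k, hk⟩ : ∃ k, (c n : ℕ) = k + 1 := ⟨c n - 1, by have := (c n).pos; omega⟩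
    rw [hk, leftNormedCommutator, commutatorElement_eq_one_iff_mul_comm, mul_comm]

theorem gen_injective (hp : p ≠ 1) : Function.Injective M.gen := by
  have : Nontrivial (ZMod p) := ZMod.nontrivial_iff.2 hp
  intro i j h
  have hij := congrArg (M.lift (isLocalTuple_single p c L)) h
  rw [lift_gen, lift_gen] at hij
  exact Finsupp.single_left_injective one_ne_zero (ofAdd.injective hij)

theorem baseShift_single (p : ℕ) (i : ℤ) :
    baseShift p (ofAdd (Finsupp.single i 1)) = ofAdd (Finsupp.single (i + 1) 1) := by
  change ofAdd (Finsupp.domCongr (Equiv.addRight (1 : ℤ)) (Finsupp.single i (1 : ZMod p))) = _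
  simp

theorem inr_zpow_conj_single (p : ℕ) (i : ℤ) :
    (inr (ofAdd 1) : WreathZModInt p) ^ i * inl (ofAdd (Finsupp.single 0 1)) *
      (inr (ofAdd 1) ^ i)⁻¹ = inl (ofAdd (Finsupp.single i 1)) := by
  rw [← map_zpow, ← map_inv, ← inl_aut, zpowersHom_apply, toAdd_zpow, toAdd_ofAdd, smul_eq_mul,
    mul_one, zpow_apply_of_shift (baseShift_single p), zero_add]

theorem closure_wreathZModInt (p : ℕ) [NeZero p] :
    Subgroup.closure {(inl (ofAdd (Finsupp.single 0 1)) : WreathZModInt p), inr (ofAdd 1)} = ⊤ := by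
  rw [eq_top_iff]
  set K := Subgroup.closure {(inl (ofAdd (Finsupp.single 0 1)) : WreathZModInt p), inr (ofAdd 1)}
  have hb : inl (ofAdd (Finsupp.single 0 1)) ∈ K := Subgroup.subset_closure (by simp)
  have hs : inr (ofAdd 1) ∈ K := Subgroup.subset_closure (by simp)
  intro x _
  rw [← inl_left_mul_inr_right x]
  refine mul_mem ?_ ?_
  · rw [← ofAdd_toAdd x.left]
    induction toAdd x.left using Finsupp.induction_linear with
    | zero => rw [ofAdd_zero, map_one]; exact one_mem _
    | add f g hf hg => rw [ofAdd_add, map_mul]; exact mul_mem hf hg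
    | single i b =>
      have hib : Finsupp.single i b = b.val • Finsupp.single i (1 : ZMod p) := by
        rw [Finsupp.smul_single, nsmul_eq_mul, mul_one, ZMod.natCast_zmod_val]
      rw [hib, ofAdd_nsmul, map_pow, ← inr_zpow_conj_single]
      exact pow_mem (mul_mem (mul_mem (zpow_mem hs _) hb) (inv_mem (zpow_mem hs _))) _
  · have hx : x.right = ofAdd 1 ^ toAdd x.right := by
      rw [← ofAdd_zsmul, smul_eq_mul, mul_one, ofAdd_toAdd]
    rw [hx, map_zpow]
    exact zpow_mem hs _

theorem exists_surjective_wreath [NeZero p] :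
    ∃ f : M.Ext →* WreathZModInt p, Function.Surjective f := by
  have hloc : IsLocalTuple p c L fun i : ℤ => (inr (ofAdd 1) : WreathZModInt p) ^ i *
      inl (ofAdd (Finsupp.single 0 1)) * (inr (ofAdd 1) ^ i)⁻¹ := by
    simp only [inr_zpow_conj_single]
    exact (isLocalTuple_single p c L).map inl
  refine ⟨M.extLift hloc, MonoidHom.range_eq_top.1 (top_le_iff.1 ?_)⟩
  rw [← closure_wreathZModInt, Subgroup.closure_le]
  rintro _ (rfl | rfl)
  exacts [⟨M.base, M.extLift_base hloc⟩, ⟨M.stable, M.extLift_stable hloc⟩]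

end LocalPresentation

/-! ### The four-point condition for groups that act on a tree of lists -/

section ListTree

variable {α : Type*}

/-- Adjacency in the rooted tree whose vertices are the lists, the parent of a list being its tail;
a list counts as adjacent to itself. -/
def ListStep (l l' : List α) : Prop := l' = l ∨ (∃ x, l' = x :: l) ∨ ∃ x, l = x :: l'

theorem ListStep.symm {l l' : List α} (h : ListStep l l') : ListStep l' l := by
  rcases h with h | h | h
  exacts [Or.inl h.symm, Or.inr (Or.inr h), Or.inr (Or.inl h)]

theorem exists_cons_suffix {m l : List α} (h : m <:+ l) (hne : l ≠ m) : ∃ a, a :: m <:+ l := by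
  obtain ⟨t, rfl⟩ := h
  rcases List.eq_nil_or_concat t with rfl | ⟨t', a, rfl⟩
  · exact absurd rfl hne
  · exact ⟨a, t', by simp⟩

/-- The vertex `m` separates two vertices of the tree that do not lie in the same branch above
it. -/
theorem exists_eq_of_suffix {m : List α} (w : ℕ → List α) (k : ℕ)
    (hstep : ∀ j < k, ListStep (w j) (w (j + 1))) (h0 : m <:+ w 0)
    (hk : ∀ a, a :: m <:+ w 0 → ¬ a :: m <:+ w k) : ∃ j ≤ k, w j = m := by
  by_cases hm : w 0 = m
  · exact ⟨0, Nat.zero_le _, hm⟩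
  obtain ⟨a, ha⟩ := exists_cons_suffix h0 hm
  obtain ⟨j, hj, hin, hout⟩ : ∃ j < k, a :: m <:+ w j ∧ ¬ a :: m <:+ w (j + 1) := by
    by_contra! hstay
    have hall : ∀ j ≤ k, a :: m <:+ w j := fun j => by
      induction j with
      | zero => exact fun _ => ha
      | succ j ih => exact fun hj => hstay j hj (ih (by omega))
    exact hk a ha (hall k le_rfl)
  refine ⟨j + 1, hj, ?_⟩
  rcases hstep j hj with h | ⟨x, h⟩ | ⟨x, h⟩
  · exact absurd (h ▸ hin) hout
  · exact absurd (h ▸ hin.trans (List.suffix_cons x _)) hout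
  · rw [h, List.suffix_cons_iff] at hin
    rcases hin with hin | hin
    · exact (List.cons_eq_cons.1 hin).2.symm
    · exact absurd hin hout

/-- The branch point of three vertices of the tree. -/
theorem exists_branch_point (l₁ l₂ l₃ : List α) :
    ∃ m, (m <:+ l₁ ∧ m <:+ l₂ ∨ m <:+ l₁ ∧ m <:+ l₃ ∨ m <:+ l₂ ∧ m <:+ l₃) ∧
      ∀ a, ¬(a :: m <:+ l₁ ∧ a :: m <:+ l₂) ∧ ¬(a :: m <:+ l₁ ∧ a :: m <:+ l₃) ∧
        ¬(a :: m <:+ l₂ ∧ a :: m <:+ l₃) := by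
  classical
  let P : List α → Prop :=
    fun m => m <:+ l₁ ∧ m <:+ l₂ ∨ m <:+ l₁ ∧ m <:+ l₃ ∨ m <:+ l₂ ∧ m <:+ l₃
  have hbound : ∀ m, P m → m.length ≤ l₁.length + l₂.length := by
    rintro m (⟨h, -⟩ | ⟨h, -⟩ | ⟨h, -⟩) <;> have := h.length_le <;> omega
  obtain ⟨m, hm, hlen⟩ := Nat.findGreatest_spec
    (P := fun k => ∃ m, P m ∧ m.length = k) (Nat.zero_le (l₁.length + l₂.length))
    ⟨[], Or.inl ⟨List.nil_suffix, List.nil_suffix⟩, rfl⟩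
  have hmax : ∀ a, ¬ P (a :: m) := fun a ha => by
    have := Nat.le_findGreatest (P := fun k => ∃ m, P m ∧ m.length = k) (hbound _ ha) ⟨_, ha, rfl⟩
    rw [← hlen, List.length_cons] at this
    omega
  exact ⟨m, hm, fun a => by simpa only [P, not_or] using hmax a⟩

variable {G : Type*} [Group G] {S : Set G}

theorem wordLength_symm (hS : Subgroup.closure S = ⊤) (x y : G) :
    wordLength S (x⁻¹ * y) = wordLength S (y⁻¹ * x) := by
  rw [← wordLength_inv hS, mul_inv_rev, inv_inv]

theorem wordLength_triangle (hS : Subgroup.closure S = ⊤) (x y z : G) :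
    wordLength S (x⁻¹ * z) ≤ wordLength S (x⁻¹ * y) + wordLength S (y⁻¹ * z) := by
  have := wordLength_mul_le hS (x⁻¹ * y) (y⁻¹ * z)
  rwa [mul_assoc, mul_inv_cancel_left] at this

theorem exists_on_geodesic (hS : Subgroup.closure S = ⊤) {f : G → List α}
    (hf : ∀ g, ∀ s ∈ S, ListStep (f g) (f (g * s))) {m : List α} {x z : G} (hx : m <:+ f x)
    (hz : ∀ a, a :: m <:+ f x → ¬ a :: m <:+ f z) :
    ∃ u, f u = m ∧ wordLength S (x⁻¹ * u) + wordLength S (u⁻¹ * z) ≤ wordLength S (x⁻¹ * z) := by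
  obtain ⟨l, hl, hlS, hlp⟩ := isWordOfLength_wordLength hS (x⁻¹ * z)
  have hxz : x * l.prod = z := by rw [hlp, mul_inv_cancel_left]
  obtain ⟨j, hj, hjm⟩ := exists_eq_of_suffix (fun j => f (x * (l.take j).prod)) l.length
    (fun j hj => by
      rw [List.take_add_one, List.getElem?_eq_getElem hj, Option.toList_some, List.prod_append,
        List.prod_singleton, ← mul_assoc]
      rcases hlS _ (List.getElem_mem hj) with h | h
      · exact hf _ _ h
      · have := hf (x * (l.take j).prod * l[j]) _ h
        rw [mul_inv_cancel_right] at this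
        exact this.symm)
    (by simpa using hx) (by simpa [hxz] using hz)
  have hbefore : wordLength S (x⁻¹ * (x * (l.take j).prod)) ≤ j :=
    wordLength_le ⟨l.take j, by simp [hj], fun y hy => hlS y (List.mem_of_mem_take hy), by simp⟩
  have hafter : wordLength S ((x * (l.take j).prod)⁻¹ * z) ≤ l.length - j := by
    refine wordLength_le ⟨l.drop j, by simp, fun y hy => hlS y (List.mem_of_mem_drop hy), ?_⟩
    rw [← hxz, ← List.prod_take_mul_prod_drop l j]
    group
  exact ⟨_, hjm, by omega⟩

/-- Fibres over separating vertices lie close to geodesics. -/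
theorem wordLength_add_le_of_separates (hS : Subgroup.closure S = ⊤) {f : G → List α} {D : ℕ}
    (hf : ∀ g, ∀ s ∈ S, ListStep (f g) (f (g * s)))
    (hD : ∀ g h, f g = f h → wordLength S (g⁻¹ * h) ≤ D) {x z u : G} (hx : f u <:+ f x)
    (hz : ∀ a, a :: f u <:+ f x → ¬ a :: f u <:+ f z) :
    wordLength S (x⁻¹ * u) + wordLength S (u⁻¹ * z) ≤ wordLength S (x⁻¹ * z) + 2 * D := by
  obtain ⟨v, hvu, hv⟩ := exists_on_geodesic hS hf hx hz
  have huv := hD u v hvu.symm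
  have hvu := hD v u hvu
  have hxu := wordLength_triangle hS x v u
  have huz := wordLength_triangle hS u v z
  omega

theorem add_le_of_common_suffix (hS : Subgroup.closure S = ⊤) {f : G → List α} {D : ℕ}
    (hf : ∀ g, ∀ s ∈ S, ListStep (f g) (f (g * s)))
    (hD : ∀ g h, f g = f h → wordLength S (g⁻¹ * h) ≤ D) (h1 : f 1 = []) {x y z : G} {m : List α}
    (hx : m <:+ f x) (hy : m <:+ f y) (hxz : ∀ a, ¬(a :: m <:+ f x ∧ a :: m <:+ f z))
    (hyz : ∀ a, ¬(a :: m <:+ f y ∧ a :: m <:+ f z)) :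
    wordLength S (x⁻¹ * y) + wordLength S z ≤
        wordLength S (x⁻¹ * z) + wordLength S y + 4 * D ∧
      wordLength S (x⁻¹ * z) + wordLength S y ≤
        wordLength S x + wordLength S (y⁻¹ * z) + 4 * D := by
  obtain ⟨u, rfl, -⟩ := exists_on_geodesic hS hf hx fun a hax haz => hxz a ⟨hax, haz⟩
  have hroot : ∀ a, ¬ a :: f u <:+ f 1 := fun a h => by simpa [h1] using h.length_le
  have hxuz := wordLength_add_le_of_separates hS hf hD hx fun a hax haz => hxz a ⟨hax, haz⟩
  have hyuz := wordLength_add_le_of_separates hS hf hD hy fun a hay haz => hyz a ⟨hay, haz⟩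
  have hxu1 := wordLength_add_le_of_separates hS hf hD hx fun a _ => hroot a
  have hyu1 := wordLength_add_le_of_separates hS hf hD hy fun a _ => hroot a
  have hxy := wordLength_triangle hS x u y
  have hz := wordLength_triangle hS z u 1
  have hxz' := wordLength_triangle hS x u z
  have hy' := wordLength_triangle hS y u 1
  rw [wordLength_symm hS u y] at hxy
  rw [wordLength_symm hS z u] at hz
  simp only [mul_one, wordLength_inv hS] at *
  omega

theorem add_le_max_of_listStep (hS : Subgroup.closure S = ⊤) {f : G → List α} {D : ℕ}
    (hf : ∀ g, ∀ s ∈ S, ListStep (f g) (f (g * s)))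
    (hD : ∀ g h, f g = f h → wordLength S (g⁻¹ * h) ≤ D) (h1 : f 1 = []) (x y z : G) :
    wordLength S (x⁻¹ * y) + wordLength S z ≤
      max (wordLength S (x⁻¹ * z) + wordLength S y) (wordLength S x + wordLength S (y⁻¹ * z)) +
        4 * D := by
  have hxy := wordLength_symm hS x y
  have hxz := wordLength_symm hS x z
  have hyz := wordLength_symm hS y z
  obtain ⟨m, h | h | h, hm⟩ := exists_branch_point (f x) (f y) (f z)
  · have := add_le_of_common_suffix hS hf hD h1 h.1 h.2 (fun a => (hm a).2.1)
      fun a => (hm a).2.2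
    omega
  · have := add_le_of_common_suffix hS hf hD h1 h.1 h.2 (fun a => (hm a).1)
      fun a ha => (hm a).2.2 ha.symm
    omega
  · have := add_le_of_common_suffix hS hf hD h1 h.1 h.2 (fun a ha => (hm a).1 ha.symm)
      fun a ha => (hm a).2.1 ha.symm
    omega

variable (S) in
/-- Gromov's four-point condition with constant `δ` for the points `x, y, z, w` and the word metric
of `S`. -/
def FourPoint (δ : ℕ) (x y z w : G) : Prop :=
  wordLength S (x⁻¹ * y) + wordLength S (z⁻¹ * w) ≤
    max (wordLength S (x⁻¹ * z) + wordLength S (y⁻¹ * w))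
      (wordLength S (x⁻¹ * w) + wordLength S (y⁻¹ * z)) + δ

theorem fourPoint_of_listStep (hS : Subgroup.closure S = ⊤) {f : G → List α} {D : ℕ}
    (hf : ∀ g, ∀ s ∈ S, ListStep (f g) (f (g * s)))
    (hD : ∀ g h, f g = f h → wordLength S (g⁻¹ * h) ≤ D) (h1 : f 1 = []) (x y z w : G) :
    FourPoint S (4 * D) x y z w := by
  have hbase := add_le_max_of_listStep hS hf hD h1 (w⁻¹ * x) (w⁻¹ * y) (w⁻¹ * z)
  have htranslate : ∀ a b : G, (w⁻¹ * a)⁻¹ * (w⁻¹ * b) = a⁻¹ * b := fun a b => by group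
  rw [FourPoint, wordLength_symm hS z w, wordLength_symm hS y w, wordLength_symm hS x w]
  simpa only [htranslate] using hbase

end ListTree

/-! ### The extension as an HNN extension -/

section HNN

open HNNExtension NormalWord

variable {G : Type*} [Group G] {A B : Subgroup G} {φ : A ≃* B} {d : TransversalPair G A B}

theorem listStep_unitsSMul (u : ℤˣ) (w : NormalWord d) :
    ListStep w.toList (unitsSMul φ u w).toList := by
  classical
  unfold unitsSMul
  split_ifs with h
  · cases w using consRecOn with
    | ofGroup g => simp [Cancels] at h
    | cons g u' w h1 h2 => exact Or.inr (Or.inr ⟨(u', w.head), rfl⟩)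
  · exact Or.inr (Or.inl ⟨_, rfl⟩)

theorem eq_of_head_mul_prod (d : TransversalPair G A B) (x : HNNExtension G A B φ) :
    x = of (x • (empty : NormalWord d)).head *
      ((x • (empty : NormalWord d)).toList.map fun a => t ^ (a.1 : ℤ) * of a.2).prod := by
  have h := prod_smul φ x (empty : NormalWord d)
  rw [prod_empty, mul_one] at h
  exact h.symm

theorem exists_of_eq_mul_inv {x y : HNNExtension G A B φ}
    (h : (x • (empty : NormalWord d)).toList = (y • (empty : NormalWord d)).toList) :
    ∃ g, x * y⁻¹ = of g := by
  refine ⟨(x • (empty : NormalWord d)).head * (y • (empty : NormalWord d)).head⁻¹, ?_⟩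
  have hx := eq_of_head_mul_prod d x
  have hy := (inv_mul_eq_iff_eq_mul.2 (eq_of_head_mul_prod d y)).symm
  rw [h, hy, ← mul_assoc] at hx
  rw [map_mul, map_inv, mul_inv_eq_iff_eq_mul]
  exact hx

end HNN

namespace LocalPresentation

open SemidirectProduct Multiplicative HNNExtension

variable {p : ℕ} {c : ℕ+ → ℕ+} {L : Set ℕ+} {A : Type u} [Group A] (M : LocalPresentation p c L A)
  (N : ℕ)

/-- The vertex group `⟨a 0, …, a N⟩` of the HNN extension. -/
abbrev vertexGroup : Type u := M.window 0 N

/-- The associated subgroup `⟨a 0, …, a (N - 1)⟩`, trivial if `N = 0`. -/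
def lowerSubgroup : Subgroup (M.vertexGroup N) := (M.window 0 (N - 1)).subgroupOf _

/-- The associated subgroup `⟨a 1, …, a N⟩`, trivial if `N = 0`. -/
def upperSubgroup : Subgroup (M.vertexGroup N) := (M.window 1 N).subgroupOf _

/-- The isomorphism of the associated subgroups induced by the shift. -/
noncomputable def shiftEquiv : M.lowerSubgroup N ≃* M.upperSubgroup N :=
  (Subgroup.subgroupOfEquivOfLe (M.window_mono le_rfl (by omega))).trans <|
    (M.shift.subgroupMap _).trans <|
      (MulEquiv.subgroupCongr (by
        have := M.map_shift_zpow_window 1 0 (N - 1)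
        rw [zpow_one, zero_add, sub_add_cancel] at this
        exact this)).trans
      (Subgroup.subgroupOfEquivOfLe (M.window_mono (by omega) le_rfl)).symm

theorem coe_shiftEquiv (a : M.lowerSubgroup N) :
    ((M.shiftEquiv N a : M.vertexGroup N) : A) = M.shift (a : M.vertexGroup N) := rfl

/-- The HNN extension that the extension by the shift is isomorphic to if all relations have level
at most `N`. -/
abbrev HNN : Type u := HNNExtension (M.vertexGroup N) _ _ (M.shiftEquiv N)

theorem coe_windowTuple {u v i : ℤ} (h : i ∈ Set.Icc u v) :
    (M.windowTuple u v i : A) = M.gen i := by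
  rw [windowTuple, dif_pos h]

theorem of_windowTuple (k : ℕ) (hk : k ≤ N) :
    (of (M.windowTuple 0 N k) : M.HNN N) =
      t ^ (k : ℤ) * of (M.windowTuple 0 N 0) * (t ^ (k : ℤ))⁻¹ := by
  induction k with
  | zero => simp
  | succ k ih =>
    have hk₀ : (k : ℤ) ∈ Set.Icc (0 : ℤ) N := by rw [Set.mem_Icc]; omega
    have hk₁ : ((k + 1 : ℕ) : ℤ) ∈ Set.Icc (0 : ℤ) N := by rw [Set.mem_Icc]; omega
    have hmem : M.windowTuple 0 N k ∈ M.lowerSubgroup N := by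
      rw [lowerSubgroup, Subgroup.mem_subgroupOf, M.coe_windowTuple hk₀]
      exact M.gen_mem_window (by rw [Set.mem_Icc]; omega)
    have hshift : ((M.shiftEquiv N ⟨_, hmem⟩ : M.upperSubgroup N) : M.vertexGroup N) =
        M.windowTuple 0 N (k + 1 : ℕ) := by
      refine Subtype.ext ?_
      rw [M.coe_shiftEquiv, M.coe_windowTuple hk₁]
      change M.shift (M.windowTuple 0 N k : A) = _
      rw [M.coe_windowTuple hk₀, M.shift_gen, Nat.cast_add, Nat.cast_one]
    rw [← hshift, equiv_eq_conj, ih (by omega), Nat.cast_add, Nat.cast_one, add_comm (k : ℤ) 1,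
      zpow_add, zpow_one]
    group

theorem isLocalTuple_hnn (hL : ∀ n ∈ L, (n : ℕ) ≤ N) :
    IsLocalTuple p c L fun i : ℤ =>
      (t ^ i * of (M.windowTuple 0 N 0) * (t ^ i)⁻¹ : M.HNN N) where
  pow_eq_one i := by
    rw [conj_pow, ← map_pow, (M.isLocalTuple_windowTuple 0 N).pow_eq_one, map_one, mul_one,
      mul_inv_cancel]
  comm_eq_one n hn i hi := by
    -- Conjugating by the power of `t` that moves the least index to `0` turns the commutator into
    -- one of elements of the vertex group.
    obtain ⟨j₀, hj₀, hmin⟩ := Finset.exists_min_image (Finset.range (c n + 1)) i ⟨0, by simp⟩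
    rw [Finset.mem_range, Nat.lt_succ_iff] at hj₀
    have hloc := ((M.isLocalTuple_windowTuple 0 N).comp_add (-(i j₀))).map
      ((MulAut.conj (t ^ i j₀ : M.HNN N)).toMonoidHom.comp of)
    rw [← hloc.comm_eq_one n hn i hi]
    refine leftNormedCommutator_congr fun j hj => ?_
    have hle := hmin j (by simpa using Nat.lt_succ_of_le hj)
    have hge := (abs_le.1 (hi j hj j₀ hj₀)).2
    have hnN : (n : ℤ) ≤ N := by exact_mod_cast hL n hn
    obtain ⟨k, hk⟩ := Int.eq_ofNat_of_zero_le (sub_nonneg.2 hle)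
    rw [← sub_eq_add_neg, hk]
    simp only [MonoidHom.comp_apply, MulEquiv.coe_toMonoidHom, MulAut.conj_apply]
    rw [M.of_windowTuple N k (by omega), ← hk, ← add_sub_cancel (i j₀) (i j), zpow_add,
      add_sub_cancel]
    group

variable {N}

/-- The homomorphism `a 0 ↦ a 0`, `t ↦ t` to the HNN extension. -/
noncomputable def toHNN (hL : ∀ n ∈ L, (n : ℕ) ≤ N) : M.Ext →* M.HNN N :=
  M.extLift (M.isLocalTuple_hnn N hL)

theorem stable_mul_inl (a : A) : M.stable * inl a = inl (M.shift a) * M.stable := by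
  have h := M.stable_zpow_conj 1 a
  rwa [zpow_one, zpow_one, mul_inv_eq_iff_eq_mul] at h

variable (N) in
/-- The homomorphism `a i ↦ a i`, `t ↦ t` from the HNN extension. -/
noncomputable def ofHNN : M.HNN N →* M.Ext :=
  HNNExtension.lift (inl.comp (M.window 0 N).subtype) M.stable fun a =>
    M.stable_mul_inl (a : M.vertexGroup N).1

theorem ofHNN_of (x : M.vertexGroup N) : M.ofHNN N (of x) = inl x.1 := lift_of _ _ _ x

theorem ofHNN_toHNN (hL : ∀ n ∈ L, (n : ℕ) ≤ N) (g : M.Ext) :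
    M.ofHNN N (M.toHNN hL g) = g := by
  refine DFunLike.congr_fun (f := (M.ofHNN N).comp (M.toHNN hL)) (g := MonoidHom.id _)
    (M.ext_hom_ext ?_ ?_) g
  · rw [MonoidHom.comp_apply, toHNN, extLift_base, ofHNN_of, M.coe_windowTuple (by simp)]
    rfl
  · rw [MonoidHom.comp_apply, toHNN, extLift_stable]
    exact lift_t _ _ _

/-- The generating set `{a 0, t}`. -/
abbrev gens : Set M.Ext := {M.base, M.stable}

theorem exists_fourPoint (hp : 0 < p) (hL : ∀ n ∈ L, (n : ℕ) ≤ N) {n : ℕ+} (hn : n ∈ L)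
    (hnN : N ≤ n) : ∃ δ : ℕ, ∀ x y z w : M.Ext, FourPoint M.gens δ x y z w := by
  have : Finite (M.vertexGroup N) :=
    M.finite_window hp hn (by rw [sub_zero]; exact_mod_cast hnN)
  obtain ⟨d⟩ := NormalWord.TransversalPair.nonempty (M.vertexGroup N) (M.lowerSubgroup N)
    (M.upperSubgroup N)
  obtain ⟨D, hD⟩ := (Set.finite_range fun x : M.vertexGroup N =>
    wordLength M.gens (inl x.1 : M.Ext)).bddAbove
  let e : NormalWord d := NormalWord.empty
  refine ⟨4 * D, fourPoint_of_listStep M.closure_base_stable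
    (f := fun g => (M.toHNN hL g⁻¹ • e).toList) ?_ (fun g h hgh => ?_) (by simp [e])⟩
  · rintro g s (rfl | rfl)
    · rw [mul_inv_rev, map_mul, map_inv _ M.base, toHNN, extLift_base, mul_smul, ← map_inv of,
        NormalWord.of_smul_eq_smul, NormalWord.group_smul_toList]
      exact Or.inl rfl
    · rw [mul_inv_rev, map_mul, map_inv _ M.stable, toHNN, extLift_stable, mul_smul]
      have := NormalWord.t_pow_smul_eq_unitsSMul (M.shiftEquiv N) (-1)
        (M.extLift (M.isLocalTuple_hnn N hL) g⁻¹ • e)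
      rw [Units.val_neg, Units.val_one, zpow_neg_one] at this
      rw [this]
      exact listStep_unitsSMul _ _
  · obtain ⟨x, hx⟩ := exists_of_eq_mul_inv hgh
    have hgx : g⁻¹ * h = inl x.1 := by
      rw [← M.ofHNN_of x, ← hx, ← map_inv, ← map_mul, inv_inv, ofHNN_toHNN]
    rw [hgx]
    exact hD ⟨x, rfl⟩

end LocalPresentation

/-! ### Alternating words survive in finite `p`-groups -/

section Unitriangular

variable {r : ℕ} {R : Type*} [Ring R] {m n : ℕ} {B C : Matrix (Fin r) (Fin r) R}

variable (r R m) in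
/-- The additive group of the matrices whose entries on the first `m` diagonals, counted from the
main one upwards, and below the main diagonal vanish. -/
def upperBand : AddSubgroup (Matrix (Fin r) (Fin r) R) where
  carrier := {B | ∀ i j : Fin r, (j : ℕ) < i + m → B i j = 0}
  zero_mem' _ _ _ := rfl
  add_mem' hB hC i j h := by rw [Matrix.add_apply, hB i j h, hC i j h, add_zero]
  neg_mem' hB i j h := by rw [Matrix.neg_apply, hB i j h, neg_zero]

theorem mul_mem_upperBand (hB : B ∈ upperBand r R m) (hC : C ∈ upperBand r R n) :
    B * C ∈ upperBand r R (m + n) := fun i j h => by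
  rw [Matrix.mul_apply]
  refine Finset.sum_eq_zero fun k _ => ?_
  by_cases hk : (k : ℕ) < i + m
  · rw [hB i k hk, zero_mul]
  · rw [hC k j (by omega), mul_zero]

theorem upperBand_antitone : Antitone (upperBand r R) :=
  fun _ _ h _ hB i j hij => hB i j (by omega)

theorem one_mem_upperBand : (1 : Matrix (Fin r) (Fin r) R) ∈ upperBand r R 0 :=
  fun i j h => Matrix.one_apply_ne (by rintro rfl; omega)

theorem pow_mem_upperBand (hB : B ∈ upperBand r R 1) (k : ℕ) : B ^ k ∈ upperBand r R k := by
  induction k with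
  | zero => exact one_mem_upperBand
  | succ k ih => rw [pow_succ]; exact mul_mem_upperBand ih hB

theorem pow_eq_zero_of_mem_upperBand (hB : B ∈ upperBand r R 1) (hn : r ≤ n) : B ^ n = 0 := by
  ext i j
  exact pow_mem_upperBand hB n i j (by omega)

theorem inv_sub_one_mem_upperBand {u : (Matrix (Fin r) (Fin r) R)ˣ}
    (hu : (u : Matrix (Fin r) (Fin r) R) - 1 ∈ upperBand r R 1) :
    (↑u⁻¹ : Matrix (Fin r) (Fin r) R) - 1 ∈ upperBand r R 1 := by
  have hneg : 1 - (u : Matrix (Fin r) (Fin r) R) ∈ upperBand r R 1 := by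
    rw [← neg_sub]; exact neg_mem hu
  have hinv : (↑u⁻¹ : Matrix (Fin r) (Fin r) R) =
      ∑ i ∈ Finset.range r, (1 - (u : Matrix (Fin r) (Fin r) R)) ^ i := by
    have hgeom := geom_sum_mul_neg (1 - (u : Matrix (Fin r) (Fin r) R)) r
    rw [pow_eq_zero_of_mem_upperBand hneg le_rfl, sub_zero, sub_sub_cancel] at hgeom
    exact u.inv_eq_of_mul_eq_one_left hgeom
  have hmem : (↑u⁻¹ : Matrix (Fin r) (Fin r) R) ∈ upperBand r R 0 := by
    rw [hinv]
    exact sum_mem fun i _ => upperBand_antitone i.zero_le (pow_mem_upperBand hneg i)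
  have hmul := mul_mem_upperBand hneg hmem
  rwa [sub_mul, one_mul, Units.mul_inv] at hmul

variable (r R) in
/-- The group of the upper unitriangular matrices. -/
def unitriangular : Subgroup (Matrix (Fin r) (Fin r) R)ˣ where
  carrier := {u | (u : Matrix (Fin r) (Fin r) R) - 1 ∈ upperBand r R 1}
  one_mem' := by simp
  mul_mem' {u v} hu hv := by
    have h : (↑(u * v) : Matrix (Fin r) (Fin r) R) - 1 = (↑u - 1) * (↑v - 1) +
        ((↑u - 1) + (↑v - 1)) := by
      rw [Units.val_mul]; noncomm_ring
    rw [Set.mem_ofPred_eq, h]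
    exact add_mem (upperBand_antitone (by omega) (mul_mem_upperBand hu hv)) (add_mem hu hv)
  inv_mem' := inv_sub_one_mem_upperBand

theorem isPGroup_unitriangular (p r : ℕ) [Fact p.Prime] [CharP R p] :
    IsPGroup p (unitriangular r R) := by
  refine fun u => ⟨r, Subtype.ext (Units.ext ?_)⟩
  cases isEmpty_or_nonempty (Fin r)
  · exact Subsingleton.elim _ _
  have hpow := add_pow_char_pow_of_commute p r
    (Commute.one_right ((u.1 : Matrix (Fin r) (Fin r) R) - 1))
  rw [sub_add_cancel, pow_eq_zero_of_mem_upperBand u.2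
    (Nat.lt_pow_self (Fact.out : p.Prime).one_lt).le, one_pow, zero_add] at hpow
  simpa using hpow

variable {X : Type*} {l : List (ℤˣ × X)} (hl : l.IsChain fun a b => a.2 ≠ b.2) {k : ℕ}

variable (R l) in
open Classical in
/-- The matrix with an entry `1` at the places `(i, i + 1)` such that the `i`-th letter is `x`. -/
noncomputable def letterMatrix (x : X) : Matrix (Fin (l.length + 1)) (Fin (l.length + 1)) R :=
  Matrix.of fun i j => if (j : ℕ) = i + 1 ∧ (l[(i : ℕ)]?).map Prod.snd = some x then 1 else 0

theorem letterMatrix_apply_of_ne (x : X) {i j : Fin (l.length + 1)} (h : (j : ℕ) ≠ i + 1) :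
    letterMatrix R l x i j = 0 := by
  rw [letterMatrix, Matrix.of_apply, if_neg fun h' => h h'.1]

theorem letterMatrix_apply_succ (hk : k < l.length) :
    letterMatrix R l l[k].2 ⟨k, by omega⟩ ⟨k + 1, by omega⟩ = 1 := by
  rw [letterMatrix, Matrix.of_apply, if_pos]
  exact ⟨rfl, by rw [List.getElem?_eq_getElem hk]; rfl⟩

theorem letterMatrix_mem_upperBand (x : X) : letterMatrix R l x ∈ upperBand _ R 1 :=
  fun _ _ h => letterMatrix_apply_of_ne x h.ne

theorem mul_letterMatrix_apply (B : Matrix (Fin (l.length + 1)) (Fin (l.length + 1)) R) (x : X)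
    (i₀ : Fin (l.length + 1)) {i j : Fin (l.length + 1)} (hij : (j : ℕ) = i + 1) :
    (B * letterMatrix R l x) i₀ j = B i₀ i * letterMatrix R l x i j := by
  rw [Matrix.mul_apply]
  refine Finset.sum_eq_single i (fun b _ hb => ?_) (by simp)
  rw [letterMatrix_apply_of_ne, mul_zero]
  exact fun h => hb (Fin.ext (by omega))

include hl in
theorem letterMatrix_mul_self (x : X) : letterMatrix R l x * letterMatrix R l x = 0 := by
  ext i k
  rw [Matrix.mul_apply, Matrix.zero_apply]
  refine Finset.sum_eq_zero fun j _ => ?_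
  simp only [letterMatrix, Matrix.of_apply, mul_ite, mul_one, mul_zero]
  split_ifs with hjk hij <;> try rfl
  rw [Option.map_eq_some_iff] at hij hjk
  obtain ⟨hij, a, ha, hax⟩ := hij
  obtain ⟨-, b, hb, hbx⟩ := hjk
  rw [hij] at hb
  obtain ⟨hi, rfl⟩ := List.getElem?_eq_some_iff.1 ha
  obtain ⟨hj, rfl⟩ := List.getElem?_eq_some_iff.1 hb
  exact absurd (hax.trans hbx.symm) (List.isChain_iff_getElem.1 hl i hj)

variable (R) in
/-- The unipotent matrix `1 + N`, where `N` is the matrix of the letter `x`. -/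
noncomputable def letterUnit (x : X) :
    (Matrix (Fin (l.length + 1)) (Fin (l.length + 1)) R)ˣ where
  val := 1 + letterMatrix R l x
  inv := 1 - letterMatrix R l x
  val_inv := by
    rw [mul_sub, mul_one, add_mul, one_mul, letterMatrix_mul_self hl, add_zero,
      add_sub_cancel_right]
  inv_val := by
    rw [mul_add, mul_one, sub_mul, one_mul, letterMatrix_mul_self hl, sub_zero, sub_add_cancel]

theorem letterUnit_mem_unitriangular (x : X) : letterUnit R hl x ∈ unitriangular _ R := by
  change 1 + letterMatrix R l x - 1 ∈ upperBand _ R 1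
  rw [add_sub_cancel_left]
  exact letterMatrix_mem_upperBand x

theorem letterUnit_zpow (x : X) (u : ℤˣ) :
    (↑(letterUnit R hl x ^ (u : ℤ)) : Matrix (Fin (l.length + 1)) (Fin (l.length + 1)) R) =
      1 + (u : ℤ) • letterMatrix R l x := by
  rcases Int.units_eq_one_or u with rfl | rfl
  · simp [letterUnit]
  · simp only [Units.val_neg, Units.val_one, zpow_neg, zpow_one, neg_smul, one_smul,
      ← sub_eq_add_neg]
    rfl

theorem prod_take_succ_letterUnit (hk : k < l.length) :
    (((l.take (k + 1)).map fun a => letterUnit R hl a.2 ^ (a.1 : ℤ)).prod :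
        Matrix (Fin (l.length + 1)) (Fin (l.length + 1)) R) =
      ((l.take k).map fun a => letterUnit R hl a.2 ^ (a.1 : ℤ)).prod +
        (l[k].1 : ℤ) • (((l.take k).map fun a => letterUnit R hl a.2 ^ (a.1 : ℤ)).prod *
          letterMatrix R l l[k].2) := by
  rw [List.take_add_one, List.getElem?_eq_getElem hk, Option.toList_some, List.map_append,
    List.prod_append, List.map_singleton, List.prod_singleton, Units.val_mul, letterUnit_zpow,
    mul_add, mul_one, mul_smul_comm]

theorem isUnit_prod_take_letterUnit (hk : k ≤ l.length) :
    let B : Matrix (Fin (l.length + 1)) (Fin (l.length + 1)) R :=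
      ((l.take k).map fun a => letterUnit R hl a.2 ^ (a.1 : ℤ)).prod
    IsUnit (B 0 ⟨k, Nat.lt_succ_of_le hk⟩) ∧ ∀ j : Fin (l.length + 1), k < j → B 0 j = 0 := by
  induction k with
  | zero =>
    refine ⟨by simp, fun j hj => ?_⟩
    simp only [List.take_zero, List.map_nil, List.prod_nil, Units.val_one]
    exact Matrix.one_apply_ne (by rintro rfl; simp at hj)
  | succ k ih =>
    have hk' : k < l.length := hk
    obtain ⟨hunit, hzero⟩ := ih hk'.le
    simp only [prod_take_succ_letterUnit hl hk', Matrix.add_apply, Matrix.smul_apply]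
    refine ⟨?_, fun j hj => ?_⟩
    · rw [hzero _ (Nat.lt_succ_self k), zero_add,
        mul_letterMatrix_apply _ _ _ (i := ⟨k, by omega⟩) rfl, letterMatrix_apply_succ, mul_one,
        zsmul_eq_mul]
      exact (l[k].1.isUnit.map (Int.castRingHom R)).mul hunit
    · rw [hzero j (by omega), zero_add,
        mul_letterMatrix_apply _ _ _ (i := ⟨j - 1, by omega⟩) (by simp; omega),
        hzero ⟨j - 1, by omega⟩ (by change k < (j : ℕ) - 1; omega), zero_mul, smul_zero]

theorem exists_isPGroup_prod_ne_one (p : ℕ) [Fact p.Prime] (hne : l ≠ [])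
    (hl : l.IsChain fun a b => a.2 ≠ b.2) :
    ∃ (Q : Type) (_ : Group Q) (_ : Finite Q) (q : X → Q), IsPGroup p Q ∧
      (l.map fun a => q a.2 ^ (a.1 : ℤ)).prod ≠ 1 := by
  refine ⟨unitriangular (l.length + 1) (ZMod p), inferInstance, inferInstance,
    fun x => ⟨letterUnit (ZMod p) hl x, letterUnit_mem_unitriangular hl x⟩,
    isPGroup_unitriangular p _, fun h => ?_⟩
  have hprod := congrArg (unitriangular (l.length + 1) (ZMod p)).subtype h
  rw [map_list_prod, List.map_map, map_one] at hprod
  change (l.map fun a => letterUnit (ZMod p) hl a.2 ^ (a.1 : ℤ)).prod = 1 at hprod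
  have hunit := (isUnit_prod_take_letterUnit (R := ZMod p) hl le_rfl).1
  rw [List.take_length, hprod, Units.val_one, Matrix.one_apply_ne] at hunit
  · exact not_isUnit_zero hunit
  · rw [Ne, Fin.ext_iff]
    exact fun h0 => hne (List.length_eq_zero_iff.1 h0.symm)

end Unitriangular

/-! ### HNN extensions of finite `p`-groups -/

section HNN

open HNNExtension

/-- The cosets that are read along a word of an HNN extension whose base group and stable letter are
sent to `E` by `ρ` and `τ`, starting from `e`. -/
def letters {E P : Type*} [Group E] [Group P] (ρ : P →* E) (τ : E) (B : Subgroup E) :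
    E → List (ℤˣ × P) → List (ℤˣ × (E ⧸ B))
  | _, [] => []
  | e, (u, x) :: l => (u, ((if u = 1 then e else e * τ⁻¹ : E) : E ⧸ B)) ::
      letters ρ τ B (e * τ ^ (u : ℤ) * ρ x) l

variable {E P Q : Type*} [Group E] [Group P] [Group Q] {A B : Subgroup P} {φ : A ≃* B} {ρ : P →* E}
  {τ : E}

theorem letters_ne_nil (e : E) {l : List (ℤˣ × P)} (hl : l ≠ []) :
    letters ρ τ (B.map ρ) e l ≠ [] := by
  obtain ⟨⟨u, x⟩, l, rfl⟩ := List.exists_cons_of_ne_nil hl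
  exact List.cons_ne_nil _ _

theorem mem_of_conj_mem_map (hρ : Function.Injective ρ) (hτ : ∀ a : A, τ * ρ a = ρ (φ a) * τ)
    {x : P} (hx : τ * ρ x * τ⁻¹ ∈ B.map ρ) : x ∈ A := by
  obtain ⟨b, hb, hbx⟩ := hx
  have hconj := hτ (φ.symm ⟨b, hb⟩)
  rw [MulEquiv.apply_symm_apply, hbx, inv_mul_cancel_right] at hconj
  rw [← hρ (mul_left_cancel hconj)]
  exact (φ.symm ⟨b, hb⟩).2

theorem isChain_letters {C : Type*} [Group C] (hρ : Function.Injective ρ)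
    (hτ : ∀ a : A, τ * ρ a = ρ (φ a) * τ) (χ : E →* C) (hχρ : ∀ x, χ (ρ x) = 1) (hχτ : χ τ ≠ 1)
    (e : E) (l : List (ℤˣ × P)) (hl : l.IsChain fun a b => a.2 ∈ toSubgroup A B a.1 → a.1 = b.1) :
    (letters ρ τ (B.map ρ) e l).IsChain fun a b => a.2 ≠ b.2 := by
  have hχB : ∀ y ∈ B.map ρ, χ y = 1 := by
    rintro _ ⟨x, -, rfl⟩
    exact hχρ x
  induction l generalizing e with
  | nil => exact List.isChain_nil
  | cons a l ih =>
    obtain ⟨u, x⟩ := a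
    rw [List.isChain_cons] at hl
    rw [letters, List.isChain_cons]
    refine ⟨?_, ih _ hl.2⟩
    cases l with
    | nil => simp [letters]
    | cons b l =>
      obtain ⟨u', x'⟩ := b
      have h := hl.1 (u', x') rfl
      simp only [letters, List.head?_cons, Option.mem_def, Option.some.injEq, forall_eq',
        ne_eq, QuotientGroup.eq]
      rcases Int.units_eq_one_or u with rfl | rfl <;> rcases Int.units_eq_one_or u' with rfl | rfl
      · exact fun hmem => hχτ (by simpa [hχρ] using hχB _ hmem)
      · have hx : x ∉ A := fun hx => by simpa using h hx
        exact fun hmem => hx (mem_of_conj_mem_map hρ hτ (by simpa [mul_assoc] using hmem))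
      · have hx : x ∉ B := fun hx => by simpa using h hx
        intro hmem
        obtain ⟨b, hb, hbx⟩ : ρ x ∈ B.map ρ := by simpa [mul_assoc] using hmem
        exact hx (hρ hbx ▸ hb)
      · exact fun hmem => hχτ (by simpa [hχρ, mul_assoc] using hχB _ hmem)

/-- The homomorphism from an HNN extension to a wreath product that extends `ρ` and sends the stable
letter to `τ`, decorated by a function on the cosets of the image of the second associated
subgroup. -/
def hnnToWreath (hτ : ∀ a : A, τ * ρ a = ρ (φ a) * τ) (q : E ⧸ B.map ρ → Q) :
    HNNExtension P A B φ →* Q ≀ᵣ E :=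
  HNNExtension.lift (RegularWreathProduct.inl.comp ρ) ⟨fun y => q (y⁻¹ : E), τ⟩ fun a => by
    ext y
    · simp only [RegularWreathProduct.mul_left, MonoidHom.comp_apply,
        RegularWreathProduct.left_inl, RegularWreathProduct.right_inl, Pi.mul_apply, Pi.one_apply,
        mul_one, one_mul]
      congr 1
      rw [QuotientGroup.eq, mul_inv_rev, inv_inv, inv_inv, mul_inv_cancel_left]
      exact ⟨_, (φ a).2, rfl⟩
    · exact hτ a

variable (hτ : ∀ a : A, τ * ρ a = ρ (φ a) * τ) (q : E ⧸ B.map ρ → Q)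

theorem hnnToWreath_of (x : P) : hnnToWreath hτ q (of x) = RegularWreathProduct.inl (ρ x) :=
  lift_of _ _ _ x

theorem hnnToWreath_t : hnnToWreath hτ q t = ⟨fun y => q (y⁻¹ : E), τ⟩ := lift_t _ _ _

theorem hnnToWreath_zpow_right (u : ℤ) : (hnnToWreath hτ q (t ^ u)).right = τ ^ u := by
  rw [map_zpow, hnnToWreath_t]
  exact map_zpow (RegularWreathProduct.rightHom : Q ≀ᵣ E →* E) _ u

theorem hnnToWreath_zpow_left (u : ℤˣ) (e : E) : (hnnToWreath hτ q (t ^ (u : ℤ))).left e⁻¹ =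
    q ((if u = 1 then e else e * τ⁻¹ : E) : E ⧸ B.map ρ) ^ (u : ℤ) := by
  rcases Int.units_eq_one_or u with rfl | rfl
  · simp only [Units.val_one, zpow_one, hnnToWreath_t, if_pos, inv_inv]
  · simp only [Units.val_neg, Units.val_one, zpow_neg, zpow_one, map_inv, hnnToWreath_t,
      RegularWreathProduct.inv_left, Pi.inv_apply, mul_inv_rev, inv_inv]
    rw [if_neg (by decide)]

theorem hnnToWreath_prod_left (l : List (ℤˣ × P)) (e : E) :
    (hnnToWreath hτ q (l.map fun a => t ^ (a.1 : ℤ) * of a.2).prod).left e⁻¹ =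
      ((letters ρ τ (B.map ρ) e l).map fun a => q a.2 ^ (a.1 : ℤ)).prod := by
  induction l generalizing e with
  | nil => simp [letters]
  | cons a l ih =>
    obtain ⟨u, x⟩ := a
    rw [List.map_cons, List.prod_cons, map_mul, map_mul, hnnToWreath_of, letters, List.map_cons,
      List.prod_cons, ← ih, ← hnnToWreath_zpow_left hτ q u e]
    simp only [RegularWreathProduct.mul_left, Pi.mul_apply,
      RegularWreathProduct.left_inl, RegularWreathProduct.right_inl, Pi.one_apply, one_mul,
      hnnToWreath_zpow_right, mul_inv_rev, mul_assoc]

include hτ in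
theorem isResiduallyFinitePGroup_hnnExtension {p : ℕ} [Fact p.Prime] [Finite E] (hE : IsPGroup p E)
    (hρ : Function.Injective ρ) {C : Type*} [Group C] (χ : E →* C) (hχρ : ∀ x, χ (ρ x) = 1)
    (hχτ : χ τ ≠ 1) : IsResiduallyFinitePGroup p (HNNExtension P A B φ) := by
  intro g hg
  obtain ⟨d⟩ := NormalWord.TransversalPair.nonempty P A B
  set w : NormalWord d := g • NormalWord.empty
  have hw : g = of w.head * (w.toList.map fun a => t ^ (a.1 : ℤ) * of a.2).prod :=
    eq_of_head_mul_prod d g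
  by_cases hnil : w.toList = []
  · rw [hnil, List.map_nil, List.prod_nil, mul_one] at hw
    refine exists_normal_notMem_of_hom hE (HNNExtension.lift ρ τ hτ) fun h => hg ?_
    rw [hw, lift_of, map_eq_one_iff ρ hρ] at h
    rw [hw, h, map_one]
  · obtain ⟨Q, _, _, q, hQ, hq⟩ := exists_isPGroup_prod_ne_one p (letters_ne_nil (ρ w.head) hnil)
      (isChain_letters hρ hτ χ hχρ hχτ _ _ w.chain)
    refine exists_normal_notMem_of_hom (isPGroup_regularWreathProduct hQ hE) (hnnToWreath hτ q)
      fun h => hq ?_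
    rw [← hnnToWreath_prod_left hτ]
    have hleft := congrFun (congrArg RegularWreathProduct.left h) 1
    rw [hw, map_mul, hnnToWreath_of] at hleft
    simpa using hleft

end HNN

namespace LocalPresentation

open SemidirectProduct Multiplicative HNNExtension

variable {p : ℕ} {c : ℕ+ → ℕ+} {L : Set ℕ+} {A : Type u} [Group A] (M : LocalPresentation p c L A)
  {N : ℕ}

theorem isResiduallyFinitePGroup_of_le [Fact p.Prime] (hL : ∀ n ∈ L, (n : ℕ) ≤ N) {n : ℕ+}
    (hn : n ∈ L) (hnN : N ≤ n) : IsResiduallyFinitePGroup p M.Ext := by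
  obtain ⟨q, hq, E, _, _, F, χ, hE, hF, hχ⟩ := M.exists_finite_quotient (u := 0) (v := N) hn
    (by rw [sub_zero]; exact_mod_cast hnN) 1
  have : Fact (1 < q) := ⟨hq⟩
  let ρ : M.vertexGroup N →* E := (F.comp inl).comp (Subgroup.subtype _)
  have hρ : Function.Injective ρ :=
    (injective_iff_map_eq_one ρ).2 fun x hx => Subtype.ext (hF x.1 x.2 hx)
  have hτ : ∀ a : M.lowerSubgroup N, F M.stable * ρ a = ρ (M.shiftEquiv N a) * F M.stable := by
    intro a
    change F M.stable * F (inl (a : M.vertexGroup N).1) = F (inl (M.shiftEquiv N a).1.1) * _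
    rw [M.coe_shiftEquiv, ← map_mul, ← map_mul, stable_mul_inl]
  refine (isResiduallyFinitePGroup_hnnExtension hτ hE hρ χ (fun x => ?_) ?_).of_injective
    (M.toHNN hL) (Function.LeftInverse.injective (M.ofHNN_toHNN hL))
  · exact (hχ _).trans (by simp)
  · rw [hχ, Ne, ofAdd_eq_one]
    simp [stable]

end LocalPresentation

/-! ### Balls in word metrics -/

section Balls

variable {G Γ : Type*} [Group G] [Group Γ]

theorem finite_ball {S : Set G} (hS : Subgroup.closure S = ⊤) (hfin : S.Finite) (R : ℕ) :
    {g : G | wordLength S g ≤ R}.Finite := by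
  have : Finite {x : G // x ∈ S ∨ x⁻¹ ∈ S} := (hfin.union hfin.inv).to_subtype
  refine ((List.finite_length_le {x : G // x ∈ S ∨ x⁻¹ ∈ S} R).image
    fun l => (l.map Subtype.val).prod).subset fun g hg => ?_
  obtain ⟨l, hl, hlS, rfl⟩ := isWordOfLength_wordLength hS g
  exact ⟨l.attach.map fun x => ⟨x.1, hlS x.1 x.2⟩, by simpa [hl] using hg, by simp⟩

variable (Φ : Γ →* G) {S : Set Γ} {S' : Set G}

theorem wordLength_map_le (hS : Subgroup.closure S = ⊤) (himg : Φ '' S = S') (g : Γ) :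
    wordLength S' (Φ g) ≤ wordLength S g := by
  obtain ⟨l, hl, hlS, rfl⟩ := isWordOfLength_wordLength hS g
  refine wordLength_le ⟨l.map Φ, by rw [List.length_map, hl], ?_, by rw [map_list_prod]⟩
  intro x hx
  obtain ⟨y, hy, rfl⟩ := List.mem_map.1 hx
  rw [← himg, ← map_inv]
  exact (hlS y hy).imp (fun h => ⟨y, h, rfl⟩) fun h => ⟨_, h, rfl⟩

theorem exists_lift_wordLength (hS : Subgroup.closure S = ⊤) (hS' : Subgroup.closure S' = ⊤)
    (himg : Φ '' S = S') (x : G) : ∃ g, Φ g = x ∧ wordLength S g = wordLength S' x := by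
  obtain ⟨l, hl, hlS, rfl⟩ := isWordOfLength_wordLength hS' x
  obtain ⟨l, rfl⟩ : l ∈ Set.range (List.map fun z : {z : Γ // z ∈ S ∨ z⁻¹ ∈ S} => Φ z) := by
    rw [Set.range_list_map]
    intro y hy
    rcases hlS y hy with h | h <;> rw [← himg] at h <;> obtain ⟨z, hz, hzy⟩ := h
    · exact ⟨⟨z, Or.inl hz⟩, hzy⟩
    · exact ⟨⟨z⁻¹, Or.inr (by rwa [inv_inv])⟩, (map_inv Φ z).trans (by rw [hzy, inv_inv])⟩
  have hprod : Φ (l.map Subtype.val).prod =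
      (l.map fun z : {z : Γ // z ∈ S ∨ z⁻¹ ∈ S} => Φ z).prod := by
    rw [map_list_prod, List.map_map]
    rfl
  refine ⟨(l.map Subtype.val).prod, hprod, le_antisymm ?_ ?_⟩
  · rw [← hl, List.length_map]
    exact wordLength_le ⟨l.map Subtype.val, by simp, fun y hy => by
      obtain ⟨z, -, rfl⟩ := List.mem_map.1 hy; exact z.2, rfl⟩
  · rw [← hprod]
    exact wordLength_map_le Φ hS himg _

theorem wordLength_map_eq (hS : Subgroup.closure S = ⊤) (hS' : Subgroup.closure S' = ⊤)
    (himg : Φ '' S = S') {R : ℕ} (hinj : ∀ g, wordLength S g ≤ 2 * R → Φ g = 1 → g = 1) {g : Γ}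
    (hg : wordLength S g ≤ R) : wordLength S' (Φ g) = wordLength S g := by
  obtain ⟨h, hh, hhl⟩ := exists_lift_wordLength Φ hS hS' himg (Φ g)
  have hle := wordLength_map_le Φ hS himg g
  have hmul := wordLength_mul_le hS g h⁻¹
  rw [wordLength_inv hS] at hmul
  have hgh := hinj (g * h⁻¹) (by omega) (by rw [map_mul, map_inv, hh, mul_inv_cancel])
  rw [← hhl, mul_inv_eq_one.1 hgh]

theorem fourPoint_of_injOn_ball (hS : Subgroup.closure S = ⊤) (hS' : Subgroup.closure S' = ⊤)
    (himg : Φ '' S = S') {R δ : ℕ} (hinj : ∀ g, wordLength S g ≤ 4 * R → Φ g = 1 → g = 1)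
    (hδ : ∀ x y z w, FourPoint S δ x y z w) {x y z w : G} (hx : wordLength S' x ≤ R)
    (hy : wordLength S' y ≤ R) (hz : wordLength S' z ≤ R) (hw : wordLength S' w ≤ R) :
    FourPoint S' δ x y z w := by
  have hdist : ∀ a b, wordLength S a ≤ R → wordLength S b ≤ R →
      wordLength S' ((Φ a)⁻¹ * Φ b) = wordLength S (a⁻¹ * b) := by
    intro a b ha hb
    have hab := wordLength_mul_le hS a⁻¹ b
    rw [wordLength_inv hS] at hab
    rw [← map_inv, ← map_mul]
    exact wordLength_map_eq Φ hS hS' himg (R := 2 * R) (by rwa [← mul_assoc]) (by omega)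
  obtain ⟨x, rfl, hx'⟩ := exists_lift_wordLength Φ hS hS' himg x
  obtain ⟨y, rfl, hy'⟩ := exists_lift_wordLength Φ hS hS' himg y
  obtain ⟨z, rfl, hz'⟩ := exists_lift_wordLength Φ hS hS' himg z
  obtain ⟨w, rfl, hw'⟩ := exists_lift_wordLength Φ hS hS' himg w
  rw [← hx'] at hx
  rw [← hy'] at hy
  rw [← hz'] at hz
  rw [← hw'] at hw
  simpa only [FourPoint, hdist, hx, hy, hz, hw] using hδ x y z w

end Balls

/-! ### The choice of the sequence of nilpotency classes -/

namespace LocalPresentation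

open SemidirectProduct

variable {p : ℕ} [Fact p.Prime]

theorem exists_survives (c : ℕ+ → ℕ+) (N : ℕ+) {A : Type u} [Group A]
    (M : LocalPresentation p c (Set.Iic N) A) {g : M.Ext} (hg : g ≠ 1) :
    ∃ K : ℕ, ∀ c' : ℕ+ → ℕ+, (∀ k ≤ N, c' k = c k) → (∀ k, N < k → K ≤ c' k) →
      ∀ Φ : M.Ext →* (groupA p c').Ext, Φ M.base = (groupA p c').base →
        Φ M.stable = (groupA p c').stable → Φ g ≠ 1 := by
  obtain ⟨V, _, hgV, _, hV⟩ := M.isResiduallyFinitePGroup_of_le (fun n hn => hn)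
    (Set.mem_Iic.2 le_rfl) le_rfl g hg
  obtain ⟨K, hK⟩ := Subgroup.nilpotent_iff_lowerCentralSeries.1 hV.isNilpotent
  let F := QuotientGroup.mk' V
  refine ⟨K, fun c' hc' hK' Φ hbase hstable h => hgV ((QuotientGroup.eq_one_iff g).1 ?_)⟩
  have hloc : IsLocalTuple p c' Set.univ fun i : ℤ =>
      F M.stable ^ i * F M.base * (F M.stable ^ i)⁻¹ := by
    simp only [← M.map_inl_gen]
    have hM := M.isLocalTuple_gen.map (F.comp inl)
    refine ⟨hM.pow_eq_one, fun n _ i hi => ?_⟩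
    by_cases hn : n ≤ N
    · rw [hc' n hn] at hi ⊢
      exact hM.comm_eq_one n hn i hi
    · have hmem := (⊤ : Subgroup (M.Ext ⧸ V)).lowerCentralSeries_antitone (hK' n (not_le.1 hn))
        (leftNormedCommutator_mem_lowerCentralSeries (fun j => F (inl (M.gen (i j)))) (c' n))
      rwa [hK] at hmem
  have hF : ((groupA p c').extLift hloc).comp Φ = F := M.ext_hom_ext
    (by rw [MonoidHom.comp_apply, hbase, extLift_base])
    (by rw [MonoidHom.comp_apply, hstable, extLift_stable])
  change F g = 1
  rw [← hF, MonoidHom.comp_apply, h, map_one]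

theorem exists_fourPoint_ball (c : ℕ+ → ℕ+) (N : ℕ+) :
    ∃ δ : ℕ, ∀ R : ℕ, ∃ K : ℕ, ∀ c' : ℕ+ → ℕ+, (∀ k ≤ N, c' k = c k) →
      (∀ k, N < k → K ≤ c' k) → ∀ x y z w : (groupA p c').Ext,
        wordLength (groupA p c').gens x ≤ R → wordLength (groupA p c').gens y ≤ R →
        wordLength (groupA p c').gens z ≤ R → wordLength (groupA p c').gens w ≤ R →
          FourPoint (groupA p c').gens δ x y z w := by
  let M := presented p c (Set.Iic N)
  obtain ⟨δ, hδ⟩ := M.exists_fourPoint (Fact.out : p.Prime).pos (fun n hn => hn)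
    (Set.mem_Iic.2 le_rfl) le_rfl
  refine ⟨δ, fun R => ?_⟩
  choose! K hK using fun (g : M.Ext) (hg : g ≠ 1) => exists_survives c N M hg
  obtain ⟨K', hK'⟩ :=
    ((finite_ball M.closure_base_stable (Set.toFinite _) (4 * R)).image K).bddAbove
  refine ⟨K', fun c' hc' hcK x y z w => ?_⟩
  have hloc : IsLocalTuple p c (Set.Iic N) fun i : ℤ =>
      (groupA p c').stable ^ i * (groupA p c').base * ((groupA p c').stable ^ i)⁻¹ := by
    have hloc' := (groupA p c').isLocalTuple_gen.map (inl : _ →* (groupA p c').Ext)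
    simp only [← inl_gen]
    refine ⟨hloc'.pow_eq_one, fun n hn i hi => ?_⟩
    rw [← hc' n hn] at hi ⊢
    exact hloc'.comm_eq_one n (Set.mem_univ _) i hi
  refine fourPoint_of_injOn_ball (M.extLift hloc) M.closure_base_stable
    (groupA p c').closure_base_stable
    (by rw [Set.image_pair, extLift_base, extLift_stable]) (R := R) (fun g hg h => ?_) hδ
  by_contra hg1
  exact hK g hg1 c' hc' (fun k hk => (hK' ⟨g, hg, rfl⟩).trans (hcK k hk)) _
    (M.extLift_base _) (M.extLift_stable _) h

end LocalPresentation

theorem exists_monotone_forall_le (κ : ℕ+ → (ℕ+ → ℕ+) → ℕ)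
    (hκ : ∀ n c c', (∀ k ≤ n, c k = c' k) → κ n c = κ n c') :
    ∃ c : ℕ+ → ℕ+, Monotone c ∧ ∀ n k, n < k → κ n c ≤ c k := by
  classical
  let F : ∀ k : ℕ+, (∀ j < k, ℕ+) → ℕ+ := fun k c =>
    ((Finset.Iio k).sup fun n => κ n fun j => if h : j < k then c j h else 1).succPNat
  let c : ℕ+ → ℕ+ := wellFounded_lt.fix F
  have hc : ∀ k, (c k : ℕ) = ((Finset.Iio k).sup fun n => κ n c) + 1 := by
    intro k
    have hfix : c k = F k fun j _ => c j := wellFounded_lt.fix_eq F k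
    rw [hfix]
    refine congrArg Nat.succ (Finset.sup_congr rfl fun n hn => hκ n _ _ fun j hj => ?_)
    exact dif_pos (hj.trans_lt (Finset.mem_Iio.1 hn))
  refine ⟨c, fun i j hij => ?_, fun n k hnk => ?_⟩
  · rw [← PNat.coe_le_coe, hc, hc]
    exact Nat.succ_le_succ (Finset.sup_mono (Finset.Iio_subset_Iio hij))
  · rw [hc]
    exact (Finset.le_sup (f := fun n => κ n c) (Finset.mem_Iio.2 hnk)).trans (Nat.le_succ _)

namespace LocalPresentation

theorem exists_lacunary (p : ℕ) [Fact p.Prime] :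
    ∃ c : ℕ+ → ℕ+, Monotone c ∧ ∃ δ : ℕ → ℕ, Monotone δ ∧ ∀ n : ℕ,
      ∀ x y z w : (groupA p c).Ext,
        wordLength (groupA p c).gens x ≤ (n + 1) * ((n + 1) * (δ n + 1)) →
        wordLength (groupA p c).gens y ≤ (n + 1) * ((n + 1) * (δ n + 1)) →
        wordLength (groupA p c).gens z ≤ (n + 1) * ((n + 1) * (δ n + 1)) →
        wordLength (groupA p c).gens w ≤ (n + 1) * ((n + 1) * (δ n + 1)) →
          FourPoint (groupA p c).gens (δ n) x y z w := by
  choose δ₀ K hK using fun (c : ℕ+ → ℕ+) (N : ℕ+) => exists_fourPoint_ball (p := p) c N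
  -- Truncation makes all choices at level `N` depend on the first `N` classes only.
  let cut : (ℕ+ → ℕ+) → ℕ+ → ℕ+ → ℕ+ := fun c N k => c (min k N)
  let δ : (ℕ+ → ℕ+) → ℕ+ → ℕ := fun c N => (Finset.Iic N).sup fun m => δ₀ (cut c m) m
  have hcut : ∀ (N : ℕ+) (c c' : ℕ+ → ℕ+), (∀ k ≤ N, c k = c' k) → ∀ m ≤ N, cut c m = cut c' m :=
    fun N c c' h m hm => funext fun k => h _ ((min_le_right _ _).trans hm)
  obtain ⟨c, hc, hcκ⟩ := exists_monotone_forall_le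
    (fun N c => K (cut c N) N (N * (N * (δ c N + 1)))) fun N c c' h => by
      have hδ : δ c N = δ c' N :=
        Finset.sup_congr rfl fun m hm => by rw [hcut N c c' h m (Finset.mem_Iic.1 hm)]
      rw [hcut N c c' h N le_rfl, hδ]
  refine ⟨c, hc, fun n => δ c n.succPNat, fun m n hmn => ?_, fun n x y z w hx hy hz hw => ?_⟩
  · exact Finset.sup_mono (Finset.Iic_subset_Iic.2 (Nat.succ_le_succ hmn))
  · have hfour := hK (cut c n.succPNat) n.succPNat _ c
      (fun k hk => by simp only [cut, min_eq_left hk]) (fun k hk => hcκ _ k hk) x y z w hx hy hz hw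
    have hδ₀ : δ₀ (cut c n.succPNat) n.succPNat ≤ δ c n.succPNat :=
      Finset.le_sup (f := fun m => δ₀ (cut c m) m) (Finset.mem_Iic.2 le_rfl)
    exact hfour.trans (Nat.add_le_add_left hδ₀ _)

end LocalPresentation

/-! ### Geodesics and arcs -/

section Arcs

section TopologicalSpace

variable {X : Type*} [TopologicalSpace X] {f g : ℝ → X} {a b : ℝ}

/-- Any two topological arcs with the same endpoints have the same image. -/
def HasUniqueArcs (X : Type*) [TopologicalSpace X] : Prop :=
  ∀ α β : C(unitInterval, X), Function.Injective α → Function.Injective β →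
    α 0 = β 0 → α 1 = β 1 → Set.range α = Set.range β

theorem HasUniqueArcs.of_injective {Y : Type*} [TopologicalSpace Y]
    (hY : HasUniqueArcs Y) (f : C(X, Y)) (hf : Function.Injective f) : HasUniqueArcs X := by
  intro α β hα hβ h0 h1
  have h := hY (f.comp α) (f.comp β) (hf.comp hα) (hf.comp hβ) (congrArg f h0) (congrArg f h1)
  rw [ContinuousMap.coe_comp, ContinuousMap.coe_comp, Set.range_comp, Set.range_comp] at h
  exact hf.image_injective h

theorem exists_arc_range_eq_image_Icc (ha : 0 < a) (hf : ContinuousOn f (Set.Icc 0 a))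
    (hfi : Set.InjOn f (Set.Icc 0 a)) :
    ∃ α : C(unitInterval, X), Function.Injective α ∧ α 0 = f 0 ∧ α 1 = f a ∧
      Set.range α = f '' Set.Icc 0 a := by
  have hmem : ∀ u : unitInterval, (u : ℝ) * a ∈ Set.Icc 0 a := fun u =>
    ⟨mul_nonneg u.2.1 ha.le, mul_le_of_le_one_left ha.le u.2.2⟩
  refine ⟨⟨fun u => f (u * a), hf.comp_continuous (by fun_prop) hmem⟩, fun u v huv => ?_,
    by simp, by simp, Set.Subset.antisymm ?_ ?_⟩
  · exact Subtype.ext (mul_right_cancel₀ ha.ne' (hfi (hmem u) (hmem v) huv))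
  · rintro _ ⟨u, rfl⟩
    exact ⟨_, hmem u, rfl⟩
  · rintro _ ⟨s, hs, rfl⟩
    exact ⟨⟨s / a, div_nonneg hs.1 ha.le, (div_le_one ha).2 hs.2⟩,
      by simp [div_mul_cancel₀ _ ha.ne']⟩

theorem HasUniqueArcs.image_Icc_eq (hX : HasUniqueArcs X) (ha : 0 < a) (hb : 0 < b)
    (hf : ContinuousOn f (Set.Icc 0 a)) (hg : ContinuousOn g (Set.Icc 0 b))
    (hfi : Set.InjOn f (Set.Icc 0 a)) (hgi : Set.InjOn g (Set.Icc 0 b)) (h0 : f 0 = g 0)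
    (h1 : f a = g b) : f '' Set.Icc 0 a = g '' Set.Icc 0 b := by
  obtain ⟨α, hα, hα0, hα1, hαr⟩ := exists_arc_range_eq_image_Icc ha hf hfi
  obtain ⟨β, hβ, hβ0, hβ1, hβr⟩ := exists_arc_range_eq_image_Icc hb hg hgi
  rw [← hαr, ← hβr]
  exact hX α β hα hβ (by rw [hα0, hβ0, h0]) (by rw [hα1, hβ1, h1])

theorem exists_injOn_concat (ha : 0 ≤ a) (hb : 0 ≤ b) (hf : ContinuousOn f (Set.Icc 0 a))
    (hg : ContinuousOn g (Set.Icc 0 b)) (hfi : Set.InjOn f (Set.Icc 0 a))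
    (hgi : Set.InjOn g (Set.Icc 0 b)) (hfg : f a = g 0)
    (hmeet : ∀ s ∈ Set.Icc 0 a, ∀ t ∈ Set.Icc 0 b, f s = g t → s = a ∧ t = 0) :
    ∃ h : ℝ → X, ContinuousOn h (Set.Icc 0 (a + b)) ∧ Set.InjOn h (Set.Icc 0 (a + b)) ∧
      h 0 = f 0 ∧ h a = f a ∧ h (a + b) = g b := by
  let h : ℝ → X := fun s => if s ≤ a then f s else g (s - a)
  have hl : ∀ s ≤ a, h s = f s := fun s hs => if_pos hs
  have hr : ∀ s, a ≤ s → h s = g (s - a) := by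
    intro s hs
    rcases hs.eq_or_lt with rfl | hs
    · rw [hl a le_rfl, sub_self, hfg]
    · exact if_neg (not_le.2 hs)
  have hmem : ∀ s, a ≤ s → s ≤ a + b → s - a ∈ Set.Icc 0 b := fun s hs hs' =>
    ⟨sub_nonneg.2 hs, by linarith⟩
  have hcross : ∀ s ∈ Set.Icc 0 a, ∀ t, a ≤ t → t ≤ a + b → h s = h t → s = t := by
    intro s hs t ht ht' hst
    rw [hl s hs.2, hr t ht] at hst
    obtain ⟨h1, h2⟩ := hmeet s hs _ (hmem t ht ht') hst
    linarith
  refine ⟨h, ?_, fun s hs t ht hst => ?_, hl 0 ha, hl a le_rfl,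
    by rw [hr _ (le_add_of_nonneg_right hb), add_sub_cancel_left]⟩
  · rw [← Set.Icc_union_Icc_eq_Icc ha (le_add_of_nonneg_right hb)]
    refine (hf.congr fun s hs => hl s hs.2).union_of_isClosed ?_ isClosed_Icc isClosed_Icc
    exact (hg.comp (f := fun s => s - a) (by fun_prop) fun s hs => hmem s hs.1 hs.2).congr
      fun s hs => hr s hs.1
  · rcases le_total s a with hsa | hsa <;> rcases le_total t a with hta | hta
    · rw [hl s hsa, hl t hta] at hst
      exact hfi ⟨hs.1, hsa⟩ ⟨ht.1, hta⟩ hst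
    · exact hcross s ⟨hs.1, hsa⟩ t hta ht.2 hst
    · exact (hcross t ⟨ht.1, hta⟩ s hsa hs.2 hst.symm).symm
    · rw [hr s hsa, hr t hta] at hst
      exact sub_left_inj.1 (hgi (hmem s hsa hs.2) (hmem t hta ht.2) hst)

end TopologicalSpace

variable {X : Type*} [MetricSpace X]

/-- The four-point condition with constant zero. -/
def IsZeroHyperbolic (X : Type*) [MetricSpace X] : Prop :=
  ∀ x y z w : X, dist x y + dist z w ≤ max (dist x z + dist y w) (dist x w + dist y z)

namespace IsZeroHyperbolic

/-- A connected set that contains two points contains all the points between them: away from `z`,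
the relation `dist u v < dist u z + dist v z` is an equivalence relation with open classes. -/
theorem exists_mem_eq {T : Type*} [TopologicalSpace T] (hX : IsZeroHyperbolic X)
    (α : C(T, X)) {C : Set T} (hC : IsPreconnected C) {s t : T} (hs : s ∈ C) (ht : t ∈ C) {z : X}
    (hz : dist (α s) z + dist z (α t) = dist (α s) (α t)) : ∃ r ∈ C, α r = z := by
  by_contra! hne
  let U : Set T := {u | dist (α u) (α s) < dist (α u) z + dist (α s) z}
  let V : Set T := ⋃ v ∈ Uᶜ, {u | dist (α u) (α v) < dist (α u) z + dist (α v) z}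
  have hU : IsOpen U := isOpen_lt (by fun_prop) (by fun_prop)
  have hV : IsOpen V := isOpen_biUnion fun v _ => isOpen_lt (by fun_prop) (by fun_prop)
  have hself : ∀ u ∈ C, dist (α u) (α u) < dist (α u) z + dist (α u) z := by
    intro u hu
    have := dist_pos.2 (hne u hu)
    rw [dist_self]
    linarith
  have hcov : ∀ u ∈ C, u ∉ U → u ∈ V := fun u hu hu' =>
    Set.mem_biUnion (x := u) hu' (hself u hu)
  have htU : t ∉ U := fun h => by
    have h' : dist (α t) (α s) < dist (α t) z + dist (α s) z := h
    rw [dist_comm (α t) (α s), dist_comm (α t) z] at h'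
    linarith
  obtain ⟨u, -, huU, huV⟩ := hC U V hU hV
    (fun u hu => or_iff_not_imp_left.2 (hcov u hu)) ⟨s, hs, hself s hs⟩ ⟨t, ht, hcov t ht htU⟩
  obtain ⟨v, hv, huv⟩ := Set.mem_iUnion₂.1 huV
  refine hv ?_
  have hus : dist (α u) (α s) < dist (α u) z + dist (α s) z := huU
  have huv : dist (α u) (α v) < dist (α u) z + dist (α v) z := huv
  change dist (α v) (α s) < dist (α v) z + dist (α s) z
  have hfour := hX (α v) (α s) (α u) z
  rw [dist_comm (α v) (α u), dist_comm (α s) (α u)] at hfour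
  rcases le_max_iff.1 hfour with h | h <;> linarith

theorem exists_median (hX : IsZeroHyperbolic X) (hgeo : IsGeodesicSpace X) (x y p : X) :
    ∃ m, dist x m + dist m y = dist x y ∧ dist x m + dist m p = dist x p ∧
      dist p m + dist m y = dist p y := by
  obtain ⟨γ, hγ0, hγ1, hγ⟩ := hgeo x y
  have hxy := dist_triangle x p y
  have hpy := dist_triangle p x y
  have hxp := dist_triangle x y p
  rw [dist_comm p x] at hpy
  rw [dist_comm y p] at hxp
  set D := dist x y with hD
  have hD0 : 0 ≤ D := dist_nonneg
  obtain ⟨g, hg⟩ : ∃ g, g = (D + dist x p - dist p y) / 2 := ⟨_, rfl⟩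
  have hgm : g ∈ Set.Icc 0 D := ⟨by linarith, by linarith⟩
  have hx : dist x (γ g) = g := by
    have h := hγ 0 ⟨le_rfl, hD0⟩ g hgm
    rwa [hγ0, zero_sub, abs_neg, abs_of_nonneg hgm.1] at h
  have hy : dist (γ g) y = D - g := by
    have h := hγ g hgm D ⟨hD0, le_rfl⟩
    rwa [hγ1, abs_sub_comm, abs_of_nonneg (sub_nonneg.2 hgm.2)] at h
  have hp : dist (γ g) p ≤ dist x p - g := by
    have h := hX (γ g) p x y
    rw [dist_comm (γ g) x, hx, hy, dist_comm p x, ← hD] at h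
    rcases le_max_iff.1 h with h | h <;> linarith
  have hxgp := dist_triangle x (γ g) p
  have hpgy := dist_triangle p (γ g) y
  rw [dist_comm p (γ g)] at hpgy
  exact ⟨γ g, by linarith, by linarith, by rw [dist_comm p]; linarith⟩

theorem range_arc (hX : IsZeroHyperbolic X) (hgeo : IsGeodesicSpace X)
    (α : C(unitInterval, X)) (hα : Function.Injective α) :
    Set.range α = {z | dist (α 0) z + dist z (α 1) = dist (α 0) (α 1)} := by
  refine Set.Subset.antisymm ?_ fun p hp => ?_
  · -- The arc passes through the median of `α 0`, `α 1` and `α s` both before and after time `s`.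
    rintro _ ⟨s, rfl⟩
    obtain ⟨m, hm, hm0, hm1⟩ := hX.exists_median hgeo (α 0) (α 1) (α s)
    obtain ⟨r, hr, rfl⟩ := hX.exists_mem_eq α (isPreconnected_Icc (a := 0) (b := s))
      ⟨le_rfl, s.2.1⟩ ⟨s.2.1, le_rfl⟩ hm0
    obtain ⟨r', hr', hrr⟩ := hX.exists_mem_eq α (isPreconnected_Icc (a := s) (b := 1))
      ⟨le_rfl, s.2.2⟩ ⟨s.2.2, le_rfl⟩ hm1
    obtain rfl : r' = r := hα hrr
    obtain rfl : r' = s := le_antisymm hr.2 hr'.1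
    exact hm
  · obtain ⟨r, -, hr⟩ := hX.exists_mem_eq α isPreconnected_univ (Set.mem_univ 0) (Set.mem_univ 1) hp
    exact ⟨r, hr⟩

theorem isRealTree (hX : IsZeroHyperbolic X) (hgeo : IsGeodesicSpace X) : IsRealTree X := by
  refine ⟨hgeo, fun α β hα hβ h0 h1 => ?_⟩
  rw [hX.range_arc hgeo α hα, hX.range_arc hgeo β hβ, h0, h1]

end IsZeroHyperbolic

theorem IsRealTree.of_injective {Y : Type*} [MetricSpace Y] (hY : IsRealTree Y)
    (hX : IsGeodesicSpace X) (f : C(X, Y)) (hf : Function.Injective f) : IsRealTree X :=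
  ⟨hX, HasUniqueArcs.of_injective hY.2 f hf⟩

theorem IsGeodesicSpace.exists_midpoint (hX : IsGeodesicSpace X) (x y : X) :
    ∃ m, dist x m = dist x y / 2 ∧ dist m y = dist x y / 2 := by
  obtain ⟨γ, hγ0, hγ1, hγ⟩ := hX x y
  have hD : 0 ≤ dist x y := dist_nonneg
  have hmid : dist x y / 2 ∈ Set.Icc 0 (dist x y) := ⟨div_nonneg hD zero_le_two, half_le_self hD⟩
  have h0 := hγ 0 (Set.left_mem_Icc.2 hD) _ hmid
  have h1 := hγ _ hmid _ (Set.right_mem_Icc.2 hD)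
  rw [hγ0, zero_sub, abs_neg, abs_of_nonneg hmid.1] at h0
  rw [hγ1, half_sub, abs_neg, abs_of_nonneg hmid.1] at h1
  exact ⟨_, h0, h1⟩

/-- `γ` is an isometric embedding of the interval `[0, D]`. -/
def IsGeodesicOn (γ : ℝ → X) (D : ℝ) : Prop :=
  ∀ s ∈ Set.Icc 0 D, ∀ t ∈ Set.Icc 0 D, dist (γ s) (γ t) = |s - t|

namespace IsGeodesicOn

variable {γ : ℝ → X} {D : ℝ}

theorem continuousOn (h : IsGeodesicOn γ D) : ContinuousOn γ (Set.Icc 0 D) :=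
  (LipschitzOnWith.of_dist_le_mul (K := 1) fun s hs t ht => by
    rw [h s hs t ht, NNReal.coe_one, one_mul, Real.dist_eq]).continuousOn

theorem injOn (h : IsGeodesicOn γ D) : Set.InjOn γ (Set.Icc 0 D) := by
  intro s hs t ht hst
  have := h s hs t ht
  rw [hst, dist_self] at this
  exact sub_eq_zero.1 (abs_eq_zero.1 this.symm)

theorem dist_of_le (h : IsGeodesicOn γ D) {s t : ℝ} (hs : 0 ≤ s) (hst : s ≤ t) (ht : t ≤ D) :
    dist (γ s) (γ t) = t - s := by
  rw [h s ⟨hs, hst.trans ht⟩ t ⟨hs.trans hst, ht⟩, abs_sub_comm, abs_of_nonneg (sub_nonneg.2 hst)]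

theorem shift (h : IsGeodesicOn γ D) {r : ℝ} (hr : 0 ≤ r) :
    IsGeodesicOn (fun s => γ (r + s)) (D - r) := by
  intro s hs t ht
  rw [h _ ⟨add_nonneg hr hs.1, by linarith [hs.2]⟩ _ ⟨add_nonneg hr ht.1, by linarith [ht.2]⟩,
    add_sub_add_left_eq_sub]

theorem reverse (h : IsGeodesicOn γ D) : IsGeodesicOn (fun s => γ (D - s)) D := by
  intro s hs t ht
  rw [h (D - s) ⟨sub_nonneg.2 hs.2, sub_le_self _ hs.1⟩ (D - t)
    ⟨sub_nonneg.2 ht.2, sub_le_self _ ht.1⟩, abs_sub_comm, sub_sub_sub_cancel_left, abs_sub_comm,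
    abs_sub_comm]

end IsGeodesicOn

namespace IsRealTree

variable {γ : ℝ → X} {D : ℝ}

theorem dist_add_dist_of_injOn (hX : IsRealTree X) {f : ℝ → X} {a s : ℝ}
    (hf : ContinuousOn f (Set.Icc 0 a)) (hfi : Set.InjOn f (Set.Icc 0 a)) (hs : s ∈ Set.Icc 0 a) :
    dist (f 0) (f s) + dist (f s) (f a) = dist (f 0) (f a) := by
  rcases (hs.1.trans hs.2).eq_or_lt with rfl | ha
  · obtain rfl : s = 0 := le_antisymm hs.2 hs.1
    rw [dist_self, add_zero]
  have hne : f 0 ≠ f a := fun h =>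
    ha.ne (hfi (Set.left_mem_Icc.2 ha.le) (Set.right_mem_Icc.2 ha.le) h)
  obtain ⟨ζ, hζ0, hζ1, hζ⟩ := hX.1 (f 0) (f a)
  have hζ : IsGeodesicOn ζ (dist (f 0) (f a)) := hζ
  have himg := HasUniqueArcs.image_Icc_eq hX.2 ha (dist_pos.2 hne) hf hζ.continuousOn hfi hζ.injOn
    hζ0.symm hζ1.symm
  obtain ⟨u, hu, hus⟩ := himg ▸ Set.mem_image_of_mem f hs
  have hl := hζ.dist_of_le le_rfl hu.1 hu.2
  have hr := hζ.dist_of_le hu.1 hu.2 le_rfl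
  rw [hζ0, hus] at hl
  rw [hζ1, hus] at hr
  linarith

/-- A geodesic that starts at the point nearest to `z` can be continued to `z`. -/
theorem dist_right_eq (hX : IsRealTree X) (h : IsGeodesicOn γ D) {z : X} {r : ℝ}
    (hr : r ∈ Set.Icc 0 D) (hmin : ∀ s ∈ Set.Icc 0 D, dist z (γ r) ≤ dist z (γ s)) :
    dist z (γ D) = dist z (γ r) + (D - r) := by
  obtain ⟨η, hη0, hη1, hη⟩ := hX.1 z (γ r)
  have hη : IsGeodesicOn η (dist z (γ r)) := hη
  have hshift := h.shift hr.1
  have hmeet : ∀ s ∈ Set.Icc 0 (dist z (γ r)), ∀ t ∈ Set.Icc 0 (D - r),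
      η s = γ (r + t) → s = dist z (γ r) ∧ t = 0 := by
    intro s hs t ht hst
    have hrt : r + t ∈ Set.Icc 0 D := ⟨add_nonneg hr.1 ht.1, by linarith [ht.2]⟩
    have hzs := hη.dist_of_le le_rfl hs.1 hs.2
    rw [hη0, hst, sub_zero] at hzs
    obtain rfl : s = dist z (γ r) := le_antisymm hs.2 (hzs ▸ hmin _ hrt)
    exact ⟨rfl, left_eq_add.1 (h.injOn hr hrt (hη1.symm.trans hst))⟩
  have hrD : 0 ≤ D - r := sub_nonneg.2 hr.2
  obtain ⟨f, hf, hfi, hf0, hfm, hf1⟩ := exists_injOn_concat dist_nonneg hrD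
    hη.continuousOn hshift.continuousOn hη.injOn hshift.injOn (by rw [hη1, add_zero]) hmeet
  have hbetween := hX.dist_add_dist_of_injOn hf hfi ⟨dist_nonneg, le_add_of_nonneg_right hrD⟩
  rw [hf0, hfm, hf1, hη0, hη1, add_sub_cancel, h.dist_of_le hr.1 hr.2 le_rfl] at hbetween
  exact hbetween.symm

theorem exists_tripod (hX : IsRealTree X) (hD : 0 ≤ D) (h : IsGeodesicOn γ D) (z : X) :
    ∃ r ∈ Set.Icc 0 D, dist z (γ 0) = dist z (γ r) + r ∧
      dist z (γ D) = dist z (γ r) + (D - r) := by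
  obtain ⟨r, hr, hmin⟩ := isCompact_Icc.exists_isMinOn (Set.nonempty_Icc.2 hD)
    (((continuous_const (y := z)).dist continuous_id).comp_continuousOn h.continuousOn)
  refine ⟨r, hr, ?_, hX.dist_right_eq h hr fun s hs => hmin hs⟩
  have := hX.dist_right_eq h.reverse (z := z) (r := D - r)
    ⟨sub_nonneg.2 hr.2, sub_le_self _ hr.1⟩ fun s hs => by
      simpa using hmin (show D - s ∈ Set.Icc 0 D from ⟨sub_nonneg.2 hs.2, sub_le_self _ hs.1⟩)
  simpa using this

theorem dist_midpoint_le (hX : IsRealTree X) {x y m : X}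
    (hx : dist x m = dist x y / 2) (hy : dist m y = dist x y / 2) {z : X} {R : ℝ}
    (hzx : dist z x ≤ R) (hzy : dist z y ≤ R) : dist z m ≤ R - dist x y / 2 := by
  obtain ⟨γ, hγ0, hγ1, hγ⟩ := hX.1 x y
  have hγ : IsGeodesicOn γ (dist x y) := hγ
  set D := dist x y
  obtain ⟨q, hq, hq0, hq1⟩ := hX.exists_tripod dist_nonneg hγ m
  obtain ⟨r, hr, hr0, hr1⟩ := hX.exists_tripod dist_nonneg hγ z
  rw [hγ0] at hq0 hr0
  rw [hγ1] at hq1 hr1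
  rw [dist_comm m x] at hq0
  have hmq : m = γ q := dist_le_zero.1 (by linarith)
  have hzm := dist_triangle z (γ r) m
  rw [hmq, hγ r hr q hq, ← hmq] at hzm
  rcases abs_cases (r - q) with ⟨h, -⟩ | ⟨h, -⟩ <;> rw [h] at hzm <;> linarith

theorem dist_midpoints_le (hX : IsRealTree X) {x y m x' y' m' : X}
    (hx : dist x m = dist x y / 2) (hy : dist m y = dist x y / 2)
    (hx' : dist x' m' = dist x' y' / 2) (hy' : dist m' y' = dist x' y' / 2) {R : ℝ}
    (hxx : dist x x' ≤ R) (hxy : dist x y' ≤ R) (hyx : dist y x' ≤ R) (hyy : dist y y' ≤ R) :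
    dist m' m ≤ R - dist x' y' / 2 - dist x y / 2 :=
  hX.dist_midpoint_le hx hy
    (by rw [dist_comm]; exact hX.dist_midpoint_le hx' hy' hxx hxy)
    (by rw [dist_comm]; exact hX.dist_midpoint_le hx' hy' hyx hyy)

end IsRealTree

end Arcs

/-! ### Asymptotic cones of geodesic and of hyperbolic spaces -/

theorem IsNonprincipal.le_atTop {ω : Ultrafilter ℕ} (h : IsNonprincipal ω) :
    (ω : Filter ℕ) ≤ atTop := by
  rw [← Nat.cofinite_eq_atTop]
  intro s hs
  by_contra hs'
  exact h sᶜ hs (Ultrafilter.compl_mem_iff_notMem.2 hs')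

theorem ScalingSequence.tendsto_atTop (d : ScalingSequence) : Tendsto d atTop atTop :=
  tendsto_atTop_atTop_of_monotone' d.mono d.unbounded

theorem tendsto_min_natFloor_mul_div {ι : Type*} {l : Filter ι} {d : ι → ℝ}
    (hd : Tendsto d l atTop) (hpos : ∀ n, 0 ≤ d n) {k : ι → ℕ} {D : ℝ}
    (hk : Tendsto (fun n => k n / d n) l (𝓝 D)) {s : ℝ} (hs : s ∈ Set.Icc 0 D) :
    Tendsto (fun n => ((min ⌊s * d n⌋₊ (k n) : ℕ) : ℝ) / d n) l (𝓝 s) := by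
  have hmin := ((tendsto_nat_floor_mul_div_atTop hs.1).comp hd).min hk
  rw [min_eq_left hs.2] at hmin
  refine hmin.congr fun n => ?_
  rw [Nat.cast_min]
  exact min_div_div_right (hpos n) _ _

/-- `q 0, …, q k` is a discrete geodesic: an isometric image of `{0, …, k}`. -/
def IsDiscreteGeodesic {X : Type*} [MetricSpace X] (q : ℕ → X) (k : ℕ) : Prop :=
  ∀ i ≤ k, ∀ j ≤ k, dist (q i) (q j) = |(i : ℝ) - j|

/-- Any two points are joined by a discrete geodesic. -/
def HasDiscreteGeodesics (X : Type*) [MetricSpace X] : Prop :=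
  ∀ x y : X, ∃ (k : ℕ) (q : ℕ → X), IsDiscreteGeodesic q k ∧ q 0 = x ∧ q k = y

section Cone

variable {X : Type*} [MetricSpace X] {ω : Ultrafilter ℕ} {e : ℕ → X} {d : ScalingSequence}

namespace ConeSeq

theorem tendsto_dist (f g : ConeSeq ω X e d) :
    Tendsto (fun n => dist (f n) (g n) / d n) ω (𝓝 (dist f g)) := f.tendsto g

theorem dist_le {f g : ConeSeq ω X e d} {C : ℝ}
    (h : ∀ n, dist (f n) (g n) ≤ C * d n) : dist f g ≤ C :=
  le_of_tendsto' (f.tendsto_dist g) fun n => (div_le_iff₀ (d.pos n)).2 (h n)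

theorem le_dist {f g : ConeSeq ω X e d} {C : ℝ}
    (h : ∀ n, C * d n ≤ dist (f n) (g n)) : C ≤ dist f g :=
  ge_of_tendsto' (f.tendsto_dist g) fun n => (le_div_iff₀ (d.pos n)).2 (h n)

theorem exists_dist_le (f : ConeSeq ω X e d) : ∃ C, ∀ n, dist (f n) (e n) ≤ C * d n :=
  f.bounded.imp fun _ hC n => (div_le_iff₀ (d.pos n)).1 (hC n)

/-- A sequence of points at distance at most `C * d n` from the points of `f` is a point of the
cone. -/
def ofDistLe (f : ConeSeq ω X e d) (g : ℕ → X) (C : ℝ) (h : ∀ n, dist (g n) (f n) ≤ C * d n) :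
    ConeSeq ω X e d where
  toFun := g
  bounded := by
    obtain ⟨B, hB⟩ := f.exists_dist_le
    refine ⟨C + B, fun n => (div_le_iff₀ (d.pos n)).2 ?_⟩
    have := dist_triangle (g n) (f n) (e n)
    linarith [h n, hB n]

theorem dist_eq_abs_sub {q : ℕ → ℕ → X} {k i j : ℕ → ℕ} (hq : ∀ n, IsDiscreteGeodesic (q n) (k n))
    (hi : ∀ n, i n ≤ k n) (hj : ∀ n, j n ≤ k n) {s t : ℝ}
    (hs : Tendsto (fun n => i n / d n) ω (𝓝 s)) (ht : Tendsto (fun n => j n / d n) ω (𝓝 t))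
    {f g : ConeSeq ω X e d} (hf : ∀ n, f n = q n (i n)) (hg : ∀ n, g n = q n (j n)) :
    dist f g = |s - t| := by
  refine tendsto_nhds_unique (f.tendsto_dist g) ((hs.sub ht).abs.congr fun n => ?_)
  rw [hf, hg, hq n _ (hi n) _ (hj n), ← sub_div, abs_div, abs_of_pos (d.pos n)]

end ConeSeq

theorem HasDiscreteGeodesics.isGeodesicSpace_asymptoticCone (hX : HasDiscreteGeodesics X)
    (hω : IsNonprincipal ω) : IsGeodesicSpace (AsymptoticCone ω X e d) := by
  intro x y
  obtain ⟨f, rfl⟩ := SeparationQuotient.surjective_mk x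
  obtain ⟨g, rfl⟩ := SeparationQuotient.surjective_mk y
  choose k q hq hq0 hqk using fun n => hX (f n) (g n)
  have hd : Tendsto d ω atTop := d.tendsto_atTop.mono_left hω.le_atTop
  have hk : Tendsto (fun n => k n / d n) ω (𝓝 (dist f g)) := by
    refine (f.tendsto_dist g).congr fun n => ?_
    rw [← hq0, ← hqk, hq n 0 (Nat.zero_le _) _ le_rfl, Nat.cast_zero, zero_sub, abs_neg,
      Nat.abs_cast]
  let τ : ℝ → ℕ → ℕ := fun s n => min ⌊s * d n⌋₊ (k n)
  have hτk : ∀ s n, τ s n ≤ k n := fun s n => min_le_right _ _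
  have hτ : ∀ s ∈ Set.Icc 0 (dist f g), Tendsto (fun n => τ s n / d n) ω (𝓝 s) := fun s hs =>
    tendsto_min_natFloor_mul_div hd (fun n => (d.pos n).le) hk hs
  let γ : ℝ → ConeSeq ω X e d := fun s => f.ofDistLe (fun n => q n (τ s n)) |s| fun n => by
    rw [← hq0, hq n _ (hτk s n) _ (Nat.zero_le _), Nat.cast_zero, sub_zero, Nat.abs_cast]
    calc (τ s n : ℝ) ≤ ⌊|s| * d n⌋₊ := Nat.cast_le.2 ((min_le_left _ _).trans
          (Nat.floor_mono (mul_le_mul_of_nonneg_right (le_abs_self s) (d.pos n).le)))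
      _ ≤ |s| * d n := Nat.floor_le (mul_nonneg (abs_nonneg s) (d.pos n).le)
  have h0 : dist (γ 0) f = |0 - 0| := ConeSeq.dist_eq_abs_sub (j := 0) hq (hτk _)
    (fun n => Nat.zero_le _) (hτ 0 ⟨le_rfl, dist_nonneg⟩) (by simp) (fun n => rfl)
    fun n => (hq0 n).symm
  have h1 : dist (γ (dist f g)) g = |dist f g - dist f g| := ConeSeq.dist_eq_abs_sub hq (hτk _)
    (fun n => le_rfl) (hτ _ ⟨dist_nonneg, le_rfl⟩) hk (fun n => rfl) fun n => (hqk n).symm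
  refine ⟨fun s => SeparationQuotient.mk (γ s), ?_, ?_, fun s hs t ht => ?_⟩
  · rw [← dist_eq_zero, SeparationQuotient.dist_mk, h0, sub_self, abs_zero]
  · rw [← dist_eq_zero, SeparationQuotient.dist_mk, SeparationQuotient.dist_mk, h1, sub_self,
      abs_zero]
  · rw [SeparationQuotient.dist_mk] at hs ht ⊢
    exact ConeSeq.dist_eq_abs_sub hq (hτk s) (hτk t) (hτ s hs) (hτ t ht) (fun n => rfl) fun n => rfl

theorem isZeroHyperbolic_asymptoticCone {δ : ℕ → ℝ}
    (hδ : Tendsto (fun n => δ n / d n) ω (𝓝 0))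
    (h : ∀ C : ℝ, ∀ᶠ n in (ω : Filter ℕ), ∀ x y z w : X, dist x (e n) ≤ C * d n →
      dist y (e n) ≤ C * d n → dist z (e n) ≤ C * d n → dist w (e n) ≤ C * d n →
      dist x y + dist z w ≤ max (dist x z + dist y w) (dist x w + dist y z) + δ n) :
    IsZeroHyperbolic (AsymptoticCone ω X e d) := by
  intro x y z w
  obtain ⟨x, rfl⟩ := SeparationQuotient.surjective_mk x
  obtain ⟨y, rfl⟩ := SeparationQuotient.surjective_mk y
  obtain ⟨z, rfl⟩ := SeparationQuotient.surjective_mk z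
  obtain ⟨w, rfl⟩ := SeparationQuotient.surjective_mk w
  simp only [SeparationQuotient.dist_mk]
  have hbound : ∀ f : ConeSeq ω X e d, ∃ C, ∀ D, C ≤ D → ∀ n, dist (f n) (e n) ≤ D * d n :=
    fun f => f.exists_dist_le.imp fun C hC D hCD n =>
      (hC n).trans (mul_le_mul_of_nonneg_right hCD (d.pos n).le)
  obtain ⟨C₁, h₁⟩ := hbound x
  obtain ⟨C₂, h₂⟩ := hbound y
  obtain ⟨C₃, h₃⟩ := hbound z
  obtain ⟨C₄, h₄⟩ := hbound w
  have hlim := (((x.tendsto_dist z).add (y.tendsto_dist w)).max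
    ((x.tendsto_dist w).add (y.tendsto_dist z))).add hδ
  rw [add_zero] at hlim
  refine le_of_tendsto_of_tendsto ((x.tendsto_dist y).add (z.tendsto_dist w)) hlim ?_
  filter_upwards [h (max (max C₁ C₂) (max C₃ C₄))] with n hn
  have hfour := hn (x n) (y n) (z n) (w n) (h₁ _ (by simp) n) (h₂ _ (by simp) n) (h₃ _ (by simp) n)
    (h₄ _ (by simp) n)
  rw [← add_div, ← add_div, ← add_div, max_div_div_right (d.pos n).le, ← add_div]
  exact div_le_div_of_nonneg_right hfour (d.pos n).le

section Map

variable {Y : Type*} [MetricSpace Y] {φ : X → Y} {K K' : NNReal}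

/-- The map on sequences that a Lipschitz map induces. -/
def ConeSeq.map (hφ : LipschitzWith K φ) (f : ConeSeq ω X e d) : ConeSeq ω Y (φ ∘ e) d where
  toFun n := φ (f n)
  bounded := by
    obtain ⟨C, hC⟩ := f.exists_dist_le
    refine ⟨K * C, fun n => (div_le_iff₀ (d.pos n)).2 ((hφ.dist_le_mul _ _).trans ?_)⟩
    rw [mul_assoc]
    exact mul_le_mul_of_nonneg_left (hC n) K.2

theorem ConeSeq.lipschitzWith_map (hφ : LipschitzWith K φ) :
    LipschitzWith K (ConeSeq.map (ω := ω) (e := e) (d := d) hφ) :=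
  LipschitzWith.of_dist_le_mul fun f g =>
    le_of_tendsto_of_tendsto' ((f.map hφ).tendsto_dist (g.map hφ))
      ((f.tendsto_dist g).const_mul (K : ℝ)) fun n => by
        rw [← mul_div_assoc]
        exact div_le_div_of_nonneg_right (hφ.dist_le_mul _ _) (d.pos n).le

theorem ConeSeq.antilipschitzWith_map (hφ : LipschitzWith K φ) (hφ' : AntilipschitzWith K' φ) :
    AntilipschitzWith K' (ConeSeq.map (ω := ω) (e := e) (d := d) hφ) :=
  AntilipschitzWith.of_le_mul_dist fun f g =>
    le_of_tendsto_of_tendsto' (f.tendsto_dist g)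
      (((f.map hφ).tendsto_dist (g.map hφ)).const_mul (K' : ℝ)) fun n => by
        rw [← mul_div_assoc]
        exact div_le_div_of_nonneg_right (hφ'.le_mul_dist _ _) (d.pos n).le

theorem exists_injective_asymptoticCone (hφ : LipschitzWith K φ) (hφ' : AntilipschitzWith K' φ) :
    ∃ ψ : C(AsymptoticCone ω X e d, AsymptoticCone ω Y (φ ∘ e) d), Function.Injective ψ := by
  have hcont : Continuous fun f : ConeSeq ω X e d => SeparationQuotient.mk (f.map hφ) :=
    SeparationQuotient.continuous_mk.comp (ConeSeq.lipschitzWith_map hφ).continuous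
  refine ⟨⟨SeparationQuotient.lift _ fun f g hfg => (hfg.map hcont).eq,
    SeparationQuotient.continuous_lift hcont⟩, fun x y hxy => ?_⟩
  obtain ⟨f, rfl⟩ := SeparationQuotient.surjective_mk x
  obtain ⟨g, rfl⟩ := SeparationQuotient.surjective_mk y
  have hmap : dist (f.map hφ) (g.map hφ) = 0 := by
    rw [← SeparationQuotient.dist_mk, dist_eq_zero]
    exact hxy
  have hle := (ConeSeq.antilipschitzWith_map hφ hφ').le_mul_dist f g
  rw [hmap, mul_zero, ← SeparationQuotient.dist_mk] at hle
  exact dist_le_zero.1 hle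

end Map

end Cone

/-! ### Asymptotic cones of groups -/

theorem IsDiscreteGeodesic.of_dist_le {X : Type*} [MetricSpace X] {q : ℕ → X} {k : ℕ}
    (hq : ∀ i < k, dist (q i) (q (i + 1)) ≤ 1) (hk : (k : ℝ) ≤ dist (q 0) (q k)) :
    IsDiscreteGeodesic q k := by
  have hle : ∀ {i j}, i ≤ j → j ≤ k → dist (q i) (q j) ≤ (j : ℝ) - i := by
    intro i j hij hjk
    have h := dist_le_Ico_sum_of_dist_le (f := q) (d := fun _ => 1) hij
      fun _ hl => hq _ (hl.trans_le hjk)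
    rwa [Finset.sum_const, Nat.card_Ico, nsmul_one, Nat.cast_sub hij] at h
  have heq : ∀ i j, i ≤ j → j ≤ k → dist (q i) (q j) = |(i : ℝ) - j| := by
    intro i j hij hjk
    have h0i := hle (Nat.zero_le i) (hij.trans hjk)
    have hjk' := hle hjk le_rfl
    have hsum := dist_triangle4 (q 0) (q i) (q j) (q k)
    rw [abs_sub_comm, abs_of_nonneg (sub_nonneg.2 (Nat.cast_le.2 hij))]
    rw [Nat.cast_zero, sub_zero] at h0i
    exact le_antisymm (hle hij hjk) (by linarith)
  intro i hi j hj
  rcases le_total i j with hij | hij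
  · exact heq i j hij hj
  · rw [dist_comm, heq j i hij hi, abs_sub_comm]

section GroupCone

variable {G : Type*} [Group G]

theorem hasDiscreteGeodesics_wordMetricSpace (S : Set G) (hS : Subgroup.closure S = ⊤) :
    HasDiscreteGeodesics (WordMetricSpace S hS) := by
  intro x y
  obtain ⟨x, rfl⟩ : ∃ g : G, WordMetricSpace.of g = x := ⟨x, rfl⟩
  obtain ⟨y, rfl⟩ : ∃ g : G, WordMetricSpace.of g = y := ⟨y, rfl⟩
  obtain ⟨l, hl, hlS, hlp⟩ := isWordOfLength_wordLength hS (x⁻¹ * y)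
  have h0 : x * (l.take 0).prod = x := by rw [List.take_zero, List.prod_nil, mul_one]
  have hk : x * (l.take (wordLength S (x⁻¹ * y))).prod = y := by
    rw [← hl, List.take_length, hlp, mul_inv_cancel_left]
  refine ⟨wordLength S (x⁻¹ * y), fun i => WordMetricSpace.of (x * (l.take i).prod),
    IsDiscreteGeodesic.of_dist_le (fun i hi => ?_) ?_, congrArg _ h0, congrArg _ hk⟩
  · rw [← hl] at hi
    rw [WordMetricSpace.dist_of, List.prod_take_succ l i hi, ← mul_assoc x, inv_mul_cancel_left]
    exact Nat.cast_le_one.2 (wordLength_le ⟨[l[i]], rfl, by simpa using hlS _ (l.getElem_mem hi),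
      List.prod_singleton⟩)
  · rw [h0, hk, WordMetricSpace.dist_of]

theorem isGeodesicSpace_groupAsymptoticCone (S : Set G) (hS : Subgroup.closure S = ⊤)
    {ω : Ultrafilter ℕ} (hω : IsNonprincipal ω) (d : ScalingSequence) :
    IsGeodesicSpace (GroupAsymptoticCone S hS ω d) :=
  (hasDiscreteGeodesics_wordMetricSpace S hS).isGeodesicSpace_asymptoticCone hω

theorem exists_wordLength_le_mul {S S' : Set G} (hS : Subgroup.closure S = ⊤)
    (hS' : Subgroup.closure S' = ⊤) (hfin : S'.Finite) :
    ∃ C : ℕ, ∀ g, wordLength S g ≤ C * wordLength S' g := by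
  obtain ⟨C, hC⟩ := (hfin.image (wordLength S)).bddAbove
  refine ⟨C, fun g => ?_⟩
  obtain ⟨l, hl, hlS, hlp⟩ := isWordOfLength_wordLength hS' g
  rw [← hl, ← hlp]
  clear hl hlp
  induction l with
  | nil => simp [wordLength_one]
  | cons a l ih =>
    rw [List.prod_cons, List.length_cons, mul_add, mul_one, add_comm]
    refine (wordLength_mul_le hS _ _).trans (add_le_add ?_ (ih fun x hx => hlS x (by simp [hx])))
    rcases hlS a (by simp) with h | h
    · exact hC ⟨a, h, rfl⟩
    · rw [← wordLength_inv hS]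
      exact hC ⟨a⁻¹, h, rfl⟩

theorem exists_lipschitzWith_wordMetricSpace {S S' : Set G} (hS : Subgroup.closure S = ⊤)
    (hS' : Subgroup.closure S' = ⊤) (hfin : S'.Finite) :
    ∃ K, LipschitzWith K fun g : WordMetricSpace S' hS' =>
      (WordMetricSpace.of (show G from g) : WordMetricSpace S hS) := by
  obtain ⟨C, hC⟩ := exists_wordLength_le_mul hS hS' hfin
  refine ⟨C, LipschitzWith.of_dist_le_mul fun f g => ?_⟩
  obtain ⟨f, rfl⟩ : ∃ f' : G, WordMetricSpace.of f' = f := ⟨f, rfl⟩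
  obtain ⟨g, rfl⟩ : ∃ g' : G, WordMetricSpace.of g' = g := ⟨g, rfl⟩
  rw [WordMetricSpace.dist_of, WordMetricSpace.dist_of, NNReal.coe_natCast, ← Nat.cast_mul,
    Nat.cast_le]
  exact hC (f⁻¹ * g)

theorem IsRealTree.groupAsymptoticCone {S S' : Set G} {hS : Subgroup.closure S = ⊤}
    {hS' : Subgroup.closure S' = ⊤} (hfin : S.Finite) (hfin' : S'.Finite) {ω : Ultrafilter ℕ}
    (hω : IsNonprincipal ω) {d : ScalingSequence} (h : IsRealTree (GroupAsymptoticCone S hS ω d)) :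
    IsRealTree (GroupAsymptoticCone S' hS' ω d) := by
  obtain ⟨K, hK⟩ := exists_lipschitzWith_wordMetricSpace hS hS' hfin'
  obtain ⟨K', hK'⟩ := exists_lipschitzWith_wordMetricSpace hS' hS hfin
  obtain ⟨ψ, hψ⟩ := exists_injective_asymptoticCone (ω := ω) (d := d)
    (e := fun _ => WordMetricSpace.of 1) hK fun f g => hK' f g
  exact h.of_injective (isGeodesicSpace_groupAsymptoticCone S' hS' hω d) ψ hψ

end GroupCone

/-! ### Cones that are not trees -/

section Translate

variable {X G : Type*} [MetricSpace X] [Group G] [MulAction G X] [IsIsometricSMul G X]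
  {ω : Ultrafilter ℕ} {e : ℕ → X} {d : ScalingSequence} {g : ℕ → G} {C : ℝ}

/-- A sequence of isometries that moves the observation points by at most `C * d n` acts on the
points of the cone. -/
def ConeSeq.translate (hg : ∀ n, dist (g n • e n) (e n) ≤ C * d n) (f : ConeSeq ω X e d) :
    ConeSeq ω X e d where
  toFun n := g n • f n
  bounded := by
    obtain ⟨B, hB⟩ := f.exists_dist_le
    refine ⟨B + C, fun n => (div_le_iff₀ (d.pos n)).2 ?_⟩
    have := dist_triangle (g n • f n) (g n • e n) (e n)
    rw [dist_smul] at this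
    linarith [hg n, hB n]

theorem ConeSeq.dist_translate (hg : ∀ n, dist (g n • e n) (e n) ≤ C * d n)
    (f f' : ConeSeq ω X e d) : dist (f.translate hg) (f'.translate hg) = dist f f' :=
  tendsto_nhds_unique ((f.translate hg).tendsto_dist (f'.translate hg))
    ((f.tendsto_dist f').congr fun n => by
      rw [← dist_smul (g n)]
      rfl)

/-- In a tree, `F n` would nearly fix the midpoint of the observation point and a translate of it
by an element of `F n` at distance `d n`. -/
theorem not_isRealTree_asymptoticCone (F : ℕ → Subgroup G)
    (hF : ∀ n, ∀ f ∈ F n, dist (f • e n) (e n) ≤ d n)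
    (hfar : ∀ n, ∀ x : X, ∃ f ∈ F n, d n ≤ dist (f • x) x) :
    ¬ IsRealTree (AsymptoticCone ω X e d) := by
  intro htree
  let o : ConeSeq ω X e d := ⟨e, 0, fun n => by rw [dist_self, zero_div]⟩
  have hF1 : ∀ f : ℕ → G, (∀ n, f n ∈ F n) → ∀ n, dist (f n • e n) (e n) ≤ 1 * d n :=
    fun f hf n => by rw [one_mul]; exact hF n _ (hf n)
  choose f hfF hf using fun n => hfar n (e n)
  let b : ConeSeq ω X e d := o.translate (hF1 f hfF)
  have hob : dist o b = 1 := by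
    refine le_antisymm (ConeSeq.dist_le fun n => ?_) (ConeSeq.le_dist fun n => ?_) <;>
      rw [dist_comm, one_mul]
    exacts [hF n _ (hfF n), hf n]
  obtain ⟨m, hom, hmb⟩ := htree.1.exists_midpoint (SeparationQuotient.mk o)
    (SeparationQuotient.mk b)
  obtain ⟨m, rfl⟩ := SeparationQuotient.surjective_mk m
  choose g hgF hg using fun n => hfar n (m n)
  have hg1 := hF1 g hgF
  have hmove : 1 ≤ dist (m.translate hg1) m := ConeSeq.le_dist fun n => by
    rw [one_mul]; exact hg n
  have horbit : ∀ {s t : ConeSeq ω X e d} {h k : ℕ → G}, (∀ n, s n = h n • e n) →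
      (∀ n, t n = k n • e n) → (∀ n, h n ∈ F n) → (∀ n, k n ∈ F n) → dist s t ≤ 1 := by
    intro s t h k hs ht hh hk
    refine ConeSeq.dist_le fun n => ?_
    rw [hs, ht, one_mul, ← dist_smul (k n)⁻¹, inv_smul_smul, smul_smul]
    exact hF n _ (mul_mem (inv_mem (hk n)) (hh n))
  have ho : ∀ n, o n = (1 : G) • e n := fun n => (one_smul G _).symm
  have hgb : ∀ n, b.translate hg1 n = (g n * f n) • e n := fun n => smul_smul _ _ _
  have h1F : ∀ n, (1 : G) ∈ F n := fun n => one_mem _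
  have hgfF : ∀ n, g n * f n ∈ F n := fun n => mul_mem (hgF n) (hfF n)
  simp only [SeparationQuotient.dist_mk] at hom hmb
  have := htree.dist_midpoints_le (x := .mk o) (y := .mk b) (m := .mk m)
    (x' := .mk (o.translate hg1)) (y' := .mk (b.translate hg1)) (m' := .mk (m.translate hg1))
    (R := 1) hom hmb (by simpa only [SeparationQuotient.dist_mk, ConeSeq.dist_translate] using hom)
    (by simpa only [SeparationQuotient.dist_mk, ConeSeq.dist_translate] using hmb)
    (horbit ho (fun n => rfl) h1F hgF) (horbit ho hgb h1F hgfF)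
    (horbit (fun n => rfl) (fun n => rfl) hfF hgF) (horbit (fun n => rfl) hgb hfF hgfF)
  simp only [SeparationQuotient.dist_mk, ConeSeq.dist_translate, hob] at this
  linarith

end Translate

section ConjugationRadius

variable {G : Type*} [Group G] {S : Set G} {F F' : Subgroup G}

/-- The smallest `R` such that some conjugate of `F` lies in the ball of radius `R` (and `0` if
there is no such `R`). -/
noncomputable def conjugationRadius (S : Set G) (F : Subgroup G) : ℕ :=
  sInf {R | ∃ x : G, ∀ f ∈ F, wordLength S (x⁻¹ * f * x) ≤ R}

theorem exists_wordLength_conj_le (S : Set G) (F : Subgroup G) [Finite F] :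
    ∃ x : G, ∀ f ∈ F, wordLength S (x⁻¹ * f * x) ≤ conjugationRadius S F := by
  obtain ⟨B, hB⟩ := ((Set.toFinite (F : Set G)).image (wordLength S)).bddAbove
  exact Nat.sInf_mem (s := {R | ∃ x : G, ∀ f ∈ F, wordLength S (x⁻¹ * f * x) ≤ R})
    ⟨B, 1, fun f hf => by simpa using hB ⟨f, hf, rfl⟩⟩

theorem conjugationRadius_mono [Finite F'] (h : F ≤ F') :
    conjugationRadius S F ≤ conjugationRadius S F' := by
  obtain ⟨x, hx⟩ := exists_wordLength_conj_le S F'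
  exact Nat.sInf_le ⟨x, fun f hf => hx f (h hf)⟩

theorem exists_le_wordLength_conj (S : Set G) (F : Subgroup G) (x : G) :
    ∃ f ∈ F, conjugationRadius S F ≤ wordLength S (x⁻¹ * f * x) := by
  rcases Nat.eq_zero_or_pos (conjugationRadius S F) with h | h
  · exact ⟨1, F.one_mem, by rw [h]; exact Nat.zero_le _⟩
  by_contra! hlt
  have : conjugationRadius S F ≤ conjugationRadius S F - 1 :=
    Nat.sInf_le ⟨x, fun f hf => Nat.le_sub_one_of_lt (hlt f hf)⟩
  omega

theorem conjugationRadius_pos (hS : Subgroup.closure S = ⊤) [Finite F] (hF : F ≠ ⊥) :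
    0 < conjugationRadius S F := by
  rw [Nat.pos_iff_ne_zero]
  intro h
  obtain ⟨x, hx⟩ := exists_wordLength_conj_le S F
  refine hF ((Subgroup.eq_bot_iff_forall F).2 fun f hf => ?_)
  have hconj := eq_one_of_wordLength_eq_zero hS (Nat.le_zero.1 (h ▸ hx f hf))
  have hfx : f * x = x := by rwa [mul_assoc, inv_mul_eq_one, eq_comm] at hconj
  exact mul_eq_right.1 hfx

theorem card_le_of_conjugationRadius_le (hS : Subgroup.closure S = ⊤) (hfin : S.Finite) [Finite F]
    {R : ℕ} (h : conjugationRadius S F ≤ R) :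
    Nat.card F ≤ Nat.card {g : G | wordLength S g ≤ R} := by
  have := (finite_ball hS hfin R).to_subtype
  obtain ⟨x, hx⟩ := exists_wordLength_conj_le S F
  refine Nat.card_le_card_of_injective
    (fun f : F => (⟨x⁻¹ * f * x, (hx f f.2).trans h⟩ : {g : G | wordLength S g ≤ R}))
    fun f g hfg => ?_
  have := congrArg Subtype.val hfg
  exact Subtype.ext (mul_left_cancel (mul_right_cancel this))

theorem not_bddAbove_conjugationRadius (hS : Subgroup.closure S = ⊤) (hfin : S.Finite)
    {ι : Type*} (F : ι → Subgroup G) [∀ i, Finite (F i)] (hcard : ∀ k, ∃ i, k < Nat.card (F i)) :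
    ¬ BddAbove (Set.range fun i => (conjugationRadius S (F i) : ℝ)) := by
  rintro ⟨B, hB⟩
  obtain ⟨R, hR⟩ := exists_nat_ge B
  obtain ⟨i, hi⟩ := hcard (Nat.card {g : G | wordLength S g ≤ R})
  refine hi.not_ge (card_le_of_conjugationRadius_le hS hfin ?_)
  exact Nat.cast_le.1 ((hB ⟨i, rfl⟩).trans hR)

end ConjugationRadius

section LeftTranslation

variable {G : Type*} [Group G] {S : Set G} {hS : Subgroup.closure S = ⊤}

/-- The action of a group on itself by left multiplication, which preserves word metrics. -/
instance : MulAction G (WordMetricSpace S hS) := inferInstanceAs (MulAction G G)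

theorem WordMetricSpace.dist_smul_of (f g : G) :
    dist (f • (of g : WordMetricSpace S hS)) (of g) = wordLength S (g⁻¹ * f * g) := by
  rw [dist_comm, mul_assoc]
  exact dist_of g (f * g)

instance : IsIsometricSMul G (WordMetricSpace S hS) :=
  ⟨fun f => Isometry.of_dist_eq fun g h => by
    obtain ⟨g, rfl⟩ : ∃ g' : G, WordMetricSpace.of g' = g := ⟨g, rfl⟩
    obtain ⟨h, rfl⟩ : ∃ h' : G, WordMetricSpace.of h' = h := ⟨h, rfl⟩
    have hfgh : (f * g)⁻¹ * (f * h) = g⁻¹ * h := by group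
    rw [WordMetricSpace.dist_of, ← hfgh]
    exact WordMetricSpace.dist_of (f * g) (f * h)⟩

theorem exists_not_isRealTree (hfin : S.Finite) (F : ℕ → Subgroup G) [∀ n, Finite (F n)]
    (hF : ∀ n, F n ≠ ⊥) (hmono : Monotone F) (hcard : ∀ k, ∃ n, k < Nat.card (F n)) :
    ∃ d : ScalingSequence, ∀ ω : Ultrafilter ℕ, ¬ IsRealTree (GroupAsymptoticCone S hS ω d) := by
  choose x hx using fun n => exists_wordLength_conj_le S (F n)
  refine ⟨⟨fun n => conjugationRadius S (F n), fun n => Nat.cast_pos.2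
    (conjugationRadius_pos hS (hF n)), fun m n hmn => Nat.cast_le.2
    (conjugationRadius_mono (hmono hmn)), not_bddAbove_conjugationRadius hS hfin F hcard⟩,
    fun ω => not_isRealTree_asymptoticCone
      (fun n => (F n).map (MulAut.conj (x n)⁻¹).toMonoidHom) (fun n => ?_) fun n y => ?_⟩
  · rintro _ ⟨f, hf, rfl⟩
    rw [WordMetricSpace.dist_smul_of, inv_one, one_mul, mul_one]
    simpa using hx n f hf
  · obtain ⟨y, rfl⟩ : ∃ g : G, WordMetricSpace.of g = y := ⟨y, rfl⟩
    obtain ⟨f, hf, hle⟩ := exists_le_wordLength_conj S (F n) (x n * y)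
    refine ⟨_, ⟨f, hf, rfl⟩, ?_⟩
    rw [WordMetricSpace.dist_smul_of]
    simpa [mul_assoc] using hle

end LeftTranslation

/-! ### Cones of lacunary hyperbolic groups -/

/-- The scaling sequence `(n + 1) (δ n + 1)`, against which a monotone sequence `δ` of hyperbolicity
constants becomes negligible. -/
def lacunaryScaling {δ : ℕ → ℕ} (hδ : Monotone δ) : ScalingSequence where
  toFun n := ((n + 1) * (δ n + 1) : ℕ)
  pos _ := Nat.cast_pos.2 (by positivity)
  mono m n hmn := Nat.cast_le.2
    (Nat.mul_le_mul (Nat.add_le_add_right hmn 1) (Nat.add_le_add_right (hδ hmn) 1))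
  unbounded := by
    rintro ⟨B, hB⟩
    obtain ⟨n, hn⟩ := exists_nat_gt B
    have hle : ((n + 1) * (δ n + 1) : ℕ) ≤ B := hB ⟨n, rfl⟩
    have hlt : n < (n + 1) * (δ n + 1) :=
      n.lt_succ_self.trans_le (Nat.le_mul_of_pos_right _ (by simp))
    exact (hn.trans (Nat.cast_lt.2 hlt)).not_ge hle

theorem lacunaryScaling_apply {δ : ℕ → ℕ} (hδ : Monotone δ) (n : ℕ) :
    lacunaryScaling hδ n = ((n + 1) * (δ n + 1) : ℕ) :=
  rfl

theorem tendsto_div_lacunaryScaling {δ : ℕ → ℕ} (hδ : Monotone δ) :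
    Tendsto (fun n => (δ n : ℝ) / lacunaryScaling hδ n) atTop (𝓝 0) := by
  refine squeeze_zero (fun n => div_nonneg (Nat.cast_nonneg _) (ScalingSequence.pos _ n).le)
    (fun n => ?_) (tendsto_one_div_add_atTop_nhds_zero_nat (𝕜 := ℝ))
  rw [lacunaryScaling_apply, div_le_div_iff₀ (by positivity) (by positivity)]
  push_cast
  nlinarith [Nat.cast_nonneg (α := ℝ) n]

theorem isRealTree_groupAsymptoticCone {G : Type*} [Group G] {S : Set G}
    (hS : Subgroup.closure S = ⊤) {δ : ℕ → ℕ} (hδ : Monotone δ)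
    (h : ∀ n : ℕ, ∀ x y z w : G,
      wordLength S x ≤ (n + 1) * ((n + 1) * (δ n + 1)) →
      wordLength S y ≤ (n + 1) * ((n + 1) * (δ n + 1)) →
      wordLength S z ≤ (n + 1) * ((n + 1) * (δ n + 1)) →
      wordLength S w ≤ (n + 1) * ((n + 1) * (δ n + 1)) → FourPoint S (δ n) x y z w)
    {ω : Ultrafilter ℕ} (hω : IsNonprincipal ω) :
    IsRealTree (GroupAsymptoticCone S hS ω (lacunaryScaling hδ)) := by
  refine IsZeroHyperbolic.isRealTree (isZeroHyperbolic_asymptoticCone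
    ((tendsto_div_lacunaryScaling hδ).mono_left hω.le_atTop) fun C => ?_)
    (isGeodesicSpace_groupAsymptoticCone S hS hω _)
  obtain ⟨N, hN⟩ := exists_nat_ge C
  filter_upwards [hω.le_atTop (eventually_ge_atTop N)] with n hn
  have hball : ∀ g : G, dist (WordMetricSpace.of g : WordMetricSpace S hS) (.of 1) ≤
      C * lacunaryScaling hδ n → wordLength S g ≤ (n + 1) * ((n + 1) * (δ n + 1)) := by
    intro g hg
    rw [WordMetricSpace.dist_of, mul_one, wordLength_inv hS] at hg
    have hCn : C ≤ (n + 1 : ℕ) := hN.trans (Nat.cast_le.2 (hn.trans n.le_succ))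
    have := hg.trans (mul_le_mul_of_nonneg_right hCn (ScalingSequence.pos _ n).le)
    rw [lacunaryScaling_apply] at this
    exact_mod_cast this
  intro (x : G) (y : G) (z : G) (w : G) hx hy hz hw
  have hfour := h n x y z w (hball x hx) (hball y hy) (hball z hz) (hball w hw)
  rw [FourPoint, ← Nat.cast_le (α := ℝ)] at hfour
  push_cast at hfour
  exact hfour

namespace LocalPresentation

variable {p : ℕ} {c : ℕ+ → ℕ+} {A : Type*} [Group A] (M : LocalPresentation p c Set.univ A)

theorem lt_card_window [Fact p.Prime] (k : ℕ) : k < Nat.card (M.window 0 k) := by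
  have hle : (k : ℤ) - 0 ≤ (k.succPNat : ℕ) := by simp
  have := M.finite_window (NeZero.pos p) (Set.mem_univ _) hle
  have hinj : Function.Injective fun i : Fin (k + 1) =>
      (⟨M.gen (i : ℕ), M.gen_mem_window ⟨by omega, by omega⟩⟩ : M.window 0 k) :=
    fun i j hij => Fin.ext <| Nat.cast_injective <|
      M.gen_injective (Fact.out : p.Prime).ne_one (congrArg Subtype.val hij)
  have hcard := Nat.card_le_card_of_injective _ hinj
  rwa [Nat.card_fin] at hcard

theorem exists_not_isRealTree [Fact p.Prime] {S : Set M.Ext} (hS : Subgroup.closure S = ⊤)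
    (hfin : S.Finite) :
    ∃ d : ScalingSequence, ∀ ω : Ultrafilter ℕ, ¬ IsRealTree (GroupAsymptoticCone S hS ω d) := by
  let F (n : ℕ) : Subgroup M.Ext := (M.window 0 (n + 1 : ℕ)).map SemidirectProduct.inl
  have hcard : ∀ n, n + 1 < Nat.card (F n) := fun n => by
    rw [Subgroup.card_map_of_injective SemidirectProduct.inl_injective]
    exact M.lt_card_window (n + 1)
  have : ∀ n, Finite (F n) := fun n => Nat.finite_of_card_ne_zero (hcard n).ne_bot
  refine _root_.exists_not_isRealTree hfin F (fun n => ?_)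
    (fun m n hmn => Subgroup.map_mono (M.window_mono le_rfl (by omega)))
    fun k => ⟨k, (Nat.lt_succ_self k).trans (hcard k)⟩
  exact (F n).one_lt_card_iff_ne_bot.1 ((Nat.le_add_left 1 n).trans_lt (hcard n))

theorem not_isVirtuallyCyclic [Fact p.Prime] : ¬ IsVirtuallyCyclic M.Ext := by
  have hp : p.Prime := Fact.out
  have := Infinite.of_injective M.gen (M.gen_injective hp.ne_one)
  exact not_isVirtuallyCyclic_of_injective
    (fun a => (M.isPGroup hp.pos).isOfFinOrder hp.ne_zero a) SemidirectProduct.inl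
    SemidirectProduct.inl_injective

end LocalPresentation

/-- The first part lists the properties of `G(p, c)` for all `p` and `c`; the second part provides
`c` (for each `p`) and a scaling sequence `d` for which all asymptotic cones `Con^ω(G, d)` are
`ℝ`-trees, while `G` also has two non-homeomorphic asymptotic cones. -/
theorem theorem3p25 (p : ℕ) (hp : p.Prime) :
    (∀ c : ℕ+ → ℕ+, Monotone c →
      IsTwoGenerated (GroupG p c) ∧
      IsLocallyNilpotentPGroupByInfiniteCyclic p (GroupG p c) ∧
      IsElementaryAmenable (GroupG p c) ∧
      IsAmenableGroup (GroupG p c) ∧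
      (∃ f : GroupG p c →* WreathZModInt p, Function.Surjective f) ∧
      ¬ IsVirtuallyCyclic (GroupG p c) ∧
      IsResiduallyFinitePGroup p (GroupG p c) ∧
      IsResiduallyNilpotent (GroupG p c)) ∧
    ∃ c : ℕ+ → ℕ+, Monotone c ∧
      (∃ d : ScalingSequence, ∀ ω : Ultrafilter ℕ, IsNonprincipal ω →
        ∀ (S : Set (GroupG p c)) (hS : Subgroup.closure S = ⊤), S.Finite →
          IsRealTree (GroupAsymptoticCone S hS ω d)) ∧
      ∀ (S : Set (GroupG p c)) (hS : Subgroup.closure S = ⊤), S.Finite →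
        ∃ (ω₁ ω₂ : Ultrafilter ℕ) (d₁ d₂ : ScalingSequence),
          IsNonprincipal ω₁ ∧ IsNonprincipal ω₂ ∧
          IsEmpty (GroupAsymptoticCone S hS ω₁ d₁ ≃ₜ GroupAsymptoticCone S hS ω₂ d₂) := by
  have : Fact p.Prime := ⟨hp⟩
  refine ⟨fun c _ => ?_, ?_⟩
  · let M := LocalPresentation.groupA p c
    have hfin : IsLocallyFiniteGroup (GroupA p c) := M.isLocallyFiniteGroup hp.pos
    have hres : IsResiduallyFinitePGroup p (GroupG p c) := M.isResiduallyFinitePGroup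
    exact ⟨⟨M.base, M.stable, M.closure_base_stable⟩,
      isLocallyNilpotentPGroupByInfiniteCyclic_semidirectProduct _ hfin (M.isPGroup hp.pos),
      isElementaryAmenable_semidirectProduct _ hfin.isElementaryAmenable (.of_comm _ mul_comm),
      isAmenableGroup_semidirectProduct_int hfin _, M.exists_surjective_wreath,
      M.not_isVirtuallyCyclic, hres, hres.isResiduallyNilpotent⟩
  obtain ⟨c, hc, δ, hδ, hfour⟩ := LocalPresentation.exists_lacunary p
  let M := LocalPresentation.groupA p c
  let d := lacunaryScaling hδ
  have htree : ∀ ω : Ultrafilter ℕ, IsNonprincipal ω →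
      ∀ (S : Set (GroupG p c)) (hS : Subgroup.closure S = ⊤), S.Finite →
        IsRealTree (GroupAsymptoticCone S hS ω d) := fun ω hω S hS hfin =>
    (isRealTree_groupAsymptoticCone M.closure_base_stable hδ hfour hω).groupAsymptoticCone
      (Set.toFinite _) hfin hω
  refine ⟨c, hc, ⟨d, htree⟩, fun S hS hfin => ?_⟩
  obtain ⟨d₂, hd₂⟩ := M.exists_not_isRealTree hS hfin
  have hω : IsNonprincipal (hyperfilter ℕ) := fun s hs => notMem_hyperfilter_of_finite hs
  exact ⟨hyperfilter ℕ, hyperfilter ℕ, d, d₂, hω, hω, ⟨fun e => hd₂ _ <|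
    (htree _ hω S hS hfin).of_injective (isGeodesicSpace_groupAsymptoticCone S hS hω d₂)
      ⟨e.symm, e.symm.continuous⟩ e.symm.injective⟩⟩
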